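/- All $C^*$-algebras are unital and $\otimes$ is the minimal tensor product. A compact quantum group (CQG, or Woronowicz $C^*$-algebra) $(\mathcal A,\Delta)$ is a $C^*$-algebra with a co-associative unital $*$-homomorphism $\Delta:\mathcal A\to\mathcal A\otimes\mathcal A$ such that $\Delta(\mathcal A)(\mathcal A\otimes 1)$ and $\Delta(\mathcal A)(1\otimes\mathcal A)$ span dense subspaces. A $C^*$-subalgebra $\mathcal B\subseteq\mathcal A$ is a Woronowicz $C^*$-subalgebra if $\Delta$ restricts to a co-product $\Delta'$ making $(\mathcal B,\Delta')$ a CQG. A co-action of $(\mathcal A,\Delta)$ on a finite set $X$ is a unital $*$-homomorphism $\alpha:C(X)\to C(X)\otimes\mathcal A$ with $(\alpha\otimes\mathrm{id})\alpha=(\mathrm{id}\otimes\Delta)\alpha$ and $\alpha(C(X))(1\otimes\mathcal A)$ spanning a dense subspace. **Co-actions on multigraphs.** Let $(V,E)$ be a finite directed multigraph without isolated vertices, not necessarily uniform, and let $E^i_j$ be the set of edges from $i$ to $j$. Let $\beta:L^2(E)\to L^2(E)\otimes\mathcal A$, $\beta(\chi_\tau)=\sum_{\sigma\in E}\chi_\sigma\otimes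 u^\sigma_\tau$, be a bi-unitary co-representation of a CQG $(\mathcal A,\Delta)$, that is, $(u^\sigma_\tau)$ and $(u^{\sigma*}_\tau)$ are unitary matrices and $\Delta(u^\sigma_\tau)=\sum_\rho u^\sigma_\rho\otimes u^\rho_\tau$. It is faithful if the $u^\sigma_\tau$ generate the $C^*$-algebra $\mathcal A$. A co-action $\alpha$ on $V$ and $\beta$ respect the bimodule structure if $\beta(f\cdot g)=\alpha(f)\beta(g)$ and $\beta(g\cdot f)=\beta(g)\alpha(f)$ for $f\in C(V)$, $g\in L^2(E)$, where $f\cdot g$ and $g\cdot f$ are $g$ multiplied by the value of $f$ at the source and at the target of the edge. * $\beta$ *preserves quantum symmetry in our sense*, $(\mathcal A,\Delta,\beta)\in\mathcal C^{sym}_{(V,E)}$, if some co-action $\alpha$ on $V$ and $\beta$ respect the bimodule structure, $\beta(\xi)=\xi\otimes1$ for $\xi=\sum_{\tau\in E}\chi_\tau$, and $u^\sigma_\tau u^{\sigma'*}_\tau=0=u^{\sigma*}_\tau u^{\sigma'}_\tau$ for all $\tau\in E$ and all distinct edges $\sigma,\sigma'$ with the same source and the same target. * $(\mathcal A,\Delta,\beta)\in\mathcal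 C^{Bic}_{(V,E)}$ if $\beta$ is a co-action on the algebra $C(E)$ and respects the bimodule structure together with some co-action on $V$. * $(\mathcal A,\Delta,\beta)$ is of *non-Bichon type* if $(\mathcal A,\Delta,\beta)\notin\mathcal C^{Bic}_{(V,E)}$ whenever $\mathcal C^{Bic}_{(V,E)}\ne\mathcal C^{sym}_{(V,E)}$. **The algebra $Q_{(V,E)}$.** Let $N=\max_{i,j}|E^i_j|$ and fix an edge-labeling, i.e. number the edges in each $E^i_j$ by $1,\dots,|E^i_j|$ and write $(i,j)r$ for the $r$-th one. Let $Q_{(V,E)}$ be the universal $C^*$-algebra generated by elements $q^{ks}_{ir}$ ($k,i\in V$; $s,r\in\{1,\dots,N\}$) subject to the relations: 1. (quantum permutation relations) each $q^{ks}_{ir}$ is a projection, $\sum_{i,r}q^{ks}_{ir}=1$ for all $(k,s)$ and $\sum_{k,s}q^{ks}_{ir}=1$ for all $(i,r)$; 2. $\sum_{r}q^{ks}_{ir}=\sum_r q^{ks'}_{ir}$ for all $k,i\in V$ and $s,s'\in\{1,\dots,N\}$; 3. for $(i,j)r\in E$, $k,l\in V$ and $s,s'\in\{1,\dots,N\}$: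 $q^{ks}_{ir}q^{ls'}_{jr}=0$ if $E^k_l=\emptyset$; $q^{ks}_{ir}q^{ls'}_{jr}=0$ if $E^k_l\ne\emptyset$ and $s\ne s'$; and $q^{ks}_{ir}q^{ls}_{jr}=0$ if $E^k_l\neq\emptyset$ and $s>|E^k_l|$. A pair $(k,s)$ is *permissible* if $(k,l)s\in E$ or $(l,k)s\in E$ for some $l\in V$. Let $Q'_{(V,E)}$ be the $C^*$-subalgebra of $Q_{(V,E)}$ generated by the $q^{ks}_{ir}$ with $(k,s)$ and $(i,r)$ permissible. **Proposition.** 1. $Q'_{(V,E)}$ is also the $C^*$-subalgebra generated by the elements $q^{ks}_{ir}q^{ls}_{jr}$ with $(k,l)s,(i,j)r\in E$. 2. There is a CQG structure $\Delta$ on $Q_{(V,E)}$ with $\Delta(q^{ks}_{ir})=\sum_{k'\in V}\sum_{s'=1}^N q^{ks}_{k's'}\otimes q^{k's'}_{ir}$, and $\Delta$ restricts to $Q'_{(V,E)}$, making it a Woronowicz $C^*$-subalgebra $(Q'_{(V,E)},\Delta')$ of $(Q_{(V,E)},\Delta)$. 3. The formula $\beta(\chi_{(i,j)r})=\sum_{(k,l)s\in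 E}\chi_{(k,l)s}\otimes q^{ks}_{ir}q^{ls}_{jr}$ defines a faithful bi-unitary co-representation $\beta$ of $(Q'_{(V,E)},\Delta')$ on $L^2(E)$ that preserves quantum symmetry of $(V,E)$ in our sense and is of non-Bichon type. -/

import Mathlib

open scoped TensorProduct

universe u v w

noncomputable section

/-! ### C*-seminorms and C*-completions -/

theorem starAlgHom_continuous {A : Type u} {B : Type v} [CStarAlgebra A] [CStarAlgebra B]
    (f : A →⋆ₐ[ℂ] B) : Continuous f :=
  AddMonoidHomClass.continuous_of_bound f 1 fun x => by
    simpa using NonUnitalStarAlgHom.norm_apply_le f x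

/-- A C*-seminorm on a complex unital *-algebra. -/
structure CStarSeminorm (R : Type u) [Ring R] [StarRing R] [Algebra ℂ R] extends
    Seminorm ℂ R where
  mul_le' : ∀ x y, toFun (x * y) ≤ toFun x * toFun y
  star_mul_self' : ∀ x, toFun (star x * x) = toFun x * toFun x

namespace CStarSeminorm

section
variable {R : Type u} [Ring R] [StarRing R] [Algebra ℂ R]

instance : CoeFun (CStarSeminorm R) (fun _ => R → ℝ) := ⟨fun p => p.toFun⟩

theorem nonneg (p : CStarSeminorm R) (x : R) : 0 ≤ p x := apply_nonneg p.toSeminorm x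

theorem le_star (p : CStarSeminorm R) (x : R) : p x ≤ p (star x) := by
  by_contra! h
  have h1 := p.mul_le' (star x) x
  rw [p.star_mul_self'] at h1
  have h2 := p.nonneg (star x)
  nlinarith

theorem star_eq (p : CStarSeminorm R) (x : R) : p (star x) = p x :=
  le_antisymm (by simpa using p.le_star (star x)) (p.le_star x)

/-- The C*-seminorm `x ↦ ‖φ x‖` of a *-homomorphism into a C*-algebra. -/
def ofHom {B : Type v} [CStarAlgebra B] (φ : R →⋆ₐ[ℂ] B) : CStarSeminorm R where
  toFun x := ‖φ x‖
  map_zero' := by simp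
  add_le' x y := by simpa using norm_add_le (φ x) (φ y)
  neg' x := by simp
  smul' a x := by simp [norm_smul]
  mul_le' x y := by simpa using norm_mul_le (φ x) (φ y)
  star_mul_self' x := by
    rw [map_mul, map_star]; exact CStarRing.norm_star_mul_self

/-- The pointwise supremum of a pointwise bounded set of C*-seminorms. -/
def sup (S : Set (CStarSeminorm R)) (hS : ∀ x, BddAbove (Set.range fun p : S => p.1 x)) :
    CStarSeminorm R where
  toFun x := ⨆ p : S, p.1 x
  map_zero' := by
    have : ∀ p : S, p.1 (0 : R) = 0 := fun p => map_zero p.1.toSeminorm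
    simp [this]
  add_le' x y := by
    refine Real.iSup_le (fun p => ?_) (add_nonneg (Real.iSup_nonneg fun p => p.1.nonneg x)
      (Real.iSup_nonneg fun p => p.1.nonneg y))
    exact (p.1.add_le' x y).trans (add_le_add (le_ciSup (hS x) p) (le_ciSup (hS y) p))
  neg' x := by
    congr 1; funext p; exact p.1.neg' x
  smul' a x := by
    rw [Real.mul_iSup_of_nonneg (norm_nonneg a)]
    congr 1; funext p; exact p.1.smul' a x
  mul_le' x y := by
    refine Real.iSup_le (fun p => ?_) (mul_nonneg (Real.iSup_nonneg fun p => p.1.nonneg x)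
      (Real.iSup_nonneg fun p => p.1.nonneg y))
    exact (p.1.mul_le' x y).trans (mul_le_mul (le_ciSup (hS x) p) (le_ciSup (hS y) p)
      (p.1.nonneg y) (Real.iSup_nonneg fun p => p.1.nonneg x))
  star_mul_self' x := by
    have h0 : 0 ≤ ⨆ p : S, p.1 x := Real.iSup_nonneg fun p => p.1.nonneg x
    apply le_antisymm
    · refine Real.iSup_le (fun p => ?_) (mul_nonneg h0 h0)
      rw [p.1.star_mul_self']
      exact mul_le_mul (le_ciSup (hS x) p) (le_ciSup (hS x) p) (p.1.nonneg x) h0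
    · have h1 : 0 ≤ ⨆ p : S, p.1 (star x * x) := Real.iSup_nonneg fun p => p.1.nonneg _
      have h2 : (⨆ p : S, p.1 x) ≤ Real.sqrt (⨆ p : S, p.1 (star x * x)) := by
        refine Real.iSup_le (fun p => ?_) (Real.sqrt_nonneg _)
        apply Real.le_sqrt_of_sq_le
        have := le_ciSup (hS (star x * x)) p
        simp only [p.1.star_mul_self'] at this
        rw [sq]
        exact this
      calc _ ≤ Real.sqrt (⨆ p : S, p.1 (star x * x)) * Real.sqrt (⨆ p : S, p.1 (star x * x)) :=
            mul_le_mul h2 h2 h0 (Real.sqrt_nonneg _)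
        _ = _ := Real.mul_self_sqrt h1

theorem le_sup (S : Set (CStarSeminorm R)) (hS) (p : CStarSeminorm R) (hp : p ∈ S) (x : R) :
    p x ≤ sup S hS x := le_ciSup (hS x) ⟨p, hp⟩

/-- The *-algebra `R`, regarded as a seminormed ring through `p`. -/
def Pre (_p : CStarSeminorm R) : Type u := R

variable (p : CStarSeminorm R)

instance : Ring p.Pre := inferInstanceAs (Ring R)
instance : Algebra ℂ p.Pre := inferInstanceAs (Algebra ℂ R)
instance : StarRing p.Pre := inferInstanceAs (StarRing R)
instance [StarModule ℂ R] : StarModule ℂ p.Pre := inferInstanceAs (StarModule ℂ R)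

instance : SeminormedRing p.Pre where
  toRing := inferInstance
  norm x := p (show R from x)
  toPseudoMetricSpace := p.toSeminorm.toAddGroupSeminorm.toSeminormedAddCommGroup.toPseudoMetricSpace
  dist_eq := p.toSeminorm.toAddGroupSeminorm.toSeminormedAddCommGroup.dist_eq
  norm_mul_le x y := p.mul_le' x y

theorem norm_pre (x : p.Pre) : ‖x‖ = p (show R from x) := rfl

instance : NormedAlgebra ℂ p.Pre where
  norm_smul_le a x := (p.smul' a x).le

instance : NormedStarGroup p.Pre where
  norm_star_le x := (p.star_eq x).le

/-- The C*-algebra obtained from a *-algebra and a C*-seminorm on it, by separation and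
completion. -/
def Compl : Type u := UniformSpace.Completion p.Pre

instance : NormedRing p.Compl := inferInstanceAs (NormedRing (UniformSpace.Completion p.Pre))
instance : Algebra ℂ p.Compl := inferInstanceAs (Algebra ℂ (UniformSpace.Completion p.Pre))
instance : NormedSpace ℂ p.Compl := inferInstanceAs (NormedSpace ℂ (UniformSpace.Completion p.Pre))
instance : CompleteSpace p.Compl :=
  inferInstanceAs (CompleteSpace (UniformSpace.Completion p.Pre))

/-- The canonical map to the completion. -/
def toCompl (x : R) : p.Compl := UniformSpace.Completion.coe' (α := p.Pre) x

theorem norm_toCompl (x : R) : ‖p.toCompl x‖ = p x :=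
  UniformSpace.Completion.norm_coe (E := p.Pre) x

theorem denseRange_toCompl : DenseRange p.toCompl :=
  UniformSpace.Completion.denseRange_coe (α := p.Pre)

theorem toCompl_add (x y : R) : p.toCompl (x + y) = p.toCompl x + p.toCompl y :=
  UniformSpace.Completion.coe_add (α := p.Pre) x y

theorem toCompl_mul (x y : R) : p.toCompl (x * y) = p.toCompl x * p.toCompl y :=
  UniformSpace.Completion.coe_mul (α := p.Pre) x y

theorem toCompl_one : p.toCompl 1 = 1 := UniformSpace.Completion.coe_one p.Pre

theorem toCompl_algebraMap (z : ℂ) : p.toCompl (algebraMap ℂ R z) = algebraMap ℂ p.Compl z := rfl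

theorem toCompl_smul (z : ℂ) (x : R) : p.toCompl (z • x) = z • p.toCompl x := by
  rw [Algebra.smul_def, Algebra.smul_def, toCompl_mul, toCompl_algebraMap]

instance : NormedAlgebra ℂ p.Compl where
  norm_smul_le a x := norm_smul_le (α := ℂ) (β := p.Compl) a x

instance : Star p.Compl :=
  ⟨UniformSpace.Completion.map (α := p.Pre) (β := p.Pre) star⟩

theorem continuous_star : Continuous (star : p.Compl → p.Compl) :=
  UniformSpace.Completion.continuous_map

theorem toCompl_star (x : R) : p.toCompl (star x) = star (p.toCompl x) :=
  (UniformSpace.Completion.map_coe (f := (star : p.Pre → p.Pre))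
    (starNormedAddGroupHom (E := p.Pre)).uniformContinuous x).symm

theorem induction {P : p.Compl → Prop} (hP : IsClosed {x | P x}) (h : ∀ x, P (p.toCompl x))
    (x : p.Compl) : P x :=
  UniformSpace.Completion.induction_on (α := p.Pre) x hP h

theorem induction₂ {P : p.Compl → p.Compl → Prop} (hP : IsClosed {x : p.Compl × p.Compl | P x.1 x.2})
    (h : ∀ x y, P (p.toCompl x) (p.toCompl y)) (x y : p.Compl) : P x y :=
  UniformSpace.Completion.induction_on₂ (α := p.Pre) (β := p.Pre) x y hP h

instance : StarRing p.Compl where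
  star_involutive x := by
    refine p.induction (P := fun x => star (star x) = x) ?_ ?_ x
    · exact isClosed_eq (p.continuous_star.comp p.continuous_star) continuous_id
    · intro x; rw [← toCompl_star, ← toCompl_star, star_star]
  star_mul x y := by
    refine p.induction₂ (P := fun x y => star (x * y) = star y * star x) ?_ ?_ x y
    · exact isClosed_eq (p.continuous_star.comp continuous_mul)
        ((p.continuous_star.comp continuous_snd).mul (p.continuous_star.comp continuous_fst))
    · intro x y; rw [← toCompl_star, ← toCompl_star, ← toCompl_mul, ← toCompl_mul, ← toCompl_star,
        star_mul]
  star_add x y := by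
    refine p.induction₂ (P := fun x y => star (x + y) = star x + star y) ?_ ?_ x y
    · exact isClosed_eq (p.continuous_star.comp continuous_add)
        ((p.continuous_star.comp continuous_fst).add (p.continuous_star.comp continuous_snd))
    · intro x y; rw [← toCompl_star, ← toCompl_star, ← toCompl_add, ← toCompl_add, ← toCompl_star,
        star_add]

instance : CStarRing p.Compl where
  norm_mul_self_le x := by
    refine p.induction (P := fun x => ‖x‖ * ‖x‖ ≤ ‖star x * x‖) ?_ ?_ x
    · exact isClosed_le (by fun_prop) (p.continuous_star.mul continuous_id).norm
    · intro x
      rw [← toCompl_star, ← toCompl_mul, norm_toCompl, norm_toCompl, p.star_mul_self']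

instance [StarModule ℂ R] : StarModule ℂ p.Compl where
  star_smul z x := by
    refine p.induction (P := fun x => star (z • x) = star z • star x) ?_ ?_ x
    · exact isClosed_eq (p.continuous_star.comp (continuous_const_smul z))
        (p.continuous_star.const_smul (star z))
    · intro x
      rw [← toCompl_smul, ← toCompl_star, ← toCompl_star, ← toCompl_smul, star_smul]

instance [StarModule ℂ R] : CStarAlgebra p.Compl where

/-- The canonical *-homomorphism to the completion. -/
def of : R →⋆ₐ[ℂ] p.Compl where
  toFun := p.toCompl
  map_one' := p.toCompl_one
  map_mul' := p.toCompl_mul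
  map_zero' := UniformSpace.Completion.coe_zero (α := p.Pre)
  map_add' := p.toCompl_add
  commutes' := p.toCompl_algebraMap
  map_star' := p.toCompl_star

theorem norm_of (x : R) : ‖p.of x‖ = p x := p.norm_toCompl x

theorem denseRange_of : DenseRange p.of := p.denseRange_toCompl

/-- A *-homomorphism into a C*-algebra that is dominated by `p` extends to the completion. -/
def lift {B : Type v} [CStarAlgebra B] (φ : R →⋆ₐ[ℂ] B) (h : ∀ x, ‖φ x‖ ≤ p x) :
    p.Compl →⋆ₐ[ℂ] B :=
  let f : p.Pre →L[ℂ] B := LinearMap.mkContinuous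
    (show p.Pre →ₗ[ℂ] B from (φ : R →ₐ[ℂ] B).toLinearMap) 1
    (fun x => (h x).trans_eq (one_mul _).symm)
  let F : p.Compl →L[ℂ] B := f.fromCompletion
  have hF : ∀ x : R, F (p.toCompl x) = φ x := fun x => f.fromCompletion_apply_coe x
  { toFun := F
    map_one' := by rw [← toCompl_one, hF, map_one]
    map_mul' x y := by
      refine p.induction₂ (P := fun x y => F (x * y) = F x * F y) ?_ ?_ x y
      · exact isClosed_eq (by fun_prop) (by fun_prop)
      · intro x y; rw [← toCompl_mul, hF, hF, hF, map_mul]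
    map_zero' := map_zero F
    map_add' := map_add F
    commutes' z := by rw [← toCompl_algebraMap, hF, AlgHomClass.commutes]
    map_star' x := by
      refine p.induction (P := fun x => F (star x) = star (F x)) ?_ ?_ x
      · exact isClosed_eq (F.continuous.comp p.continuous_star) (by fun_prop)
      · intro x; rw [← toCompl_star, hF, hF, map_star] }

theorem lift_of {B : Type v} [CStarAlgebra B] (φ : R →⋆ₐ[ℂ] B) (h : ∀ x, ‖φ x‖ ≤ p x) (x : R) :
    p.lift φ h (p.of x) = φ x :=
  ContinuousLinearMap.fromCompletion_apply_coe (α := p.Pre) _ _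

theorem hom_ext [StarModule ℂ R] {B : Type v} [CStarAlgebra B] {f g : p.Compl →⋆ₐ[ℂ] B}
    (h : ∀ x, f (p.of x) = g (p.of x)) : f = g := by
  ext x
  refine p.induction (P := fun x => f x = g x) ?_ h x
  exact isClosed_eq (starAlgHom_continuous f) (starAlgHom_continuous g)

end

end CStarSeminorm

/-! ### Minimal tensor products -/

/-- The Hilbert space tensor product: the completion of the algebraic tensor product. -/
abbrev HilbertTensor (H : Type u) (K : Type v) [NormedAddCommGroup H] [InnerProductSpace ℂ H]
    [NormedAddCommGroup K] [InnerProductSpace ℂ K] : Type (max u v) :=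
  UniformSpace.Completion (H ⊗[ℂ] K)

/-- The C*-algebra of bounded operators on a Hilbert space. -/
def BOp (H : Type u) [NormedAddCommGroup H] [InnerProductSpace ℂ H] : Type u := H →L[ℂ] H

instance (H : Type u) [NormedAddCommGroup H] [InnerProductSpace ℂ H] [CompleteSpace H] :
    CStarAlgebra (BOp H) := inferInstanceAs (CStarAlgebra (H →L[ℂ] H))

section Hilbert

variable {H : Type u} {K : Type v} [NormedAddCommGroup H] [InnerProductSpace ℂ H]
  [NormedAddCommGroup K] [InnerProductSpace ℂ K]

/-- The operator `S ⊗ T` on the Hilbert space tensor product. -/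
def opTensor (S : H →L[ℂ] H) (T : K →L[ℂ] K) : HilbertTensor H K →L[ℂ] HilbertTensor H K :=
  (TensorProduct.mapL S T).completion

theorem opTensor_coe (S : H →L[ℂ] H) (T : K →L[ℂ] K) (x : H ⊗[ℂ] K) :
    opTensor S T (x : HilbertTensor H K) = (TensorProduct.mapL S T x : H ⊗[ℂ] K) :=
  ContinuousLinearMap.completion_apply_coe _ _

theorem HilbertTensor.op_ext {A B : HilbertTensor H K →L[ℂ] HilbertTensor H K}
    (h : ∀ x y, A ((x ⊗ₜ[ℂ] y : H ⊗[ℂ] K) : HilbertTensor H K) =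
      B ((x ⊗ₜ[ℂ] y : H ⊗[ℂ] K) : HilbertTensor H K)) : A = B := by
  ext z
  refine UniformSpace.Completion.induction_on z (isClosed_eq A.continuous B.continuous) ?_
  intro z
  induction z with
  | zero => rw [UniformSpace.Completion.coe_zero, map_zero, map_zero]
  | tmul x y => exact h x y
  | add x y hx hy => rw [UniformSpace.Completion.coe_add, map_add, map_add, hx, hy]

theorem opTensor_mul (S S' : H →L[ℂ] H) (T T' : K →L[ℂ] K) :
    opTensor (S * S') (T * T') = opTensor S T * opTensor S' T' :=
  HilbertTensor.op_ext fun x y => by simp [opTensor_coe]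

theorem opTensor_star [CompleteSpace H] [CompleteSpace K] (S : H →L[ℂ] H) (T : K →L[ℂ] K) :
    opTensor (star S) (star T) = star (opTensor S T) := by
  rw [ContinuousLinearMap.star_eq_adjoint (opTensor S T), ContinuousLinearMap.eq_adjoint_iff]
  intro x y
  refine UniformSpace.Completion.induction_on₂ x y (isClosed_eq (by fun_prop) (by fun_prop)) ?_
  intro x y
  simp only [opTensor_coe, UniformSpace.Completion.inner_coe]
  induction x with
  | zero => simp
  | add x x' hx hx' => simp only [map_add, inner_add_left, hx, hx']
  | tmul a b =>
    induction y with
    | zero => simp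
    | add x x' hx hx' => simp only [map_add, inner_add_right, hx, hx']
    | tmul c d => simp [ContinuousLinearMap.star_eq_adjoint, ContinuousLinearMap.adjoint_inner_left]

/-- `S ⊗ T`, as an element of the C*-algebra of bounded operators. -/
def BOp.tensor (S : BOp H) (T : BOp K) : BOp (HilbertTensor H K) := opTensor S T

variable [CompleteSpace H] [CompleteSpace K]

theorem BOp.tensor_mul (S S' : BOp H) (T T' : BOp K) :
    (S * S').tensor (T * T') = S.tensor T * S'.tensor T' := opTensor_mul S S' T T'

theorem BOp.one_tensor_one : (1 : BOp H).tensor (1 : BOp K) = 1 :=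
  HilbertTensor.op_ext fun x y => by
    change opTensor (1 : H →L[ℂ] H) (1 : K →L[ℂ] K) _ = _
    simp only [opTensor_coe]; rfl

theorem BOp.tensor_star (S : BOp H) (T : BOp K) :
    (star S).tensor (star T) = star (S.tensor T) := opTensor_star S T

variable (H K) in
/-- `S ↦ S ⊗ 1`. -/
def ampLeft : BOp H →⋆ₐ[ℂ] BOp (HilbertTensor H K) where
  toFun S := S.tensor 1
  map_one' := BOp.one_tensor_one
  map_mul' S S' := by rw [← BOp.tensor_mul, one_mul]
  map_zero' := HilbertTensor.op_ext fun x y => by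
    change opTensor (0 : H →L[ℂ] H) (1 : K →L[ℂ] K) _ = (0 : _ →L[ℂ] _) _
    simp [opTensor_coe]
  map_add' S S' := HilbertTensor.op_ext fun x y => by
    let S₁ : H →L[ℂ] H := S
    let S₂ : H →L[ℂ] H := S'
    change opTensor (S₁ + S₂) (1 : K →L[ℂ] K) _ =
      (opTensor S₁ (1 : K →L[ℂ] K) + opTensor S₂ (1 : K →L[ℂ] K)) _
    simp [opTensor_coe, TensorProduct.add_tmul, UniformSpace.Completion.coe_add]
  commutes' z := HilbertTensor.op_ext fun x y => by
    change opTensor (algebraMap ℂ (H →L[ℂ] H) z) (1 : K →L[ℂ] K) _ =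
      algebraMap ℂ (HilbertTensor H K →L[ℂ] HilbertTensor H K) z _
    simp [opTensor_coe, Algebra.algebraMap_eq_smul_one, ← TensorProduct.smul_tmul']
  map_star' S := by rw [← BOp.tensor_star, star_one]

variable (H K) in
/-- `T ↦ 1 ⊗ T`. -/
def ampRight : BOp K →⋆ₐ[ℂ] BOp (HilbertTensor H K) where
  toFun T := (1 : BOp H).tensor T
  map_one' := BOp.one_tensor_one
  map_mul' S S' := by rw [← BOp.tensor_mul, one_mul]
  map_zero' := HilbertTensor.op_ext fun x y => by
    change opTensor (1 : H →L[ℂ] H) (0 : K →L[ℂ] K) _ = (0 : _ →L[ℂ] _) _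
    simp [opTensor_coe]
  map_add' S S' := HilbertTensor.op_ext fun x y => by
    let S₁ : K →L[ℂ] K := S
    let S₂ : K →L[ℂ] K := S'
    change opTensor (1 : H →L[ℂ] H) (S₁ + S₂) _ =
      (opTensor (1 : H →L[ℂ] H) S₁ + opTensor (1 : H →L[ℂ] H) S₂) _
    simp [opTensor_coe, TensorProduct.tmul_add, UniformSpace.Completion.coe_add]
  commutes' z := HilbertTensor.op_ext fun x y => by
    change opTensor (1 : H →L[ℂ] H) (algebraMap ℂ (K →L[ℂ] K) z) _ =
      algebraMap ℂ (HilbertTensor H K →L[ℂ] HilbertTensor H K) z _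
    simp [opTensor_coe, Algebra.algebraMap_eq_smul_one]
  map_star' S := by rw [← BOp.tensor_star, star_one]

theorem ampLeft_apply (S : BOp H) : ampLeft H K S = S.tensor 1 := rfl

theorem ampRight_apply (T : BOp K) : ampRight H K T = (1 : BOp H).tensor T := rfl

theorem amp_mul (S : BOp H) (T : BOp K) : ampLeft H K S * ampRight H K T = S.tensor T := by
  rw [ampLeft_apply, ampRight_apply, ← BOp.tensor_mul, one_mul, mul_one]

theorem amp_commute (S : BOp H) (T : BOp K) : Commute (ampLeft H K S) (ampRight H K T) := by
  rw [Commute, SemiconjBy, ampLeft_apply, ampRight_apply, ← BOp.tensor_mul, ← BOp.tensor_mul,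
    one_mul, one_mul, mul_one, mul_one]

theorem BOp.norm_tensor_one_le (S : BOp H) : ‖S.tensor (1 : BOp K)‖ ≤ ‖S‖ :=
  NonUnitalStarAlgHom.norm_apply_le (ampLeft H K) S

theorem BOp.norm_one_tensor_le (T : BOp K) : ‖(1 : BOp H).tensor T‖ ≤ ‖T‖ :=
  NonUnitalStarAlgHom.norm_apply_le (ampRight H K) T

theorem BOp.norm_tensor_le (S : BOp H) (T : BOp K) : ‖S.tensor T‖ ≤ ‖S‖ * ‖T‖ := by
  rw [← amp_mul]
  exact (norm_mul_le _ _).trans (mul_le_mul (BOp.norm_tensor_one_le S) (BOp.norm_one_tensor_le T)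
    (norm_nonneg _) (norm_nonneg _))

/-- Conjugation by a unitary. -/
def conjHom (U : H ≃ₗᵢ[ℂ] K) : BOp H →⋆ₐ[ℂ] BOp K where
  toFun := U.conjStarAlgEquiv
  map_one' := map_one U.conjStarAlgEquiv
  map_mul' := map_mul U.conjStarAlgEquiv
  map_zero' := map_zero U.conjStarAlgEquiv
  map_add' := map_add U.conjStarAlgEquiv
  commutes' z := by
    change U.conjStarAlgEquiv (algebraMap ℂ (H →L[ℂ] H) z) = algebraMap ℂ (K →L[ℂ] K) z
    rw [Algebra.algebraMap_eq_smul_one, map_smul, map_one, Algebra.algebraMap_eq_smul_one]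
  map_star' := map_star U.conjStarAlgEquiv

theorem norm_conjHom (U : H ≃ₗᵢ[ℂ] K) (T : BOp H) :
    ‖conjHom U T‖ = ‖T‖ := StarAlgEquiv.norm_map U.conjStarAlgEquiv T

end Hilbert

/-- The *-homomorphism out of an algebraic tensor product given by two *-homomorphisms with
commuting ranges. -/
def tensorHom {R : Type*} {S : Type*} {B : Type*} [Ring R] [StarRing R] [Algebra ℂ R]
    [StarModule ℂ R] [Ring S] [StarRing S] [Algebra ℂ S] [StarModule ℂ S] [Ring B] [StarRing B]
    [Algebra ℂ B] (f : R →⋆ₐ[ℂ] B) (g : S →⋆ₐ[ℂ] B) (h : ∀ x y, Commute (f x) (g y)) :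
    R ⊗[ℂ] S →⋆ₐ[ℂ] B :=
  { Algebra.TensorProduct.lift (f : R →ₐ[ℂ] B) (g : S →ₐ[ℂ] B) h with
    map_star' := fun x => by
      change Algebra.TensorProduct.lift (f : R →ₐ[ℂ] B) (g : S →ₐ[ℂ] B) h (star x) =
        star (Algebra.TensorProduct.lift (f : R →ₐ[ℂ] B) (g : S →ₐ[ℂ] B) h x)
      induction x with
      | zero => simp
      | add x y hx hy => simp only [star_add, map_add, hx, hy]
      | tmul x y =>
        rw [TensorProduct.star_tmul, Algebra.TensorProduct.lift_tmul,
          Algebra.TensorProduct.lift_tmul]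
        change f (star x) * g (star y) = star (f x * g y)
        rw [(h x y).eq, star_mul, map_star f, map_star g] }

theorem tensorHom_tmul {R : Type*} {S : Type*} {B : Type*} [Ring R] [StarRing R] [Algebra ℂ R]
    [StarModule ℂ R] [Ring S] [StarRing S] [Algebra ℂ S] [StarModule ℂ S] [Ring B] [StarRing B]
    [Algebra ℂ B] (f : R →⋆ₐ[ℂ] B) (g : S →⋆ₐ[ℂ] B) (h : ∀ x y, Commute (f x) (g y)) (x : R)
    (y : S) : tensorHom f g h (x ⊗ₜ[ℂ] y) = f x * g y :=
  Algebra.TensorProduct.lift_tmul _ _ h x y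

section ProdRep

variable {R : Type*} {S : Type*} [Ring R] [StarRing R] [Algebra ℂ R]
    [StarModule ℂ R] [Ring S] [StarRing S] [Algebra ℂ S] [StarModule ℂ S]
    {H : Type u} {K : Type v} [NormedAddCommGroup H] [InnerProductSpace ℂ H] [CompleteSpace H]
  [NormedAddCommGroup K] [InnerProductSpace ℂ K] [CompleteSpace K]

/-- The product representation `π ⊗ ρ` of the algebraic tensor product on the Hilbert space
tensor product. -/
def prodRep (π : R →⋆ₐ[ℂ] BOp H) (ρ : S →⋆ₐ[ℂ] BOp K) :
    R ⊗[ℂ] S →⋆ₐ[ℂ] BOp (HilbertTensor H K) :=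
  tensorHom ((ampLeft H K).comp π) ((ampRight H K).comp ρ) fun _ _ => amp_commute _ _

theorem prodRep_tmul (π : R →⋆ₐ[ℂ] BOp H) (ρ : S →⋆ₐ[ℂ] BOp K) (x : R) (y : S) :
    prodRep π ρ (x ⊗ₜ[ℂ] y) = (π x).tensor (ρ y) :=
  (tensorHom_tmul _ _ _ x y).trans (amp_mul _ _)

end ProdRep

/-- The C*-seminorms on `A ⊗ B` (algebraic) that come from product representations. -/
def minFamily (A : Type u) (B : Type u) [CStarAlgebra A] [CStarAlgebra B] :
    Set (CStarSeminorm (A ⊗[ℂ] B)) :=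
  {p | ∃ (H K : Type u) (_ : NormedAddCommGroup H) (_ : InnerProductSpace ℂ H)
    (_ : CompleteSpace H) (_ : NormedAddCommGroup K) (_ : InnerProductSpace ℂ K)
    (_ : CompleteSpace K) (π : A →⋆ₐ[ℂ] BOp H) (ρ : B →⋆ₐ[ℂ] BOp K),
    p = CStarSeminorm.ofHom (prodRep π ρ)}

theorem minFamily_bdd (A : Type u) (B : Type u) [CStarAlgebra A] [CStarAlgebra B] (x : A ⊗[ℂ] B) :
    BddAbove (Set.range fun p : minFamily A B => p.1 x) := by
  suffices h : ∃ C, ∀ p ∈ minFamily A B, p x ≤ C by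
    obtain ⟨C, hC⟩ := h
    exact ⟨C, by rintro _ ⟨p, rfl⟩; exact hC p.1 p.2⟩
  induction x with
  | zero => exact ⟨0, fun p _ => (map_zero p.toSeminorm).le⟩
  | add x y hx hy =>
    obtain ⟨C, hC⟩ := hx
    obtain ⟨D, hD⟩ := hy
    exact ⟨C + D, fun p hp => (p.add_le' x y).trans (add_le_add (hC p hp) (hD p hp))⟩
  | tmul a b =>
    refine ⟨‖a‖ * ‖b‖, ?_⟩
    rintro p ⟨H, K, _, _, _, _, _, _, π, ρ, rfl⟩
    change ‖prodRep π ρ (a ⊗ₜ[ℂ] b)‖ ≤ _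
    rw [prodRep_tmul]
    exact (BOp.norm_tensor_le _ _).trans (mul_le_mul (NonUnitalStarAlgHom.norm_apply_le π a)
      (NonUnitalStarAlgHom.norm_apply_le ρ b) (by exact norm_nonneg (ρ b)) (norm_nonneg a))

/-- The minimal (spatial) C*-norm: the supremum of `‖(π ⊗ ρ)(x)‖` over all pairs of
representations on Hilbert spaces. -/
def minSeminorm (A : Type u) (B : Type u) [CStarAlgebra A] [CStarAlgebra B] :
    CStarSeminorm (A ⊗[ℂ] B) :=
  CStarSeminorm.sup (minFamily A B) (minFamily_bdd A B)

/-- The minimal tensor product of unital C*-algebras: the completion of the algebraic tensor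
product in the minimal C*-norm. -/
def MinTensor (A : Type u) (B : Type u) [CStarAlgebra A] [CStarAlgebra B] : Type u :=
  (minSeminorm A B).Compl

instance (A : Type u) (B : Type u) [CStarAlgebra A] [CStarAlgebra B] :
    CStarAlgebra (MinTensor A B) := inferInstanceAs (CStarAlgebra (minSeminorm A B).Compl)

namespace MinTensor

section Basic

variable {A B : Type u} [CStarAlgebra A] [CStarAlgebra B]

/-- The canonical map from the algebraic tensor product. -/
def of : A ⊗[ℂ] B →⋆ₐ[ℂ] MinTensor A B := (minSeminorm A B).of

theorem norm_of (x : A ⊗[ℂ] B) : ‖of x‖ = minSeminorm A B x := CStarSeminorm.norm_of _ x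

theorem denseRange_of : DenseRange (of : A ⊗[ℂ] B → MinTensor A B) :=
  CStarSeminorm.denseRange_of _

/-- A *-homomorphism that is dominated by the minimal C*-norm extends. -/
def lift {D : Type v} [CStarAlgebra D] (φ : A ⊗[ℂ] B →⋆ₐ[ℂ] D)
    (h : ∀ x, ‖φ x‖ ≤ minSeminorm A B x) : MinTensor A B →⋆ₐ[ℂ] D :=
  (minSeminorm A B).lift φ h

theorem lift_of {D : Type v} [CStarAlgebra D] (φ : A ⊗[ℂ] B →⋆ₐ[ℂ] D)
    (h : ∀ x, ‖φ x‖ ≤ minSeminorm A B x) (x : A ⊗[ℂ] B) : lift φ h (of x) = φ x :=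
  CStarSeminorm.lift_of _ _ _ x

/-- The elementary tensor `a ⊗ b`. -/
def tmul (a : A) (b : B) : MinTensor A B := of (a ⊗ₜ[ℂ] b)

theorem tmul_mul_tmul (a a' : A) (b b' : B) :
    tmul a b * tmul a' b' = tmul (a * a') (b * b') := by
  simp only [tmul, ← map_mul, Algebra.TensorProduct.tmul_mul_tmul]

theorem star_tmul (a : A) (b : B) : star (tmul a b) = tmul (star a) (star b) := by
  simp only [tmul, ← map_star, TensorProduct.star_tmul]

/-- `a ↦ a ⊗ 1`. -/
def inl : A →⋆ₐ[ℂ] MinTensor A B where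
  toFun a := tmul a 1
  map_one' := map_one of
  map_mul' a b := by rw [tmul_mul_tmul, one_mul]
  map_zero' := by simp [tmul]
  map_add' a b := by simp [tmul, TensorProduct.add_tmul]
  commutes' z := by
    rw [tmul, Algebra.algebraMap_eq_smul_one, ← TensorProduct.smul_tmul', map_smul,
      Algebra.algebraMap_eq_smul_one]
    exact congrArg _ (map_one of)
  map_star' a := by rw [star_tmul, star_one]

/-- `b ↦ 1 ⊗ b`. -/
def inr : B →⋆ₐ[ℂ] MinTensor A B where
  toFun b := tmul 1 b
  map_one' := map_one of
  map_mul' a b := by rw [tmul_mul_tmul, one_mul]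
  map_zero' := by simp [tmul]
  map_add' a b := by simp [tmul, TensorProduct.tmul_add]
  commutes' z := by
    rw [tmul, Algebra.algebraMap_eq_smul_one, TensorProduct.tmul_smul, map_smul,
      Algebra.algebraMap_eq_smul_one]
    exact congrArg _ (map_one of)
  map_star' a := by rw [star_tmul, star_one]

theorem inl_mul_inr (a : A) (b : B) : (inl a : MinTensor A B) * inr b = tmul a b := by
  change tmul a 1 * tmul 1 b = _
  rw [tmul_mul_tmul, one_mul, mul_one]

theorem inr_mul_inl (a : A) (b : B) : (inr b : MinTensor A B) * inl a = tmul a b := by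
  change tmul 1 b * tmul a 1 = _
  rw [tmul_mul_tmul, one_mul, mul_one]

/-- Two *-homomorphisms that agree on elementary tensors are equal. -/
theorem hom_ext {D : Type v} [CStarAlgebra D] {f g : MinTensor A B →⋆ₐ[ℂ] D}
    (h : ∀ a b, f (tmul a b) = g (tmul a b)) : f = g := by
  refine CStarSeminorm.hom_ext (minSeminorm A B) (B := D) fun x => ?_
  change f (of x) = g (of x)
  induction x with
  | zero => simp
  | add x y hx hy => simp only [map_add, hx, hy]
  | tmul a b => exact h a b

section rep

variable {H K : Type u} [NormedAddCommGroup H] [InnerProductSpace ℂ H] [CompleteSpace H]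
  [NormedAddCommGroup K] [InnerProductSpace ℂ K] [CompleteSpace K]

/-- The product representation `π ⊗ ρ` of the minimal tensor product. -/
def rep (π : A →⋆ₐ[ℂ] BOp H) (ρ : B →⋆ₐ[ℂ] BOp K) :
    MinTensor A B →⋆ₐ[ℂ] BOp (HilbertTensor H K) :=
  lift (prodRep π ρ)
    fun x => CStarSeminorm.le_sup _ (minFamily_bdd A B) _
      ⟨H, K, _, _, _, _, _, _, π, ρ, rfl⟩ x

theorem rep_of (π : A →⋆ₐ[ℂ] BOp H) (ρ : B →⋆ₐ[ℂ] BOp K) (x : A ⊗[ℂ] B) :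
    rep π ρ (of x) = prodRep π ρ x :=
  lift_of _ _ x

theorem norm_rep_le (π : A →⋆ₐ[ℂ] BOp H) (ρ : B →⋆ₐ[ℂ] BOp K) (x : MinTensor A B) :
    ‖rep π ρ x‖ ≤ ‖x‖ :=
  NonUnitalStarAlgHom.norm_apply_le (rep π ρ) x

theorem norm_prodRep_le (π : A →⋆ₐ[ℂ] BOp H) (ρ : B →⋆ₐ[ℂ] BOp K) (x : A ⊗[ℂ] B) :
    ‖prodRep π ρ x‖ ≤ minSeminorm A B x := by
  rw [← rep_of, ← norm_of]
  exact norm_rep_le π ρ _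

end rep

theorem le_of_rep {x : A ⊗[ℂ] B} {c : ℝ} (hc : 0 ≤ c)
    (h : ∀ (H K : Type u) [NormedAddCommGroup H] [InnerProductSpace ℂ H]
    [CompleteSpace H] [NormedAddCommGroup K] [InnerProductSpace ℂ K]
    [CompleteSpace K] (π : A →⋆ₐ[ℂ] BOp H) (ρ : B →⋆ₐ[ℂ] BOp K),
    ‖prodRep π ρ x‖ ≤ c) : minSeminorm A B x ≤ c := by
  refine Real.iSup_le (fun p => ?_) hc
  obtain ⟨_, H, K, _, _, _, _, _, _, π, ρ, rfl⟩ := p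
  exact h H K π ρ

end Basic

section map

variable {A B A' B' : Type u} [CStarAlgebra A] [CStarAlgebra B] [CStarAlgebra A'] [CStarAlgebra B']

/-- The *-homomorphism `f ⊗ g` between minimal tensor products. -/
def map (f : A →⋆ₐ[ℂ] A') (g : B →⋆ₐ[ℂ] B') : MinTensor A B →⋆ₐ[ℂ] MinTensor A' B' :=
  lift
    (tensorHom (inl.comp f) (inr.comp g) fun x y => by
      change inl (f x) * inr (g y) = inr (g y) * inl (f x)
      rw [inl_mul_inr, inr_mul_inl]) fun x => by
    have hx : ∀ x, tensorHom (B := MinTensor A' B') (inl.comp f) (inr.comp g) (fun x y => by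
        change inl (f x) * inr (g y) = inr (g y) * inl (f x)
        rw [inl_mul_inr, inr_mul_inl]) x =
        of (TensorProduct.map (f : A →ₐ[ℂ] A').toLinearMap
          (g : B →ₐ[ℂ] B').toLinearMap x) := by
      intro x
      induction x with
      | zero => simp
      | add x y hx hy => simp only [map_add, hx, hy]
      | tmul a b =>
        rw [tensorHom_tmul, TensorProduct.map_tmul]
        exact inl_mul_inr _ _
    rw [hx, norm_of]
    refine le_of_rep (CStarSeminorm.nonneg _ _) ?_
    intro H K _ _ _ _ _ _ π ρ
    have hy : ∀ y, prodRep π ρ (TensorProduct.map (f : A →ₐ[ℂ] A').toLinearMap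
          (g : B →ₐ[ℂ] B').toLinearMap y) = prodRep (π.comp f) (ρ.comp g) y := by
      intro y
      induction y with
      | zero => simp
      | add x y hx hy => simp only [map_add, hx, hy]
      | tmul a b => rw [TensorProduct.map_tmul, prodRep_tmul, prodRep_tmul]; rfl
    rw [hy]
    exact CStarSeminorm.le_sup _ (minFamily_bdd A B) _
      ⟨H, K, _, _, _, _, _, _, π.comp f, ρ.comp g, rfl⟩ x

theorem map_tmul (f : A →⋆ₐ[ℂ] A') (g : B →⋆ₐ[ℂ] B') (a : A) (b : B) :
    map f g (tmul a b) = tmul (f a) (g b) := by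
  rw [map, tmul, lift_of, tensorHom_tmul]
  exact inl_mul_inr _ _

end map

end MinTensor

section Triple

variable (H K L : Type u) [NormedAddCommGroup H] [InnerProductSpace ℂ H]
  [NormedAddCommGroup K] [InnerProductSpace ℂ K] [NormedAddCommGroup L] [InnerProductSpace ℂ L]

/-- The inclusion of the algebraic triple tensor product, bracketed to the left. -/
def tripleLeft : (H ⊗[ℂ] K) ⊗[ℂ] L →ₗᵢ[ℂ] HilbertTensor (HilbertTensor H K) L :=
  UniformSpace.Completion.toComplₗᵢ.comp
    (TensorProduct.mapIsometry UniformSpace.Completion.toComplₗᵢ LinearIsometry.id)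

/-- The inclusion of the algebraic triple tensor product, bracketed to the right. -/
def tripleRight : H ⊗[ℂ] (K ⊗[ℂ] L) →ₗᵢ[ℂ] HilbertTensor H (HilbertTensor K L) :=
  UniformSpace.Completion.toComplₗᵢ.comp
    (TensorProduct.mapIsometry LinearIsometry.id UniformSpace.Completion.toComplₗᵢ)

theorem tripleLeft_tmul (x : H ⊗[ℂ] K) (z : L) : tripleLeft H K L (x ⊗ₜ[ℂ] z) =
    (((x : HilbertTensor H K) ⊗ₜ[ℂ] z : HilbertTensor H K ⊗[ℂ] L) :
      HilbertTensor (HilbertTensor H K) L) := rfl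

theorem tripleRight_tmul (x : H) (y : K ⊗[ℂ] L) : tripleRight H K L (x ⊗ₜ[ℂ] y) =
    ((x ⊗ₜ[ℂ] (y : HilbertTensor K L) : H ⊗[ℂ] HilbertTensor K L) :
      HilbertTensor H (HilbertTensor K L)) := rfl

theorem tripleLeft_dense : DenseRange (tripleLeft H K L) := by
  let M : Submodule ℂ (HilbertTensor (HilbertTensor H K) L) :=
    (LinearMap.range (tripleLeft H K L).toLinearMap).topologicalClosure
  have h0 : ∀ x, tripleLeft H K L x ∈ M := fun x => subset_closure ⟨x, rfl⟩
  have hM : IsClosed (M : Set (HilbertTensor (HilbertTensor H K) L)) :=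
    Submodule.isClosed_topologicalClosure _
  have h1 : ∀ (v : HilbertTensor H K) (z : L),
      ((v ⊗ₜ[ℂ] z : HilbertTensor H K ⊗[ℂ] L) : HilbertTensor (HilbertTensor H K) L) ∈ M := by
    intro v z
    refine UniformSpace.Completion.induction_on v ?_ fun x => h0 (x ⊗ₜ[ℂ] z)
    exact hM.preimage ((UniformSpace.Completion.continuous_coe _).comp
      (TensorProduct.continuous_tmul.comp (continuous_id.prodMk continuous_const)))
  intro v
  change v ∈ M
  refine UniformSpace.Completion.induction_on v hM fun x => ?_
  induction x with
  | zero => rw [UniformSpace.Completion.coe_zero]; exact M.zero_mem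
  | add x y hx hy => rw [UniformSpace.Completion.coe_add]; exact M.add_mem hx hy
  | tmul v z => exact h1 v z

theorem tripleRight_dense : DenseRange (tripleRight H K L) := by
  let M : Submodule ℂ (HilbertTensor H (HilbertTensor K L)) :=
    (LinearMap.range (tripleRight H K L).toLinearMap).topologicalClosure
  have h0 : ∀ x, tripleRight H K L x ∈ M := fun x => subset_closure ⟨x, rfl⟩
  have hM : IsClosed (M : Set (HilbertTensor H (HilbertTensor K L))) :=
    Submodule.isClosed_topologicalClosure _
  have h1 : ∀ (z : H) (v : HilbertTensor K L),
      ((z ⊗ₜ[ℂ] v : H ⊗[ℂ] HilbertTensor K L) : HilbertTensor H (HilbertTensor K L)) ∈ M := by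
    intro z v
    refine UniformSpace.Completion.induction_on v ?_ fun x => h0 (z ⊗ₜ[ℂ] x)
    exact hM.preimage ((UniformSpace.Completion.continuous_coe _).comp
      (TensorProduct.continuous_tmul.comp (continuous_const.prodMk continuous_id)))
  intro v
  change v ∈ M
  refine UniformSpace.Completion.induction_on v hM fun x => ?_
  induction x with
  | zero => rw [UniformSpace.Completion.coe_zero]; exact M.zero_mem
  | add x y hx hy => rw [UniformSpace.Completion.coe_add]; exact M.add_mem hx hy
  | tmul v z => exact h1 v z

/-- The associativity unitary of Hilbert space tensor products. -/
def HilbertTensor.assoc :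
    HilbertTensor (HilbertTensor H K) L ≃ₗᵢ[ℂ] HilbertTensor H (HilbertTensor K L) :=
  LinearEquiv.extendOfIsometry (TensorProduct.assoc ℂ H K L)
    (tripleLeft H K L).toLinearMap (tripleRight H K L).toLinearMap
    (tripleLeft_dense H K L) (tripleRight_dense H K L) fun x => by
      change ‖tripleRight H K L (TensorProduct.assoc ℂ H K L x)‖ = ‖tripleLeft H K L x‖
      rw [LinearIsometry.norm_map, LinearIsometry.norm_map, TensorProduct.norm_assoc]

variable {H K L}

theorem HilbertTensor.assoc_tripleLeft (x : (H ⊗[ℂ] K) ⊗[ℂ] L) :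
    HilbertTensor.assoc H K L (tripleLeft H K L x) =
      tripleRight H K L (TensorProduct.assoc ℂ H K L x) :=
  LinearMap.extendOfNorm_eq (tripleLeft_dense H K L) ⟨1, fun x => by
      change ‖tripleRight H K L (TensorProduct.assoc ℂ H K L x)‖ ≤ 1 * ‖tripleLeft H K L x‖
      rw [LinearIsometry.norm_map, LinearIsometry.norm_map, TensorProduct.norm_assoc, one_mul]⟩ x

theorem assoc_opTensor (S : H →L[ℂ] H) (T : K →L[ℂ] K) (W : L →L[ℂ] L)
    (v : HilbertTensor (HilbertTensor H K) L) :
    HilbertTensor.assoc H K L (opTensor (opTensor S T) W v) =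
      opTensor S (opTensor T W) (HilbertTensor.assoc H K L v) := by
  refine (tripleLeft_dense H K L).induction_on v ?_ fun x => ?_
  · exact isClosed_eq (by fun_prop) (by fun_prop)
  have h0 : tripleLeft H K L 0 = 0 := LinearIsometry.map_zero _
  induction x with
  | zero => rw [h0, map_zero, map_zero, map_zero]
  | add x y hx hy => simp only [map_add, hx, hy]
  | tmul x z =>
    induction x with
    | zero => rw [TensorProduct.zero_tmul, h0, map_zero, map_zero, map_zero]
    | add x y hx hy => simp only [map_add, TensorProduct.add_tmul, hx, hy]
    | tmul x y =>
      rw [HilbertTensor.assoc_tripleLeft, TensorProduct.assoc_tmul, tripleRight_tmul, tripleLeft_tmul,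
        opTensor_coe, opTensor_coe, TensorProduct.mapL_tmul, TensorProduct.mapL_tmul, opTensor_coe,
        opTensor_coe, TensorProduct.mapL_tmul, TensorProduct.mapL_tmul, ← tripleRight_tmul,
        ← tripleLeft_tmul, HilbertTensor.assoc_tripleLeft, TensorProduct.assoc_tmul]

theorem conjHom_assoc [CompleteSpace H] [CompleteSpace K] [CompleteSpace L] (S : BOp H)
    (T : BOp K) (W : BOp L) :
    conjHom (HilbertTensor.assoc H K L) ((S.tensor T).tensor W) = S.tensor (T.tensor W) := by
  refine ContinuousLinearMap.ext fun v => ?_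
  change HilbertTensor.assoc H K L (opTensor (opTensor S T) W ((HilbertTensor.assoc H K L).symm v))
    = opTensor S (opTensor T W) v
  exact (assoc_opTensor S T W _).trans (congrArg _ (LinearIsometryEquiv.apply_symm_apply _ v))

end Triple

/-- The C*-seminorms on the algebraic tensor product `A ⊗ B ⊗ C` that come from triple product
representations. -/
def minFamily₃ (A B C : Type u) [CStarAlgebra A] [CStarAlgebra B] [CStarAlgebra C] :
    Set (CStarSeminorm ((A ⊗[ℂ] B) ⊗[ℂ] C)) :=
  {p | ∃ (H K L : Type u) (_ : NormedAddCommGroup H) (_ : InnerProductSpace ℂ H)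
    (_ : CompleteSpace H) (_ : NormedAddCommGroup K) (_ : InnerProductSpace ℂ K)
    (_ : CompleteSpace K) (_ : NormedAddCommGroup L) (_ : InnerProductSpace ℂ L)
    (_ : CompleteSpace L) (π : A →⋆ₐ[ℂ] BOp H) (ρ : B →⋆ₐ[ℂ] BOp K)
    (σ : C →⋆ₐ[ℂ] BOp L),
    p = CStarSeminorm.ofHom (prodRep (prodRep π ρ) σ)}

theorem minFamily₃_bdd (A B C : Type u) [CStarAlgebra A] [CStarAlgebra B] [CStarAlgebra C]
    (x : (A ⊗[ℂ] B) ⊗[ℂ] C) : BddAbove (Set.range fun p : minFamily₃ A B C => p.1 x) := by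
  suffices h : ∃ D, ∀ p ∈ minFamily₃ A B C, p x ≤ D by
    obtain ⟨D, hD⟩ := h
    exact ⟨D, by rintro _ ⟨p, rfl⟩; exact hD p.1 p.2⟩
  induction x with
  | zero => exact ⟨0, fun p _ => (map_zero p.toSeminorm).le⟩
  | add x y hx hy =>
    obtain ⟨C, hC⟩ := hx
    obtain ⟨D, hD⟩ := hy
    exact ⟨C + D, fun p hp => (p.add_le' x y).trans (add_le_add (hC p hp) (hD p hp))⟩
  | tmul a c =>
    refine ⟨minSeminorm A B a * ‖c‖, ?_⟩
    rintro p ⟨H, K, L, _, _, _, _, _, _, _, _, _, π, ρ, σ, rfl⟩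
    change ‖prodRep (prodRep π ρ) σ (a ⊗ₜ[ℂ] c)‖ ≤ _
    rw [prodRep_tmul]
    exact (BOp.norm_tensor_le _ _).trans (mul_le_mul (MinTensor.norm_prodRep_le π ρ a)
      (NonUnitalStarAlgHom.norm_apply_le σ c) (by exact norm_nonneg (σ c))
      (CStarSeminorm.nonneg _ _))

/-- The minimal C*-norm on a triple algebraic tensor product. -/
def minSeminorm₃ (A B C : Type u) [CStarAlgebra A] [CStarAlgebra B] [CStarAlgebra C] :
    CStarSeminorm ((A ⊗[ℂ] B) ⊗[ℂ] C) :=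
  CStarSeminorm.sup (minFamily₃ A B C) (minFamily₃_bdd A B C)

/-- The triple minimal tensor product `A ⊗ B ⊗ C` of unital C*-algebras. -/
def MinTensor₃ (A B C : Type u) [CStarAlgebra A] [CStarAlgebra B] [CStarAlgebra C] : Type u :=
  (minSeminorm₃ A B C).Compl

instance (A B C : Type u) [CStarAlgebra A] [CStarAlgebra B] [CStarAlgebra C] :
    CStarAlgebra (MinTensor₃ A B C) := inferInstanceAs (CStarAlgebra (minSeminorm₃ A B C).Compl)

namespace MinTensor₃

variable {A B C : Type u} [CStarAlgebra A] [CStarAlgebra B] [CStarAlgebra C]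

/-- The canonical map from the algebraic tensor product. -/
def of : (A ⊗[ℂ] B) ⊗[ℂ] C →⋆ₐ[ℂ] MinTensor₃ A B C := (minSeminorm₃ A B C).of

theorem norm_of (x : (A ⊗[ℂ] B) ⊗[ℂ] C) : ‖of x‖ = minSeminorm₃ A B C x :=
  CStarSeminorm.norm_of _ x

theorem denseRange_of : DenseRange (of : (A ⊗[ℂ] B) ⊗[ℂ] C → MinTensor₃ A B C) :=
  CStarSeminorm.denseRange_of _

/-- The elementary tensor `a ⊗ b ⊗ c`. -/
def tmul (a : A) (b : B) (c : C) : MinTensor₃ A B C :=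
  of ((a ⊗ₜ[ℂ] b) ⊗ₜ[ℂ] c)

theorem tmul_mul_tmul (a a' : A) (b b' : B) (c c' : C) :
    tmul a b c * tmul a' b' c' = tmul (a * a') (b * b') (c * c') := by
  simp only [tmul, ← map_mul, Algebra.TensorProduct.tmul_mul_tmul]

section rep

variable {H K L : Type u} [NormedAddCommGroup H] [InnerProductSpace ℂ H] [CompleteSpace H]
  [NormedAddCommGroup K] [InnerProductSpace ℂ K] [CompleteSpace K]
  [NormedAddCommGroup L] [InnerProductSpace ℂ L] [CompleteSpace L]

/-- The product representation `π ⊗ ρ ⊗ σ`. -/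
def rep (π : A →⋆ₐ[ℂ] BOp H) (ρ : B →⋆ₐ[ℂ] BOp K) (σ : C →⋆ₐ[ℂ] BOp L) :
    MinTensor₃ A B C →⋆ₐ[ℂ] BOp (HilbertTensor (HilbertTensor H K) L) :=
  (minSeminorm₃ A B C).lift (prodRep (prodRep π ρ) σ)
    fun x => CStarSeminorm.le_sup _ (minFamily₃_bdd A B C) _
      ⟨H, K, L, _, _, _, _, _, _, _, _, _, π, ρ, σ, rfl⟩ x

theorem rep_of (π : A →⋆ₐ[ℂ] BOp H) (ρ : B →⋆ₐ[ℂ] BOp K) (σ : C →⋆ₐ[ℂ] BOp L)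
    (x : (A ⊗[ℂ] B) ⊗[ℂ] C) :
    rep π ρ σ (of x) = prodRep (prodRep π ρ) σ x :=
  CStarSeminorm.lift_of _ _ _ x

theorem rep_tmul (π : A →⋆ₐ[ℂ] BOp H) (ρ : B →⋆ₐ[ℂ] BOp K) (σ : C →⋆ₐ[ℂ] BOp L)
    (a : A) (b : B) (c : C) :
    rep π ρ σ (tmul a b c) = ((π a).tensor (ρ b)).tensor (σ c) := by
  rw [tmul, rep_of, prodRep_tmul, prodRep_tmul]

end rep

/-- The norm of the triple tensor product is computed by the triple product representations. -/
theorem norm_le_of_rep {x : MinTensor₃ A B C} {c : ℝ} (hc : 0 ≤ c)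
    (h : ∀ (H K L : Type u) [NormedAddCommGroup H] [InnerProductSpace ℂ H]
    [CompleteSpace H] [NormedAddCommGroup K] [InnerProductSpace ℂ K]
    [CompleteSpace K] [NormedAddCommGroup L] [InnerProductSpace ℂ L] [CompleteSpace L]
    (π : A →⋆ₐ[ℂ] BOp H) (ρ : B →⋆ₐ[ℂ] BOp K) (σ : C →⋆ₐ[ℂ] BOp L),
    ‖rep π ρ σ x‖ ≤ c) : ‖x‖ ≤ c := by
  refine le_of_forall_pos_le_add fun ε hε => ?_
  obtain ⟨y, hy⟩ := denseRange_of.exists_dist_lt x (half_pos hε)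
  rw [dist_eq_norm] at hy
  have h1 : ‖of y‖ ≤ c + ε / 2 := by
    rw [norm_of]
    refine Real.iSup_le (fun p => ?_) (by positivity)
    obtain ⟨_, H, K, L, _, _, _, _, _, _, _, _, _, π, ρ, σ, rfl⟩ := p
    change ‖prodRep (prodRep π ρ) σ y‖ ≤ _
    have h2 := NonUnitalStarAlgHom.norm_apply_le (rep π ρ σ) (x - of y)
    rw [map_sub, rep_of] at h2
    have h3 := h H K L π ρ σ
    have h4 := norm_sub_norm_le (prodRep (prodRep π ρ) σ y) (rep π ρ σ x)
    have h5 := norm_sub_rev (prodRep (prodRep π ρ) σ y) (rep π ρ σ x)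
    linarith
  have h5 := norm_sub_norm_le x (of y)
  linarith

/-- `a ↦ a ⊗ 1 ⊗ 1`. -/
def in₁ : A →⋆ₐ[ℂ] MinTensor₃ A B C where
  toFun a := tmul a 1 1
  map_one' := map_one of
  map_mul' a b := by rw [tmul_mul_tmul, one_mul, one_mul]
  map_zero' := by simp [tmul]
  map_add' a b := by simp [tmul, TensorProduct.add_tmul]
  commutes' z := by
    rw [tmul, Algebra.algebraMap_eq_smul_one, ← TensorProduct.smul_tmul',
      ← TensorProduct.smul_tmul', map_smul, Algebra.algebraMap_eq_smul_one]
    exact congrArg _ (map_one of)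
  map_star' a := by
    rw [tmul, tmul, ← map_star, TensorProduct.star_tmul, TensorProduct.star_tmul, star_one,
      star_one]

/-- `c ↦ 1 ⊗ 1 ⊗ c`. -/
def in₃ : C →⋆ₐ[ℂ] MinTensor₃ A B C where
  toFun c := tmul 1 1 c
  map_one' := map_one of
  map_mul' a b := by rw [tmul_mul_tmul, one_mul, one_mul]
  map_zero' := by simp [tmul]
  map_add' a b := by simp [tmul, TensorProduct.tmul_add]
  commutes' z := by
    rw [tmul, Algebra.algebraMap_eq_smul_one, TensorProduct.tmul_smul, map_smul,
      Algebra.algebraMap_eq_smul_one]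
    exact congrArg _ (map_one of)
  map_star' a := by
    rw [tmul, tmul, ← map_star, TensorProduct.star_tmul, TensorProduct.star_tmul, star_one,
      star_one]

/-- `b ↦ 1 ⊗ b ⊗ 1`. -/
def in₂ : B →⋆ₐ[ℂ] MinTensor₃ A B C where
  toFun b := tmul 1 b 1
  map_one' := map_one of
  map_mul' a b := by rw [tmul_mul_tmul, one_mul, one_mul]
  map_zero' := by simp [tmul]
  map_add' a b := by simp [tmul, TensorProduct.tmul_add, TensorProduct.add_tmul]
  commutes' z := by
    rw [tmul, Algebra.algebraMap_eq_smul_one, TensorProduct.tmul_smul,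
      ← TensorProduct.smul_tmul', map_smul, Algebra.algebraMap_eq_smul_one]
    exact congrArg _ (map_one of)
  map_star' a := by
    rw [tmul, tmul, ← map_star, TensorProduct.star_tmul, TensorProduct.star_tmul, star_one,
      star_one]

theorem comm₁₂ (a : A) (b : B) : Commute (in₁ a : MinTensor₃ A B C) (in₂ b) := by
  change tmul a 1 1 * tmul 1 b 1 = tmul 1 b 1 * tmul a 1 1
  simp only [tmul_mul_tmul, one_mul, mul_one]

theorem comm₁₃ (a : A) (c : C) : Commute (in₁ a : MinTensor₃ A B C) (in₃ c) := by
  change tmul a 1 1 * tmul 1 1 c = tmul 1 1 c * tmul a 1 1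
  simp only [tmul_mul_tmul, one_mul, mul_one]

theorem comm₂₃ (b : B) (c : C) : Commute (in₂ b : MinTensor₃ A B C) (in₃ c) := by
  change tmul 1 b 1 * tmul 1 1 c = tmul 1 1 c * tmul 1 b 1
  simp only [tmul_mul_tmul, one_mul, mul_one]

section legs

variable {H K L : Type u} [NormedAddCommGroup H] [InnerProductSpace ℂ H] [CompleteSpace H]
  [NormedAddCommGroup K] [InnerProductSpace ℂ K] [CompleteSpace K]
  [NormedAddCommGroup L] [InnerProductSpace ℂ L] [CompleteSpace L]

theorem rep_leg₁₂ (π : A →⋆ₐ[ℂ] BOp H) (ρ : B →⋆ₐ[ℂ] BOp K) (σ : C →⋆ₐ[ℂ] BOp L)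
    (x : A ⊗[ℂ] B) : rep π ρ σ (tensorHom in₁ in₂ comm₁₂ x) = (prodRep π ρ x).tensor 1 := by
  change _ = ampLeft (HilbertTensor H K) L (prodRep π ρ x)
  induction x with
  | zero => simp
  | add x y hx hy => simp only [map_add, hx, hy]
  | tmul a b =>
    rw [tensorHom_tmul, prodRep_tmul]
    change rep π ρ σ (tmul a 1 1 * tmul 1 b 1) = ((π a).tensor (ρ b)).tensor 1
    rw [tmul_mul_tmul, rep_tmul, one_mul, one_mul, mul_one, map_one]

theorem rep_leg₂₃ (π : A →⋆ₐ[ℂ] BOp H) (ρ : B →⋆ₐ[ℂ] BOp K) (σ : C →⋆ₐ[ℂ] BOp L)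
    (x : B ⊗[ℂ] C) : conjHom (HilbertTensor.assoc H K L)
      (rep π ρ σ (tensorHom in₂ in₃ comm₂₃ x)) = (1 : BOp H).tensor (prodRep ρ σ x) := by
  change _ = ampRight H (HilbertTensor K L) (prodRep ρ σ x)
  induction x with
  | zero => simp
  | add x y hx hy => simp only [map_add, hx, hy]
  | tmul b c =>
    rw [tensorHom_tmul, prodRep_tmul]
    change conjHom (HilbertTensor.assoc H K L)
      (rep π ρ σ (tmul 1 b 1 * tmul 1 1 c)) = (1 : BOp H).tensor ((ρ b).tensor (σ c))
    rw [tmul_mul_tmul, rep_tmul, one_mul, one_mul, mul_one, map_one, conjHom_assoc]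

end legs

/-- `x ↦ x ⊗ 1`, for `x` in the minimal tensor product `A ⊗ B`. -/
def leg₁₂ : MinTensor A B →⋆ₐ[ℂ] MinTensor₃ A B C :=
  MinTensor.lift (tensorHom in₁ in₂ comm₁₂) fun x =>
    norm_le_of_rep (CStarSeminorm.nonneg _ _) fun H K L _ _ _ _ _ _ _ _ _ π ρ σ => by
      rw [rep_leg₁₂]
      exact (BOp.norm_tensor_one_le _).trans (MinTensor.norm_prodRep_le π ρ x)

/-- `x ↦ 1 ⊗ x`, for `x` in the minimal tensor product `B ⊗ C`. -/
def leg₂₃ : MinTensor B C →⋆ₐ[ℂ] MinTensor₃ A B C :=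
  MinTensor.lift (tensorHom in₂ in₃ comm₂₃) fun x =>
    norm_le_of_rep (CStarSeminorm.nonneg _ _) fun H K L _ _ _ _ _ _ _ _ _ π ρ σ => by
      rw [← norm_conjHom (HilbertTensor.assoc H K L), rep_leg₂₃]
      exact (BOp.norm_one_tensor_le _).trans (MinTensor.norm_prodRep_le ρ σ x)

theorem leg₁₂_tmul (a : A) (b : B) :
    (leg₁₂ (MinTensor.tmul a b) : MinTensor₃ A B C) = tmul a b 1 := by
  rw [leg₁₂, MinTensor.tmul, MinTensor.lift_of, tensorHom_tmul]
  change tmul a 1 1 * tmul 1 b 1 = _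
  rw [tmul_mul_tmul, one_mul, one_mul, mul_one]

theorem leg₂₃_tmul (b : B) (c : C) :
    (leg₂₃ (MinTensor.tmul b c) : MinTensor₃ A B C) = tmul 1 b c := by
  rw [leg₂₃, MinTensor.tmul, MinTensor.lift_of, tensorHom_tmul]
  change tmul 1 b 1 * tmul 1 1 c = _
  rw [tmul_mul_tmul, one_mul, one_mul, mul_one]

theorem leg₁₂_comm (x : MinTensor A B) (c : C) :
    Commute (leg₁₂ x : MinTensor₃ A B C) (in₃ c) := by
  refine CStarSeminorm.induction _ (P := fun x => leg₁₂ x * in₃ c = in₃ c * leg₁₂ x) ?_ ?_ x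
  · have := starAlgHom_continuous (leg₁₂ : MinTensor A B →⋆ₐ[ℂ] MinTensor₃ A B C)
    exact isClosed_eq (by fun_prop) (by fun_prop)
  · intro x
    change leg₁₂ (MinTensor.of x) * in₃ c = in₃ c * leg₁₂ (MinTensor.of x)
    induction x with
    | zero => simp
    | add x y hx hy => simp only [map_add, add_mul, mul_add, hx, hy]
    | tmul a b =>
      change leg₁₂ (MinTensor.tmul a b) * tmul 1 1 c = tmul 1 1 c * leg₁₂ (MinTensor.tmul a b)
      simp only [leg₁₂_tmul, tmul_mul_tmul, one_mul, mul_one]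

theorem leg₂₃_comm (a : A) (x : MinTensor B C) :
    Commute (in₁ a : MinTensor₃ A B C) (leg₂₃ x) := by
  refine CStarSeminorm.induction _ (P := fun x => in₁ a * leg₂₃ x = leg₂₃ x * in₁ a) ?_ ?_ x
  · have := starAlgHom_continuous (leg₂₃ : MinTensor B C →⋆ₐ[ℂ] MinTensor₃ A B C)
    exact isClosed_eq (by fun_prop) (by fun_prop)
  · intro x
    change in₁ a * leg₂₃ (MinTensor.of x) = leg₂₃ (MinTensor.of x) * in₁ a
    induction x with
    | zero => simp
    | add x y hx hy => simp only [map_add, add_mul, mul_add, hx, hy]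
    | tmul b c =>
      change tmul a 1 1 * leg₂₃ (MinTensor.tmul b c) = leg₂₃ (MinTensor.tmul b c) * tmul a 1 1
      simp only [leg₂₃_tmul, tmul_mul_tmul, one_mul, mul_one]

/-- The canonical map `(A ⊗ B) ⊗ C → A ⊗ B ⊗ C`. -/
def ofLeft : MinTensor (MinTensor A B) C →⋆ₐ[ℂ] MinTensor₃ A B C :=
  MinTensor.lift
    (tensorHom leg₁₂ in₃ leg₁₂_comm) fun x =>
    norm_le_of_rep (CStarSeminorm.nonneg _ _) fun H K L _ _ _ _ _ _ _ _ _ π ρ σ => by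
      have h1 : (rep π ρ σ).comp leg₁₂ =
          (ampLeft (HilbertTensor H K) L).comp (MinTensor.rep π ρ) := by
        refine CStarSeminorm.hom_ext (minSeminorm A B) fun y => ?_
        change rep π ρ σ (leg₁₂ (MinTensor.of y)) =
          (MinTensor.rep π ρ (MinTensor.of y)).tensor 1
        rw [leg₁₂, MinTensor.lift_of, rep_leg₁₂, MinTensor.rep_of]
      have h2 : ∀ y, rep π ρ σ (tensorHom leg₁₂ in₃ leg₁₂_comm y) =
          prodRep (MinTensor.rep π ρ) σ y := by
        intro y
        induction y with
        | zero => simp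
        | add x y hx hy => simp only [map_add, hx, hy]
        | tmul y c =>
          rw [tensorHom_tmul, prodRep_tmul, map_mul]
          have h3 : rep π ρ σ (leg₁₂ y) = (MinTensor.rep π ρ y).tensor 1 :=
            DFunLike.congr_fun h1 y
          have h4 : rep π ρ σ (in₃ c) = (1 : BOp (HilbertTensor H K)).tensor (σ c) := by
            refine (rep_tmul π ρ σ 1 1 c).trans ?_
            rw [map_one, map_one]
            rw [BOp.one_tensor_one]
          rw [h3, h4, ← BOp.tensor_mul, one_mul, mul_one]
      rw [h2]
      exact CStarSeminorm.le_sup _ (minFamily_bdd _ _) _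
        ⟨HilbertTensor H K, L, _, _, _, _, _, _, MinTensor.rep π ρ, σ, rfl⟩ x

/-- The canonical map `A ⊗ (B ⊗ C) → A ⊗ B ⊗ C`. -/
def ofRight : MinTensor A (MinTensor B C) →⋆ₐ[ℂ] MinTensor₃ A B C :=
  MinTensor.lift
    (tensorHom in₁ leg₂₃ leg₂₃_comm) fun x =>
    norm_le_of_rep (CStarSeminorm.nonneg _ _) fun H K L _ _ _ _ _ _ _ _ _ π ρ σ => by
      have h1 : ((conjHom (HilbertTensor.assoc H K L)).comp (rep π ρ σ)).comp leg₂₃ =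
          (ampRight H (HilbertTensor K L)).comp (MinTensor.rep ρ σ) := by
        refine CStarSeminorm.hom_ext (minSeminorm B C) fun y => ?_
        change conjHom (HilbertTensor.assoc H K L)
          (rep π ρ σ (leg₂₃ (MinTensor.of y))) =
          (1 : BOp H).tensor (MinTensor.rep ρ σ (MinTensor.of y))
        rw [leg₂₃, MinTensor.lift_of, rep_leg₂₃, MinTensor.rep_of]
      have h2 : ∀ y, conjHom (HilbertTensor.assoc H K L)
          (rep π ρ σ (tensorHom in₁ leg₂₃ leg₂₃_comm y)) =
          prodRep π (MinTensor.rep ρ σ) y := by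
        intro y
        induction y with
        | zero => simp
        | add x y hx hy => simp only [map_add, hx, hy]
        | tmul a y =>
          rw [tensorHom_tmul, prodRep_tmul, map_mul, map_mul]
          have h3 : conjHom (HilbertTensor.assoc H K L) (rep π ρ σ (leg₂₃ y)) =
            (1 : BOp H).tensor (MinTensor.rep ρ σ y) := DFunLike.congr_fun h1 y
          have h4 : conjHom (HilbertTensor.assoc H K L) (rep π ρ σ (in₁ a)) =
              (π a).tensor 1 := by
            refine (congrArg _ (rep_tmul π ρ σ a 1 1)).trans ?_
            rw [conjHom_assoc, map_one, map_one, BOp.one_tensor_one]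
          rw [h3, h4, ← BOp.tensor_mul, one_mul, mul_one]
      rw [← norm_conjHom (HilbertTensor.assoc H K L), h2]
      exact CStarSeminorm.le_sup _ (minFamily_bdd _ _) _
        ⟨H, HilbertTensor K L, _, _, _, _, _, _, π, MinTensor.rep ρ σ, rfl⟩ x

theorem ofLeft_tmul (a : A) (b : B) (c : C) :
    ofLeft (MinTensor.tmul (MinTensor.tmul a b) c) = tmul a b c := by
  rw [ofLeft, MinTensor.tmul, MinTensor.lift_of, tensorHom_tmul, leg₁₂_tmul]
  change tmul a b 1 * tmul 1 1 c = _
  rw [tmul_mul_tmul, one_mul, mul_one, mul_one]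

theorem ofRight_tmul (a : A) (b : B) (c : C) :
    ofRight (MinTensor.tmul a (MinTensor.tmul b c)) = tmul a b c := by
  rw [ofRight, MinTensor.tmul, MinTensor.lift_of, tensorHom_tmul, leg₂₃_tmul]
  change tmul a 1 1 * tmul 1 b c = _
  rw [tmul_mul_tmul, one_mul, one_mul, mul_one]

end MinTensor₃

/-! ### Universal C*-algebras generated by projections -/

/-- The free complex unital *-algebra on self-adjoint generators `x : X`: the complexification of
the free real algebra, whose star fixes the generators. -/
def FreeStar (X : Type u) : Type u := ℂ ⊗[ℝ] FreeAlgebra ℝ X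

namespace FreeStar

variable {X : Type u}

instance : StarModule ℝ (FreeAlgebra ℝ X) where
  star_smul r x := by
    rw [Algebra.smul_def, star_mul, FreeAlgebra.star_algebraMap,
      ← Algebra.commutes, ← Algebra.smul_def, star_trivial r]

instance : Ring (FreeStar X) := inferInstanceAs (Ring (ℂ ⊗[ℝ] FreeAlgebra ℝ X))
instance : Algebra ℂ (FreeStar X) := inferInstanceAs (Algebra ℂ (ℂ ⊗[ℝ] FreeAlgebra ℝ X))
instance : StarRing (FreeStar X) := inferInstanceAs (StarRing (ℂ ⊗[ℝ] FreeAlgebra ℝ X))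

/-- The generators. -/
def gen (x : X) : FreeStar X := (1 : ℂ) ⊗ₜ[ℝ] FreeAlgebra.ι ℝ x

theorem star_gen (x : X) : star (gen x) = gen x := by
  change star ((1 : ℂ) ⊗ₜ[ℝ] FreeAlgebra.ι ℝ x) = _
  rw [TensorProduct.star_tmul, star_one, FreeAlgebra.star_ι]
  rfl

instance : StarModule ℂ (FreeStar X) where
  star_smul z x := by
    change star (z • (show ℂ ⊗[ℝ] FreeAlgebra ℝ X from x)) =
      star z • star (show ℂ ⊗[ℝ] FreeAlgebra ℝ X from x)
    induction (show ℂ ⊗[ℝ] FreeAlgebra ℝ X from x) with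
    | zero => simp
    | add x y hx hy => rw [smul_add, star_add, star_add, smul_add, hx, hy]
    | tmul w a => simp [TensorProduct.smul_tmul']

@[elab_as_elim]
theorem induction {P : FreeStar X → Prop} (one : P 1) (gen : ∀ x, P (gen x))
    (smul : ∀ (z : ℂ) x, P x → P (z • x)) (add : ∀ x y, P x → P y → P (x + y))
    (mul : ∀ x y, P x → P y → P (x * y)) (x : FreeStar X) : P x := by
  let t : ℂ → FreeAlgebra ℝ X → FreeStar X := fun z w => z ⊗ₜ[ℝ] w
  have h : ∀ w : FreeAlgebra ℝ X, P (t 1 w) := by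
    intro w
    induction w with
    | grade0 r =>
      have e : t 1 (algebraMap ℝ _ r) = (r : ℂ) • (1 : FreeStar X) := by
        change (1 : ℂ) ⊗ₜ[ℝ] _ = (r : ℂ) • ((1 : ℂ) ⊗ₜ[ℝ] (1 : FreeAlgebra ℝ X))
        rw [TensorProduct.smul_tmul', Algebra.algebraMap_eq_smul_one, TensorProduct.tmul_smul,
          TensorProduct.smul_tmul']
        simp
      exact e ▸ smul (r : ℂ) 1 one
    | grade1 x => exact gen x
    | mul a b ha hb =>
      have e : t 1 (a * b) = t 1 a * t 1 b := by
        change _ = ((1 : ℂ) ⊗ₜ[ℝ] a) * ((1 : ℂ) ⊗ₜ[ℝ] b)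
        rw [Algebra.TensorProduct.tmul_mul_tmul, one_mul]
      exact e ▸ mul _ _ ha hb
    | add a b ha hb =>
      have e : t 1 (a + b) = t 1 a + t 1 b := TensorProduct.tmul_add _ _ _
      exact e ▸ add _ _ ha hb
  refine TensorProduct.induction_on (motive := fun x => P x) x ?_ ?_ ?_
  · have := smul 0 1 one
    rw [zero_smul] at this
    exact this
  · intro z w
    have e : t z w = z • t 1 w := by
      change z ⊗ₜ[ℝ] w = z • ((1 : ℂ) ⊗ₜ[ℝ] w)
      rw [TensorProduct.smul_tmul']; simp
    have := smul z _ (h w)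
    rw [← e] at this
    exact this
  · exact fun x y hx hy => add _ _ hx hy

/-- A family of self-adjoint elements determines a *-homomorphism. -/
def lift {B : Type v} [CStarAlgebra B] (b : X → B) (hb : ∀ x, star (b x) = b x) :
    FreeStar X →⋆ₐ[ℂ] B :=
  let F : FreeStar X →ₐ[ℂ] B := AlgHom.liftEquiv ℝ ℂ (FreeAlgebra ℝ X) B (FreeAlgebra.lift ℝ b)
  have hg : ∀ x, F (gen x) = b x := fun x => by
    refine (AlgHom.liftEquiv_tmul (R := ℝ) (S := ℂ) _ _ _).trans ?_
    simp
  { F with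
    map_star' := fun x => by
      change F (star x) = star (F x)
      induction x using FreeStar.induction with
      | one => simp
      | gen x => rw [star_gen, hg, hb]
      | smul z x hx => rw [star_smul, map_smul, hx, map_smul, star_smul]
      | add x y hx hy => rw [star_add, map_add, hx, hy, map_add, star_add]
      | mul x y hx hy => rw [star_mul, map_mul, hx, hy, map_mul, star_mul] }

theorem lift_gen {B : Type v} [CStarAlgebra B] (b : X → B) (hb : ∀ x, star (b x) = b x) (x : X) :
    lift b hb (gen x) = b x := by
  refine (AlgHom.liftEquiv_tmul (R := ℝ) (S := ℂ) _ _ _).trans ?_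
  simp

end FreeStar

/-- The C*-seminorms on the free *-algebra for which the generators become projections and the
relators become zero. -/
def univFamily {X : Type u} (rel : Set (FreeStar X)) : Set (CStarSeminorm (FreeStar X)) :=
  {p | (∀ x, p (FreeStar.gen x * FreeStar.gen x - FreeStar.gen x) = 0) ∧ ∀ r ∈ rel, p r = 0}

theorem univFamily_bdd {X : Type u} (rel : Set (FreeStar X)) (x : FreeStar X) :
    BddAbove (Set.range fun p : univFamily rel => p.1 x) := by
  suffices h : ∃ D, ∀ p ∈ univFamily rel, p x ≤ D by
    obtain ⟨D, hD⟩ := h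
    exact ⟨D, by rintro _ ⟨p, rfl⟩; exact hD p.1 p.2⟩
  induction x using FreeStar.induction with
  | one =>
    refine ⟨1, fun p _ => ?_⟩
    have := p.star_mul_self' 1
    rw [star_one, one_mul] at this
    by_contra! h
    nlinarith
  | gen x =>
    refine ⟨1, fun p hp => ?_⟩
    have h1 := p.star_mul_self' (FreeStar.gen x)
    rw [FreeStar.star_gen] at h1
    have h2 := p.add_le' (FreeStar.gen x * FreeStar.gen x - FreeStar.gen x) (FreeStar.gen x)
    rw [sub_add_cancel, h1] at h2
    have h3 : p.toFun (FreeStar.gen x * FreeStar.gen x - FreeStar.gen x) = 0 := hp.1 x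
    by_contra! h
    nlinarith
  | smul z x hx =>
    obtain ⟨C, hC⟩ := hx
    exact ⟨‖z‖ * C, fun p hp => (p.smul' z x).trans_le
      (mul_le_mul_of_nonneg_left (hC p hp) (norm_nonneg z))⟩
  | add x y hx hy =>
    obtain ⟨C, hC⟩ := hx
    obtain ⟨D, hD⟩ := hy
    exact ⟨C + D, fun p hp => (p.add_le' x y).trans (add_le_add (hC p hp) (hD p hp))⟩
  | mul x y hx hy =>
    obtain ⟨C, hC⟩ := hx
    obtain ⟨D, hD⟩ := hy
    exact ⟨C * D, fun p hp => (p.mul_le' x y).trans (mul_le_mul (hC p hp) (hD p hp)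
      (p.nonneg y) ((p.nonneg x).trans (hC p hp)))⟩

/-- The universal unital C*-algebra generated by projections `x : X` subject to the relations
`r = 0`, `r ∈ rel`: the completion of the free *-algebra in the largest C*-seminorm for which
these relations hold. -/
def UnivProj {X : Type u} (rel : Set (FreeStar X)) : Type u :=
  (CStarSeminorm.sup (univFamily rel) (univFamily_bdd rel)).Compl

namespace UnivProj

variable {X : Type u} (rel : Set (FreeStar X))

instance : CStarAlgebra (UnivProj rel) :=
  inferInstanceAs (CStarAlgebra (CStarSeminorm.sup (univFamily rel) (univFamily_bdd rel)).Compl)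

/-- The canonical map from the free *-algebra. -/
def of : FreeStar X →⋆ₐ[ℂ] UnivProj rel :=
  (CStarSeminorm.sup (univFamily rel) (univFamily_bdd rel)).of

theorem denseRange_of : DenseRange (of rel) := CStarSeminorm.denseRange_of _

/-- The generators. -/
def gen (x : X) : UnivProj rel := of rel (FreeStar.gen x)

theorem of_rel {r : FreeStar X} (hr : r ∈ rel) : of rel r = 0 := by
  rw [← norm_eq_zero]
  refine (CStarSeminorm.norm_of _ r).trans (le_antisymm ?_ (CStarSeminorm.nonneg _ _))
  exact Real.iSup_le (fun p => (p.2.2 r hr).le) le_rfl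

theorem star_gen (x : X) : star (gen rel x) = gen rel x := by
  rw [gen, ← map_star, FreeStar.star_gen]

theorem gen_mul_gen (x : X) : gen rel x * gen rel x = gen rel x := by
  rw [gen, ← map_mul, ← sub_eq_zero, ← map_sub, ← norm_eq_zero]
  refine (CStarSeminorm.norm_of _ _).trans (le_antisymm ?_ (CStarSeminorm.nonneg _ _))
  exact Real.iSup_le (fun p => (p.2.1 x).le) le_rfl

variable {rel} in
/-- The universal property: projections of a C*-algebra that satisfy the relations determine a
*-homomorphism. -/
def lift {B : Type v} [CStarAlgebra B] (b : X → B) (hb : ∀ x, star (b x) = b x)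
    (hb' : ∀ x, b x * b x = b x) (h : ∀ r ∈ rel, FreeStar.lift b hb r = 0) :
    UnivProj rel →⋆ₐ[ℂ] B :=
  (CStarSeminorm.sup (univFamily rel) (univFamily_bdd rel)).lift (FreeStar.lift b hb) fun x =>
    CStarSeminorm.le_sup (univFamily rel) (univFamily_bdd rel) (CStarSeminorm.ofHom (FreeStar.lift b hb)) ⟨fun x => by
      change ‖FreeStar.lift b hb _‖ = 0
      rw [map_sub, map_mul, FreeStar.lift_gen, hb', sub_self, norm_zero], fun r hr => by
      change ‖FreeStar.lift b hb r‖ = 0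
      rw [h r hr, norm_zero]⟩ x

variable {rel} in
theorem lift_gen {B : Type v} [CStarAlgebra B] (b : X → B) (hb : ∀ x, star (b x) = b x)
    (hb' : ∀ x, b x * b x = b x) (h : ∀ r ∈ rel, FreeStar.lift b hb r = 0) (x : X) :
    lift b hb hb' h (gen rel x) = b x :=
  (CStarSeminorm.lift_of _ _ _ _).trans (FreeStar.lift_gen b hb x)

end UnivProj

/-! ### Compact quantum groups and their co-actions -/

/-- A compact quantum group (Woronowicz C*-algebra) structure on a unital C*-algebra `A`: a
co-associative *-homomorphism `Δ : A → A ⊗ A` such that `Δ(A)(A ⊗ 1)` and `Δ(A)(1 ⊗ A)` span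
dense subspaces. The two sides of `(Δ ⊗ id) Δ = (id ⊗ Δ) Δ` are compared in `A ⊗ A ⊗ A`. -/
structure CQG (A : Type u) [CStarAlgebra A] where
  comul : A →⋆ₐ[ℂ] MinTensor A A
  coassoc : ∀ a, MinTensor₃.ofLeft (MinTensor.map comul (StarAlgHom.id ℂ A) (comul a)) =
    MinTensor₃.ofRight (MinTensor.map (StarAlgHom.id ℂ A) comul (comul a))
  dense_left : Dense (Submodule.span ℂ
    (Set.range fun p : A × A => comul p.1 * MinTensor.tmul p.2 1) : Set (MinTensor A A))
  dense_right : Dense (Submodule.span ℂ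
    (Set.range fun p : A × A => comul p.1 * MinTensor.tmul 1 p.2) : Set (MinTensor A A))

/-- A closed *-subalgebra `S` with a compact quantum group structure `G'` is a Woronowicz
C*-subalgebra of `(A, G)` if the co-product of `G'` is the restriction of the co-product of `G`,
i.e. `(ι ⊗ ι) Δ' = Δ ι` for the inclusion `ι : S → A`. -/
def CQG.IsWoronowiczSub {A : Type u} [CStarAlgebra A] (G : CQG A) (S : StarSubalgebra ℂ A)
    [IsClosed (S : Set A)] (G' : CQG S) : Prop :=
  ∀ a : S, MinTensor.map S.subtype S.subtype (G'.comul a) = G.comul a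

open Classical in
/-- A co-action `α : C(X) → C(X) ⊗ A` of a compact quantum group on a finite set `X`. Here
`C(X) ⊗ A` is the algebra of functions `X → A`; writing `α(χ_x) = ∑ y, χ_y ⊗ q y x`, the
condition `comul` is `(α ⊗ id) α = (id ⊗ Δ) α`. -/
structure FiniteCoaction {A : Type u} [CStarAlgebra A] (G : CQG A) (X : Type v) [Fintype X] where
  toHom : (X → ℂ) →⋆ₐ[ℂ] (X → A)
  comul : ∀ x y, G.comul (toHom (Pi.single x 1) y) =
    ∑ z, MinTensor.tmul (toHom (Pi.single z 1) y) (toHom (Pi.single x 1) z)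
  dense : Dense (Submodule.span ℂ
    (Set.range fun p : (X → ℂ) × A => fun y => toHom p.1 y * p.2) : Set (X → A))

open Classical in
/-- A bi-unitary co-representation `β : L²(E) → L²(E) ⊗ A`,
`β(χ_τ) = ∑ σ, χ_σ ⊗ u σ τ`: the matrix `u` and its entrywise adjoint are unitary and
`Δ(u σ τ) = ∑ ρ, u σ ρ ⊗ u ρ τ`. -/
structure BiunitaryCorep {A : Type u} [CStarAlgebra A] (G : CQG A) (E : Type v) [Fintype E] where
  u : Matrix E E A
  unitary_u : u ∈ unitary (Matrix E E A)
  unitary_conj : u.map star ∈ unitary (Matrix E E A)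
  comul : ∀ σ τ, G.comul (u σ τ) = ∑ ρ, MinTensor.tmul (u σ ρ) (u ρ τ)

/-- The map `β : L²(E) → L²(E) ⊗ A`, where `L²(E) ⊗ A` is the space of functions `E → A`. -/
def BiunitaryCorep.toMap {A : Type u} [CStarAlgebra A] {G : CQG A} {E : Type v} [Fintype E]
    (β : BiunitaryCorep G E) (f : E → ℂ) : E → A :=
  fun σ => ∑ τ, f τ • β.u σ τ

/-- A co-representation is faithful if its coefficients generate `A` as a C*-algebra. -/
def BiunitaryCorep.Faithful {A : Type u} [CStarAlgebra A] {G : CQG A} {E : Type v} [Fintype E]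
    (β : BiunitaryCorep G E) : Prop :=
  (StarAlgebra.adjoin ℂ (Set.range fun p : E × E => β.u p.1 p.2)).topologicalClosure = ⊤

/-! ### Multigraphs -/

/-- A multigraph with source and target maps and without isolated vertices. -/
structure Multigraph (V : Type u) (E : Type v) where
  src : E → V
  tgt : E → V
  no_isolated : ∀ v, ∃ e, src e = v ∨ tgt e = v

/-- A bi-unitary co-representation on the edge space of a compact quantum group, i.e. a triple
`(A, Δ, β)`. -/
structure EdgeCorep (E : Type v) [Fintype E] where
  A : Type w
  [cstar : CStarAlgebra A]
  qg : CQG A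
  β : BiunitaryCorep qg E

namespace Multigraph

variable {V : Type u} {E : Type v} [Fintype V] [Fintype E] (G : Multigraph V E)

section Categories

variable {A : Type w} [CStarAlgebra A] {Q : CQG A}

/-- The pair `(α, β)` respects the `C(V)`-`C(V)` bimodule structure of `L²(E)`:
`β(f · g) = α(f) β(g)` and `β(g · f) = β(g) α(f)`. -/
def RespectsBimodule (α : FiniteCoaction Q V) (β : BiunitaryCorep Q E) : Prop :=
  ∀ (f : V → ℂ) (g : E → ℂ),
    β.toMap (fun e => f (G.src e) * g e) = (fun e => α.toHom f (G.src e) * β.toMap g e) ∧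
    β.toMap (fun e => g e * f (G.tgt e)) = (fun e => β.toMap g e * α.toHom f (G.tgt e))

/-- `β` preserves quantum symmetry in Banica's sense. -/
def PreservesBanica (β : BiunitaryCorep Q E) : Prop :=
  (∃ α : FiniteCoaction Q V, G.RespectsBimodule α β) ∧ β.toMap (fun _ => 1) = fun _ => 1

/-- Restricted orthogonality for parallel edges. -/
def RestrictedOrthogonality (β : BiunitaryCorep Q E) : Prop :=
  ∀ σ σ' τ, G.src σ = G.src σ' → G.tgt σ = G.tgt σ' → σ ≠ σ' →
    β.u σ τ * star (β.u σ' τ) = 0 ∧ star (β.u σ τ) * β.u σ' τ = 0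

/-- `β` preserves quantum symmetry (in the sense between Bichon's and Banica's). -/
def PreservesSym (β : BiunitaryCorep Q E) : Prop :=
  G.PreservesBanica β ∧ G.RestrictedOrthogonality β

open Classical in
/-- `β` preserves quantum symmetry in Bichon's sense: it is a co-action on the algebra `C(E)`,
and it respects the bimodule structure for some co-action on `C(V)`. -/
def PreservesBichon (β : BiunitaryCorep Q E) : Prop :=
  (∃ γ : FiniteCoaction Q E, ∀ σ τ, γ.toHom (Pi.single τ 1) σ = β.u σ τ) ∧
    ∃ α : FiniteCoaction Q V, G.RespectsBimodule α β

end Categories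

/-- The objects `(A, Δ, β)` of the category of co-actions preserving quantum symmetry. -/
def catSym : Set (EdgeCorep.{v, w} E) :=
  {X | letI := X.cstar; G.PreservesSym X.β}

/-- The objects `(A, Δ, β)` of the category of co-actions preserving quantum symmetry in Bichon's
sense. -/
def catBic : Set (EdgeCorep.{v, w} E) :=
  {X | letI := X.cstar; G.PreservesBichon X.β}

/-- The set of edges from `i` to `j`. -/
def edges (i j : V) : Set E := {e | G.src e = i ∧ G.tgt e = j}

/-- The number of edges from `i` to `j`. -/
def mult (i j : V) : ℕ := (G.edges i j).ncard

/-- The maximal number `N` of edges between two vertices. -/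
def maxMult : ℕ := Finset.univ.sup fun p : V × V => G.mult p.1 p.2

/-- An edge-labeling: the edges from `i` to `j` are numbered bijectively by the first `mult i j`
elements of `Fin N`, so that the edge `e` is `(src e, tgt e) (lab e)`. -/
structure EdgeLabeling where
  lab : E → Fin G.maxMult
  bij : ∀ i j, Set.BijOn (fun e => (lab e : ℕ)) (G.edges i j) (Set.Iio (G.mult i j))

variable {G} (L : G.EdgeLabeling)

/-- The index set of the generators `q k s i r`. -/
abbrev EdgeLabeling.Index (_L : G.EdgeLabeling) : Type u :=
  (V × Fin G.maxMult) × (V × Fin G.maxMult)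

/-- The free generator `q k s i r`. -/
def EdgeLabeling.free (k : V) (s : Fin G.maxMult) (i : V) (r : Fin G.maxMult) :
    FreeStar L.Index := FreeStar.gen ((k, s), (i, r))

/-- The relators of `Q`. The relations `row`, `col` (for projections) are the quantum permutation
relations; `vertex` says that `α(C(V) ⊗ 1) ⊆ C(V) ⊗ 1 ⊗ Q`; the last three say that the
co-action preserves the space of edges. -/
inductive EdgeLabeling.Rel : FreeStar L.Index → Prop
  | row (k s) : Rel (∑ i, ∑ r, L.free k s i r - 1)
  | col (i r) : Rel (∑ k, ∑ s, L.free k s i r - 1)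
  | vertex (k i s s') : Rel (∑ r, L.free k s i r - ∑ r, L.free k s' i r)
  | noEdge (e : E) (k l s s') (h : G.mult k l = 0) :
      Rel (L.free k s (G.src e) (L.lab e) * L.free l s' (G.tgt e) (L.lab e))
  | offDiag (e : E) (k l s s') (h : G.mult k l ≠ 0) (hs : s ≠ s') :
      Rel (L.free k s (G.src e) (L.lab e) * L.free l s' (G.tgt e) (L.lab e))
  | excess (e : E) (k l) (s : Fin G.maxMult) (h : G.mult k l ≠ 0) (hs : G.mult k l ≤ (s : ℕ)) :
      Rel (L.free k s (G.src e) (L.lab e) * L.free l s (G.tgt e) (L.lab e))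

/-- The universal C*-algebra `Q` of the labelled multigraph. -/
abbrev EdgeLabeling.Q : Type u := UnivProj {x | L.Rel x}

/-- The generators `q k s i r` of `Q`. -/
def EdgeLabeling.q (k : V) (s : Fin G.maxMult) (i : V) (r : Fin G.maxMult) : L.Q :=
  UnivProj.gen _ ((k, s), (i, r))

/-- The pair `(k, s)` is permissible if `(k, l) s` or `(l, k) s` is an edge for some `l`. -/
def EdgeLabeling.Permissible (k : V) (s : Fin G.maxMult) : Prop :=
  ∃ e, (G.src e = k ∨ G.tgt e = k) ∧ L.lab e = s

/-- The C*-subalgebra `Q'` of `Q` generated by the `q k s i r` with `(k, s)` and `(i, r)`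
permissible. -/
def EdgeLabeling.Q' : StarSubalgebra ℂ L.Q :=
  (StarAlgebra.adjoin ℂ {x | ∃ k s i r, L.Permissible k s ∧ L.Permissible i r ∧
    x = L.q k s i r}).topologicalClosure

instance : IsClosed (L.Q' : Set L.Q) := StarSubalgebra.isClosed_topologicalClosure _

end Multigraph

end

/-! The relations of `Q` are studied for a matrix `b` over an arbitrary C*-algebra (`Magic`), since
homomorphisms out of `Q` correspond to such matrices (`Magic.hom`). Summing out labels gives a
quantum permutation matrix `vtx` on the vertices. The edge relation is stated only for columns; the
crucial fact is that it passes to rows, so that the relations are stable under transposition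
(`Magic.transpose`). This is a counting argument (`Magic.mul_vtx_eq_zero`): a family of positive
elements indexed by edges and by pairs (labelled vertex, vertex) has total mass `|E|`, and its part
over the pairs that come from edges already has mass `|E|`, so the rest vanishes.

Orthogonality and the edge relation make half of the bi-unitarity conditions for the edge
coefficients routine, and transposing gives the other half. A bi-unitary matrix that generates the
algebra and is multiplicative for `Δ` gives a compact quantum group (`CQG.ofMatrix`). On `Q` the
co-product exists because the tensor product of two magic matrices is magic (`Magic.tensor`).

For `Q'`: inserting a column sum equal to `1` writes each generator with a permissible column as a
sum of edge coefficients and zeros (`Q'_eq`). To obtain a co-product with values in `Q' ⊗ Q'`, a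
retraction of `Q` onto `Q'` is built from the universal property. Entries with no permissible index
are replaced by `δ · vtx`. This is again magic because `vtx k i = 0` unless `k` and `i` have the
same permissible labels (`Magic.vtx_eq_zero_of_permissible`). The co-product of `Q'` is then `Δ`
followed by the retraction on both legs.

Non-Bichon type is proved by contraposition. If the co-representation of `Q'` is of Bichon type, its
edge coefficients are self-adjoint. For any `(α, β)` that preserves quantum symmetry, the matrix of
`α` repeated on every label is magic, so `Q` maps to that algebra, and the products `α_{ki} α_{lj}`,
for edges `k → l` and `i → j`, become self-adjoint, hence projections. Such a product is the sum of
the coefficients `u σ τ` over the edges `σ` from `k` to `l`, for any edge `τ` from `i` to `j`.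
Restricted orthogonality then makes each `u σ τ` a projection (`CStarAlgebra.isProjection_of_sum`),
so `β` is a co-action on `C(E)`. -/

/-! ### Positivity in C*-algebras. -/

/-- The summands are positive in the spectral order. This is how the arguments that compare sums of
positive elements conclude. -/
theorem CStarAlgebra.eq_zero_of_sum_zsmul_star_mul_self {B : Type*} [CStarAlgebra B] {ι : Type*}
    {s : Finset ι} {c : ι → ℤ} {x : ι → B} (hc : ∀ i ∈ s, 0 ≤ c i)
    (h : ∑ i ∈ s, c i • (star (x i) * x i) = 0) {i : ι} (hi : i ∈ s) (hci : c i ≠ 0) :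
    x i = 0 := by
  let _ := CStarAlgebra.spectralOrder B
  let _ := CStarAlgebra.spectralOrderedRing B
  have h1 := (Finset.sum_eq_zero_iff_of_nonneg
    fun j hj => zsmul_nonneg (star_mul_self_nonneg (x j)) (hc j hj)).1 h i hi
  rw [← Int.cast_smul_eq_zsmul ℂ, smul_eq_zero, CStarRing.star_mul_self_eq_zero_iff] at h1
  exact h1.resolve_left (by exact_mod_cast hci)

theorem CStarAlgebra.eq_zero_of_sum_star_mul_self {B : Type*} [CStarAlgebra B] {ι : Type*}
    {s : Finset ι} {x : ι → B} (h : ∑ i ∈ s, star (x i) * x i = 0) {i : ι} (hi : i ∈ s) :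
    x i = 0 :=
  eq_zero_of_sum_zsmul_star_mul_self (c := fun _ => 1) (fun _ _ => zero_le_one)
    (by simpa using h) hi one_ne_zero

/-- Projections of a C*-algebra that add up to `1` are pairwise orthogonal. -/
theorem CStarAlgebra.mul_eq_zero_of_sum_eq_one {B : Type*} [CStarAlgebra B] {ι : Type*}
    [Fintype ι] {x : ι → B} (hs : ∀ i, star (x i) = x i) (hx : ∀ i, x i * x i = x i)
    (h : ∑ i, x i = 1) {i j : ι} (hij : i ≠ j) : x i * x j = 0 := by
  classical
  -- Compressing `∑ x k = 1` by `x j` leaves `∑_{k ≠ j} x j * x k * x j = 0`, a sum of squares.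
  have h1 : ∑ k ∈ Finset.univ.erase j, star (x k * x j) * (x k * x j) = 0 := by
    have h2 : ∀ k, star (x k * x j) * (x k * x j) = x j * x k * x j := fun k => by
      rw [star_mul, hs, hs, mul_assoc, ← mul_assoc (x k), hx, mul_assoc]
    simp only [h2]
    rw [← Finset.sum_mul, ← Finset.mul_sum, Finset.sum_erase_eq_sub (Finset.mem_univ j), h,
      mul_sub, sub_mul, mul_one, hx, hx, sub_self]
  exact eq_zero_of_sum_star_mul_self h1 (Finset.mem_erase.2 ⟨hij, Finset.mem_univ i⟩)

/-! ### Magic matrices: the relations of `Q` over an arbitrary C*-algebra. -/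

namespace Multigraph

variable {V : Type u} {E : Type v} [Fintype V] {G : Multigraph V E}

namespace EdgeLabeling

variable (L : G.EdgeLabeling)

/-- The source of an edge, together with its label. -/
def s (e : E) : V × Fin G.maxMult := (G.src e, L.lab e)

/-- The target of an edge, together with its label. -/
def t (e : E) : V × Fin G.maxMult := (G.tgt e, L.lab e)

/-- `((k, s), (l, s'))` is an edge pair if `s = s'` and `(k, l) s` is an edge. -/
def EdgePair (x y : V × Fin G.maxMult) : Prop := ∃ e, L.s e = x ∧ L.t e = y

theorem ext_edge {e e' : E} (h : L.s e = L.s e') (h' : G.tgt e = G.tgt e') : e = e' :=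
  (L.bij (G.src e) (G.tgt e)).injOn ⟨rfl, rfl⟩ ⟨(congrArg Prod.fst h).symm, h'.symm⟩
    (congrArg (fun x => (x.2 : ℕ)) h)

theorem lab_lt (e : E) : (L.lab e : ℕ) < G.mult (G.src e) (G.tgt e) :=
  (L.bij (G.src e) (G.tgt e)).mapsTo ⟨rfl, rfl⟩

theorem exists_edge {k l : V} {n : ℕ} (h : n < G.mult k l) :
    ∃ e, G.src e = k ∧ G.tgt e = l ∧ (L.lab e : ℕ) = n := by
  obtain ⟨e, he, h⟩ := (L.bij k l).surjOn h
  exact ⟨e, he.1, he.2, h⟩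

theorem edgePair_of_lt {k l : V} {r : Fin G.maxMult} (h : (r : ℕ) < G.mult k l) :
    L.EdgePair (k, r) (l, r) := by
  obtain ⟨e, rfl, rfl, h'⟩ := L.exists_edge h
  exact ⟨e, Prod.ext rfl (Fin.ext h'), Prod.ext rfl (Fin.ext h')⟩

/-- An edge is determined by its labelled endpoints. Since the edge relation kills the remaining
pairs, sums over edges become free double sums, to which the row and column relations apply. -/
theorem sum_edge [Fintype E] {M : Type*} [AddCommMonoid M] (F : V × Fin G.maxMult → V × Fin G.maxMult → M)
    (hF : ∀ x y, ¬ L.EdgePair x y → F x y = 0) :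
    ∑ e, F (L.s e) (L.t e) = ∑ x, ∑ y, F x y := by
  rw [← Fintype.sum_prod_type']
  refine Fintype.sum_of_injective (fun e => (L.s e, L.t e)) ?_ _ _ ?_ fun _ => rfl
  · intro e e' h
    obtain ⟨h1, h2⟩ := Prod.ext_iff.1 h
    exact L.ext_edge h1 (congrArg Prod.fst h2)
  · rintro ⟨x, y⟩ h
    refine hF x y fun ⟨e, h1, h2⟩ => h ⟨e, Prod.ext h1 h2⟩

/-- The label of some edge at the vertex `k`. -/
noncomputable def label (k : V) : Fin G.maxMult := L.lab (G.no_isolated k).choose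

theorem permissible_label (k : V) : L.Permissible k (L.label k) :=
  ⟨_, (G.no_isolated k).choose_spec, rfl⟩

/-- The relations of the algebra `Q` of a labelled multigraph, for a matrix over a C*-algebra
whose rows and columns are indexed by the labelled vertices. -/
structure Magic {B : Type w} [CStarAlgebra B]
    (b : V × Fin G.maxMult → V × Fin G.maxMult → B) : Prop where
  star_eq : ∀ x y, star (b x y) = b x y
  idem : ∀ x y, b x y * b x y = b x y
  row : ∀ x, ∑ y, b x y = 1
  col : ∀ y, ∑ x, b x y = 1
  vertex : ∀ k i s s', ∑ r, b (k, s) (i, r) = ∑ r, b (k, s') (i, r)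
  -- The failures of `EdgePair` are exactly: no edge, unequal labels, or a label beyond the
  -- multiplicity. One field thus covers the last three families of relators.
  edge : ∀ e x y, ¬ L.EdgePair x y → b x (L.s e) * b y (L.t e) = 0

/-- The entry `∑ r, b (k, s) (i, r)` of the matrix over the vertices that is induced by `b`. -/
noncomputable def vtx {B : Type w} [AddCommMonoid B]
    (b : V × Fin G.maxMult → V × Fin G.maxMult → B) (k i : V) : B :=
  ∑ r, b (k, L.label k) (i, r)

namespace Magic

variable {L} {B : Type w} [CStarAlgebra B] {b : V × Fin G.maxMult → V × Fin G.maxMult → B}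
  (h : L.Magic b)
include h

theorem row_orth (x) {y y'} (hy : y ≠ y') : b x y * b x y' = 0 :=
  CStarAlgebra.mul_eq_zero_of_sum_eq_one (h.star_eq x) (h.idem x) (h.row x) hy

theorem col_orth (y) {x x'} (hx : x ≠ x') : b x y * b x' y = 0 :=
  CStarAlgebra.mul_eq_zero_of_sum_eq_one (x := fun x => b x y) (fun x => h.star_eq x y)
    (fun x => h.idem x y) (h.col y) hx

theorem sum_right (k i s) : ∑ r, b (k, s) (i, r) = L.vtx b k i := h.vertex _ _ _ _

theorem star_vtx (k i) : star (L.vtx b k i) = L.vtx b k i := by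
  simp only [vtx, star_sum, h.star_eq]

theorem mul_vtx_self (k i s r) : b (k, s) (i, r) * L.vtx b k i = b (k, s) (i, r) := by
  rw [← h.sum_right k i s, Finset.mul_sum, Finset.sum_eq_single r, h.idem]
  · intro r' _ hr
    exact h.row_orth _ fun h' => hr (congrArg Prod.snd h').symm
  · simp

theorem vtx_mul_self (k i s r) : L.vtx b k i * b (k, s) (i, r) = b (k, s) (i, r) := by
  simpa [h.star_eq, h.star_vtx] using congrArg star (h.mul_vtx_self k i s r)

theorem vtx_idem (k i) : L.vtx b k i * L.vtx b k i = L.vtx b k i := by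
  nth_rw 1 [vtx]
  rw [Finset.sum_mul]
  exact Finset.sum_congr rfl fun r _ => h.mul_vtx_self _ _ _ _

theorem sum_vtx_right (k) : ∑ i, L.vtx b k i = 1 := by
  rw [← h.row (k, L.label k), Fintype.sum_prod_type]; rfl

/-- Counting all entries in the `N` columns over `i` by rows and by columns gives `N` times the
claim; `N ≠ 0` because `i` is not isolated. -/
theorem sum_vtx_left (i) : ∑ k, L.vtx b k i = 1 := by
  have h1 : G.maxMult • ∑ k, L.vtx b k i = G.maxMult • (1 : B) := by
    calc _ = ∑ k, ∑ _s : Fin G.maxMult, L.vtx b k i := by simp [Finset.smul_sum]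
      _ = ∑ k, ∑ s, ∑ r, b (k, s) (i, r) := by simp only [h.sum_right]
      _ = ∑ r, ∑ x, b x (i, r) := by rw [← Fintype.sum_prod_type', Finset.sum_comm]
      _ = _ := by simp [h.col]
  have h2 : G.maxMult ≠ 0 := (L.label i).pos.ne'
  rw [← Nat.cast_smul_eq_nsmul ℂ, ← Nat.cast_smul_eq_nsmul ℂ] at h1
  exact smul_right_injective B (by exact_mod_cast h2 : (G.maxMult : ℂ) ≠ 0) h1

theorem vtx_row_orth (k) {i i'} (hi : i ≠ i') : L.vtx b k i * L.vtx b k i' = 0 :=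
  CStarAlgebra.mul_eq_zero_of_sum_eq_one (h.star_vtx k) (h.vtx_idem k) (h.sum_vtx_right k) hi

theorem vtx_col_orth (i) {k k'} (hk : k ≠ k') : L.vtx b k i * L.vtx b k' i = 0 :=
  CStarAlgebra.mul_eq_zero_of_sum_eq_one (x := fun k => L.vtx b k i) (fun k => h.star_vtx k i)
    (fun k => h.vtx_idem k i) (h.sum_vtx_left i) hk

/-- Multiplying the column sum `1` on the left by `vtx k i` keeps only the rows over `k`. This is
the vertex relation for the transpose. -/
theorem sum_left (k i r) : ∑ s, b (k, s) (i, r) = L.vtx b k i := by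
  calc _ = ∑ k', ∑ s, L.vtx b k i * b (k', s) (i, r) := by
        rw [Finset.sum_eq_single k]
        · simp only [h.vtx_mul_self]
        · intro k' _ hk
          refine Finset.sum_eq_zero fun s _ => ?_
          rw [← h.vtx_mul_self, ← mul_assoc, h.vtx_col_orth i hk.symm, zero_mul]
        · simp
    _ = _ := by
        rw [← Fintype.sum_prod_type' (f := fun k' s => L.vtx b k i * b (k', s) (i, r)),
          ← Finset.mul_sum, h.col, mul_one]

/-- When `vtx` is expanded down the column `L.t τ`, the edge relation at `τ` leaves only the label
of `σ`. -/
theorem mul_vtx_tgt (σ τ) : b (L.s σ) (L.s τ) * L.vtx b (G.tgt σ) (G.tgt τ) =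
    b (L.s σ) (L.s τ) * b (L.t σ) (L.t τ) := by
  rw [← h.sum_left (G.tgt σ) (G.tgt τ) (L.lab τ), Finset.mul_sum,
    Finset.sum_eq_single (L.lab σ)]
  · rfl
  · intro r _ hr
    refine h.edge τ _ _ ?_
    rintro ⟨e, he, he'⟩
    exact hr ((congrArg Prod.snd he').symm.trans (congrArg Prod.snd he))
  · simp

theorem edge_star (e x y) (hxy : ¬ L.EdgePair x y) : b y (L.t e) * b x (L.s e) = 0 := by
  simpa [h.star_eq] using congrArg star (h.edge e x y hxy)

/-- A permissible column is one end of an edge `e`. Multiply by the column sum at the other end: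
every term vanishes, since `x` is an endpoint of no edge pair. -/
theorem eq_zero_of_permissible {x y : V × Fin G.maxMult} (hy : L.Permissible y.1 y.2)
    (hx : ¬ L.Permissible x.1 x.2) : b x y = 0 := by
  obtain ⟨i, r⟩ := y
  obtain ⟨e, he, rfl⟩ := hy
  obtain rfl | rfl := he
  · rw [← mul_one (b _ _), ← h.col (L.t e), Finset.mul_sum]
    refine Finset.sum_eq_zero fun z _ => h.edge e x z ?_
    rintro ⟨e', rfl, -⟩
    exact hx ⟨e', Or.inl rfl, rfl⟩
  · rw [← one_mul (b _ _), ← h.col (L.s e), Finset.sum_mul]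
    refine Finset.sum_eq_zero fun z _ => h.edge e z x ?_
    rintro ⟨e', -, rfl⟩
    exact hx ⟨e', Or.inr rfl, rfl⟩

variable [Fintype E]

/-- The elements `b (s σ) x * vtx (tgt σ) j * b (s σ) x` are squares. For fixed `σ` they sum to `1`
over all `(x, j)`; for fixed `τ` and `(x, j) = (s τ, tgt τ)` they sum to `1` over all `σ`. Both give
total mass `|E|`, so nothing is left for the pairs that do not come from an edge. -/
theorem mul_vtx_eq_zero (σ x j) (hx : ¬ ∃ τ, L.s τ = x ∧ G.tgt τ = j) :
    b (L.s σ) x * L.vtx b (G.tgt σ) j = 0 := by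
  classical
  let F : E → (V × Fin G.maxMult) × V → B := fun σ z =>
    L.vtx b (G.tgt σ) z.2 * b (L.s σ) z.1
  have hF : ∀ σ z, star (F σ z) * F σ z =
      b (L.s σ) z.1 * L.vtx b (G.tgt σ) z.2 * b (L.s σ) z.1 := fun σ z => by
    simp only [F]
    rw [star_mul, h.star_eq, h.star_vtx, mul_assoc, ← mul_assoc (L.vtx b _ _), h.vtx_idem,
      mul_assoc]
  let f : E → (V × Fin G.maxMult) × V := fun τ => (L.s τ, G.tgt τ)
  have hf : Function.Injective f := fun τ τ' hτ =>
    L.ext_edge (congrArg Prod.fst hτ) (congrArg Prod.snd hτ)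
  have h1 : ∀ σ, ∑ z, star (F σ z) * F σ z = 1 := fun σ => by
    simp only [hF]
    rw [Fintype.sum_prod_type, ← h.row (L.s σ)]
    refine Finset.sum_congr rfl fun x _ => ?_
    simp only [← Finset.sum_mul, ← Finset.mul_sum, h.sum_vtx_right, mul_one, h.idem]
  -- At such a pair `mul_vtx_tgt` restores the product of two entries of `b`, so the edge relation
  -- frees the sum over `σ`.
  have h2 : ∀ τ, ∑ σ, star (F σ (f τ)) * F σ (f τ) = 1 := fun τ => by
    simp only [hF, f, h.mul_vtx_tgt]
    rw [L.sum_edge (fun x y => b x (L.s τ) * b y (L.t τ) * b x (L.s τ)) fun x y hxy => by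
      rw [h.edge τ x y hxy, zero_mul], ← h.col (L.s τ)]
    refine Finset.sum_congr rfl fun x _ => ?_
    simp only [← Finset.sum_mul, ← Finset.mul_sum, h.col, mul_one, h.idem]
  have h3 : ∑ p ∈ Finset.univ ×ˢ (Finset.univ \ Finset.univ.image f),
      star (F p.1 p.2) * F p.1 p.2 = 0 := by
    rw [Finset.sum_product]
    have h4 : ∀ σ, ∑ z ∈ Finset.univ \ Finset.univ.image f, star (F σ z) * F σ z =
        1 - ∑ τ, star (F σ (f τ)) * F σ (f τ) := fun σ => by
      rw [eq_sub_iff_add_eq, ← h1 σ, ← Finset.sum_image (f := fun z => star (F σ z) * F σ z)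
        hf.injOn, Finset.sum_sdiff (Finset.subset_univ _)]
    simp only [h4]
    rw [Finset.sum_sub_distrib, Finset.sum_comm (f := fun σ τ => star (F σ (f τ)) * F σ (f τ))]
    simp only [h2, sub_self]
  have h5 : F σ (x, j) = 0 := by
    refine CStarAlgebra.eq_zero_of_sum_star_mul_self h3 (i := (σ, (x, j))) ?_
    simp only [Finset.mem_product, Finset.mem_univ, true_and, Finset.mem_sdiff, Finset.mem_image,
      f, Prod.mk.injEq]
    exact hx
  simpa [F, h.star_eq, h.star_vtx] using congrArg star h5

/-- The edge relation for rows. Insert `vtx (tgt σ) j` between the factors. Either `(x, j)` comes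
from no edge and `mul_vtx_eq_zero` applies, or it comes from some `τ`; then the entry at `L.t τ`
appears, which is orthogonal to the entry at `y ≠ L.t τ` in the same row. -/
theorem edge_left (σ x y) (hxy : ¬ L.EdgePair x y) : b (L.s σ) x * b (L.t σ) y = 0 := by
  obtain ⟨j, r⟩ := y
  have h1 : L.vtx b (G.tgt σ) j * b (L.t σ) (j, r) = b (L.t σ) (j, r) := h.vtx_mul_self _ _ _ _
  rw [← h1, ← mul_assoc]
  by_cases hx : ∃ τ, L.s τ = x ∧ G.tgt τ = j
  · obtain ⟨τ, rfl, rfl⟩ := hx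
    rw [h.mul_vtx_tgt, mul_assoc, h.row_orth, mul_zero]
    exact fun h' => hxy ⟨τ, rfl, h'⟩
  · rw [h.mul_vtx_eq_zero σ x j hx, zero_mul]

/-- Every statement about columns now yields the one about rows; this takes the place of an
antipode. -/
theorem transpose : L.Magic fun x y => b y x where
  star_eq x y := h.star_eq y x
  idem x y := h.idem y x
  row := h.col
  col := h.row
  vertex k i s s' := by rw [h.sum_left, h.sum_left]
  edge := h.edge_left

theorem eq_zero_of_permissible' {x y : V × Fin G.maxMult} (hx : L.Permissible x.1 x.2)
    (hy : ¬ L.Permissible y.1 y.2) : b x y = 0 :=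
  h.transpose.eq_zero_of_permissible hx hy

/-- The inner factors lie in the same row, so they vanish unless `τ` and `τ'` have the same labelled
source. In that case the sum over `σ` is free and collapses to orthogonality of the target entries.
-/
theorem sum_star_mul (τ τ' : E) [Decidable (τ = τ')] :
    ∑ σ, star (b (L.s σ) (L.s τ) * b (L.t σ) (L.t τ)) *
      (b (L.s σ) (L.s τ') * b (L.t σ) (L.t τ')) = if τ = τ' then 1 else 0 := by
  have h1 : ∀ σ, star (b (L.s σ) (L.s τ) * b (L.t σ) (L.t τ)) *
      (b (L.s σ) (L.s τ') * b (L.t σ) (L.t τ')) =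
      b (L.t σ) (L.t τ) * (b (L.s σ) (L.s τ) * b (L.s σ) (L.s τ')) * b (L.t σ) (L.t τ') :=
    fun σ => by simp only [star_mul, h.star_eq, mul_assoc]
  simp only [h1]
  by_cases hs : L.s τ = L.s τ'
  · simp only [← hs, h.idem]
    rw [L.sum_edge (fun x y => b y (L.t τ) * b x (L.s τ) * b y (L.t τ')) fun x y hxy => by
      rw [h.edge_star τ x y hxy, zero_mul], Finset.sum_comm]
    simp only [← Finset.sum_mul, ← Finset.mul_sum, h.col, mul_one]
    split_ifs with hτ
    · subst hτ
      simp only [h.idem, h.col]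
    · refine Finset.sum_eq_zero fun y _ => h.row_orth y fun ht => hτ (L.ext_edge hs ?_)
      exact congrArg Prod.fst ht
  · rw [if_neg fun hτ => hs (congrArg _ hτ)]
    simp only [h.row_orth _ hs, mul_zero, zero_mul, Finset.sum_const_zero]

theorem sum_mul_star (τ τ' : E) [Decidable (τ = τ')] :
    ∑ σ, (b (L.s σ) (L.s τ) * b (L.t σ) (L.t τ)) *
      star (b (L.s σ) (L.s τ') * b (L.t σ) (L.t τ')) = if τ = τ' then 1 else 0 := by
  have h1 : ∀ σ, (b (L.s σ) (L.s τ) * b (L.t σ) (L.t τ)) *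
      star (b (L.s σ) (L.s τ') * b (L.t σ) (L.t τ')) =
      b (L.s σ) (L.s τ) * (b (L.t σ) (L.t τ) * b (L.t σ) (L.t τ')) * b (L.s σ) (L.s τ') :=
    fun σ => by simp only [star_mul, h.star_eq, mul_assoc]
  simp only [h1]
  by_cases ht : L.t τ = L.t τ'
  · simp only [← ht, h.idem]
    rw [L.sum_edge (fun x y => b x (L.s τ) * b y (L.t τ) * b x (L.s τ')) fun x y hxy => by
      rw [h.edge τ x y hxy, zero_mul]]
    simp only [← Finset.sum_mul, ← Finset.mul_sum, h.col, mul_one]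
    split_ifs with hτ
    · subst hτ
      simp only [h.idem, h.col]
    · refine Finset.sum_eq_zero fun y _ => h.row_orth y fun hs => hτ (L.ext_edge hs ?_)
      exact congrArg Prod.fst ht
  · rw [if_neg fun hτ => ht (congrArg _ hτ)]
    simp only [h.row_orth _ ht, mul_zero, zero_mul, Finset.sum_const_zero]

theorem sum_edge_col (τ : E) : ∑ σ, b (L.s σ) (L.s τ) * b (L.t σ) (L.t τ) = 1 := by
  rw [L.sum_edge (fun x y => b x (L.s τ) * b y (L.t τ)) (h.edge τ)]
  simp only [← Finset.mul_sum, h.col, mul_one]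

end Magic

end EdgeLabeling

end Multigraph

/-! ### Generators of C*-algebras -/

theorem starAlgHom_ext_of_generates {A : Type*} {B : Type*} [CStarAlgebra A] [CStarAlgebra B]
    {S : Set A} (hS : (StarAlgebra.adjoin ℂ S).topologicalClosure = ⊤) {f g : A →⋆ₐ[ℂ] B}
    (h : ∀ a ∈ S, f a = g a) : f = g := by
  have h1 : StarAlgebra.adjoin ℂ S ≤ StarAlgHom.equalizer f g := StarAlgebra.adjoin_le h
  have h2 : (StarAlgebra.adjoin ℂ S).topologicalClosure ≤ StarAlgHom.equalizer f g :=
    StarSubalgebra.topologicalClosure_minimal h1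
      (isClosed_eq (starAlgHom_continuous f) (starAlgHom_continuous g))
  rw [hS] at h2
  ext a
  exact h2 (StarSubalgebra.mem_top (x := a))

theorem UnivProj.generates {X : Type u} (rel : Set (FreeStar X)) :
    (StarAlgebra.adjoin ℂ (Set.range (UnivProj.gen rel))).topologicalClosure = ⊤ := by
  rw [eq_top_iff]
  intro a _
  refine closure_mono ?_ (UnivProj.denseRange_of rel a)
  rintro _ ⟨x, rfl⟩
  change UnivProj.of rel x ∈ StarAlgebra.adjoin ℂ (Set.range (UnivProj.gen rel))
  induction x using FreeStar.induction with
  | one => rw [map_one]; exact one_mem _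
  | gen x => exact StarAlgebra.subset_adjoin _ _ ⟨x, rfl⟩
  | smul z x hx => rw [map_smul]; exact (StarAlgebra.adjoin ℂ _).smul_mem hx z
  | add x y hx hy => rw [map_add]; exact add_mem hx hy
  | mul x y hx hy => rw [map_mul]; exact mul_mem hx hy

/-- A subset of a C*-subalgebra `S` generates `S` if its image in the ambient algebra does. -/
theorem StarSubalgebra.generates_of_coe {A : Type*} [CStarAlgebra A] {S : StarSubalgebra ℂ A}
    [IsClosed (S : Set A)] {T : Set S}
    (h : S ≤ (StarAlgebra.adjoin ℂ (((↑) : S → A) '' T)).topologicalClosure) :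
    (StarAlgebra.adjoin ℂ T).topologicalClosure = ⊤ := by
  rw [eq_top_iff]
  intro a
  have h1 : (StarAlgebra.adjoin ℂ T).map S.subtype = StarAlgebra.adjoin ℂ (((↑) : S → A) '' T) :=
    StarAlgHom.map_adjoin S.subtype T
  have h2 := h a.2
  rw [← h1] at h2
  rw [← SetLike.mem_coe, StarSubalgebra.topologicalClosure_coe,
    Topology.IsInducing.subtypeVal.closure_eq_preimage_closure_image]
  exact h2

/-! ### Compact quantum groups from bi-unitary matrices -/

namespace MinTensor

variable {A B : Type u} [CStarAlgebra A] [CStarAlgebra B]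

theorem sum_tmul {ι : Type*} (s : Finset ι) (a : ι → A) (b : B) :
    tmul (∑ i ∈ s, a i) b = ∑ i ∈ s, tmul (a i) b := by
  simp only [tmul, TensorProduct.sum_tmul, map_sum]

theorem tmul_sum {ι : Type*} (s : Finset ι) (a : A) (b : ι → B) :
    tmul a (∑ i ∈ s, b i) = ∑ i ∈ s, tmul a (b i) := by
  simp only [tmul, TensorProduct.tmul_sum, map_sum]

theorem zero_tmul (b : B) : tmul (0 : A) b = 0 := by
  simp only [tmul, TensorProduct.zero_tmul, map_zero]

theorem tmul_zero (a : A) : tmul a (0 : B) = 0 := by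
  simp only [tmul, TensorProduct.tmul_zero, map_zero]

theorem one_tmul_one : tmul (1 : A) (1 : B) = 1 := map_one of

theorem dense_span_tmul :
    Dense (Submodule.span ℂ (Set.range fun p : A × B => tmul p.1 p.2) : Set (MinTensor A B)) := by
  refine denseRange_of.mono ?_
  rintro _ ⟨x, rfl⟩
  induction x with
  | zero => rw [map_zero]; exact zero_mem _
  | add x y hx hy => rw [map_add]; exact add_mem hx hy
  | tmul a b => exact Submodule.subset_span ⟨(a, b), rfl⟩

end MinTensor

/-- The cancellation conditions need checking only on generators. The span `M` of `D(A) i(A)`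
absorbs `D(A)` on the left and `i(A)` on the right, and `i` commutes with `j`, so the `a` with `j a
∈ M` are closed under products. The two density conditions of a compact quantum group arise by
exchanging the legs `i` and `j`. -/
theorem dense_span_mul_of_generates {A T : Type*} [CStarAlgebra A] [CStarAlgebra T]
    (D i j : A →⋆ₐ[ℂ] T) (hij : ∀ a b, Commute (i a) (j b))
    (hd : Dense (Submodule.span ℂ (Set.range fun p : A × A => i p.1 * j p.2) : Set T))
    {S : Set A} (hS : (StarAlgebra.adjoin ℂ S).topologicalClosure = ⊤)
    (h : ∀ a ∈ S, j a ∈ Submodule.span ℂ (Set.range fun p : A × A => D p.1 * i p.2) ∧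
      j (star a) ∈ Submodule.span ℂ (Set.range fun p : A × A => D p.1 * i p.2)) :
    Dense (Submodule.span ℂ (Set.range fun p : A × A => D p.1 * i p.2) : Set T) := by
  set M := Submodule.span ℂ (Set.range fun p : A × A => D p.1 * i p.2) with hM
  have hD : ∀ a, ∀ m ∈ M, D a * m ∈ M := fun a m hm => by
    induction hm using Submodule.span_induction with
    | mem x hx =>
      obtain ⟨p, rfl⟩ := hx
      exact Submodule.subset_span ⟨(a * p.1, p.2), by simp only [map_mul, mul_assoc]⟩
    | zero => rw [mul_zero]; exact zero_mem _
    | add x y _ _ hx hy => rw [mul_add]; exact add_mem hx hy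
    | smul z x _ hx => rw [mul_smul_comm]; exact M.smul_mem z hx
  have hi : ∀ a, ∀ m ∈ M, m * i a ∈ M := fun a m hm => by
    induction hm using Submodule.span_induction with
    | mem x hx =>
      obtain ⟨p, rfl⟩ := hx
      exact Submodule.subset_span ⟨(p.1, p.2 * a), by simp only [map_mul, mul_assoc]⟩
    | zero => rw [zero_mul]; exact zero_mem _
    | add x y _ _ hx hy => rw [add_mul]; exact add_mem hx hy
    | smul z x _ hx => rw [smul_mul_assoc]; exact M.smul_mem z hx
  have hj : ∀ a, j a ∈ M → ∀ m ∈ M, m * j a ∈ M := fun a ha m hm => by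
    induction hm using Submodule.span_induction with
    | mem x hx =>
      obtain ⟨p, rfl⟩ := hx
      change D p.1 * i p.2 * j a ∈ M
      rw [mul_assoc, (hij _ _).eq]
      -- Here `D p * i q * j a = D p * (j a * i q)`, and the bracket is in `M` because `j a` is.
      exact hD _ _ (hi _ _ ha)
    | zero => rw [zero_mul]; exact zero_mem _
    | add x y _ _ hx hy => rw [add_mul]; exact add_mem hx hy
    | smul z x _ hx => rw [smul_mul_assoc]; exact M.smul_mem z hx
  have h1 : (1 : T) ∈ M := Submodule.subset_span ⟨(1, 1), by simp⟩
  have h2 : ∀ a ∈ StarAlgebra.adjoin ℂ S, j a ∈ M := fun a ha => by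
    rw [← StarSubalgebra.mem_toSubalgebra, StarAlgebra.adjoin_toSubalgebra] at ha
    induction ha using Algebra.adjoin_induction with
    | mem x hx =>
      rcases hx with hx | hx
      · exact (h x hx).1
      · simpa using (h _ hx).2
    | algebraMap z =>
      rw [AlgHomClass.commutes, Algebra.algebraMap_eq_smul_one]
      exact M.smul_mem z h1
    | add x y _ _ hx hy => rw [map_add]; exact add_mem hx hy
    | mul x y _ _ hx hy => rw [map_mul]; exact hj _ hy _ hx
  have h3 : ∀ a, j a ∈ M.topologicalClosure := fun a => by
    have ha : a ∈ closure (StarAlgebra.adjoin ℂ S : Set A) := by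
      rw [← StarSubalgebra.topologicalClosure_coe, hS]; trivial
    exact map_mem_closure (starAlgHom_continuous j) ha h2
  have h4 : ∀ a, ∀ m ∈ M.topologicalClosure, m * i a ∈ M.topologicalClosure := fun a m hm =>
    map_mem_closure (f := fun m => m * i a) (by fun_prop) hm (hi a)
  have h5 : Submodule.span ℂ (Set.range fun p : A × A => i p.1 * j p.2) ≤
      M.topologicalClosure := by
    rw [Submodule.span_le]
    rintro _ ⟨p, rfl⟩
    change i p.1 * j p.2 ∈ _
    rw [(hij _ _).eq]
    exact h4 _ _ (h3 _)
  exact dense_closure.1 (hd.mono h5)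

open Classical in
/-- A matrix over a C*-algebra such that it and its entrywise adjoint are unitary. -/
structure IsBiunitary {A : Type u} [CStarAlgebra A] {X : Type v} [Fintype X] (u : Matrix X X A) :
    Prop where
  star_mul : ∀ x y, ∑ z, star (u z x) * u z y = if x = y then 1 else 0
  mul_star : ∀ x y, ∑ z, u x z * star (u y z) = if x = y then 1 else 0
  star_mul' : ∀ x y, ∑ z, star (u x z) * u y z = if x = y then 1 else 0
  mul_star' : ∀ x y, ∑ z, u z x * star (u z y) = if x = y then 1 else 0

namespace IsBiunitary

variable {A : Type u} [CStarAlgebra A] {X : Type v} [Fintype X] {u : Matrix X X A}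

open Classical in
theorem iff_mem_unitary :
    IsBiunitary u ↔ u ∈ unitary (Matrix X X A) ∧ u.map star ∈ unitary (Matrix X X A) := by
  simp only [Unitary.mem_iff, ← Matrix.ext_iff, Matrix.mul_apply, Matrix.star_apply,
    Matrix.map_apply, Matrix.one_apply, star_star]
  exact ⟨fun h => ⟨⟨h.star_mul, h.mul_star⟩, h.mul_star', h.star_mul'⟩,
    fun h => ⟨h.1.1, h.1.2, h.2.2, h.2.1⟩⟩

end IsBiunitary

theorem BiunitaryCorep.isBiunitary {A : Type u} [CStarAlgebra A] {Q : CQG A} {E : Type v}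
    [Fintype E] (β : BiunitaryCorep Q E) : IsBiunitary β.u :=
  IsBiunitary.iff_mem_unitary.2 ⟨β.unitary_u, β.unitary_conj⟩

/-- A compact matrix quantum group: the co-product is determined on the coefficients of a
bi-unitary matrix that generate the C*-algebra. -/
def CQG.ofMatrix {A : Type u} [CStarAlgebra A] {X : Type v} [Fintype X] (D : A →⋆ₐ[ℂ] MinTensor A A)
    (u : Matrix X X A) (hu : IsBiunitary u)
    (hS : (StarAlgebra.adjoin ℂ (Set.range fun p : X × X => u p.1 p.2)).topologicalClosure = ⊤)
    (hD : ∀ x y, D (u x y) = ∑ z, MinTensor.tmul (u x z) (u z y)) : CQG A where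
  comul := D
  coassoc := by
    suffices H : MinTensor₃.ofLeft.comp ((MinTensor.map D (StarAlgHom.id ℂ A)).comp D) =
        MinTensor₃.ofRight.comp ((MinTensor.map (StarAlgHom.id ℂ A) D).comp D) from
      DFunLike.congr_fun H
    refine starAlgHom_ext_of_generates hS ?_
    rintro _ ⟨⟨x, y⟩, rfl⟩
    simp only [StarAlgHom.comp_apply, hD, map_sum, MinTensor.map_tmul, StarAlgHom.coe_id, id,
      MinTensor.sum_tmul, MinTensor.tmul_sum, MinTensor₃.ofLeft_tmul, MinTensor₃.ofRight_tmul]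
    exact Finset.sum_comm
  dense_left := by
    classical
    refine dense_span_mul_of_generates D MinTensor.inl MinTensor.inr
      (fun a b => (MinTensor.inl_mul_inr a b).trans (MinTensor.inr_mul_inl a b).symm) ?_ hS ?_
    · simp only [MinTensor.inl_mul_inr]
      exact MinTensor.dense_span_tmul
    · rintro _ ⟨⟨x, y⟩, rfl⟩
      constructor
      -- Expanding `D` leaves `∑ z, u z w * star (u z x)` in the first leg, which is `δ` because the
      -- entrywise adjoint of `u` is unitary.
      · have : MinTensor.inr (u x y) = ∑ z, D (u z y) * MinTensor.inl (star (u z x)) := by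
          change MinTensor.tmul 1 (u x y) = ∑ z, D (u z y) * MinTensor.tmul (star (u z x)) 1
          simp only [hD, Finset.sum_mul, MinTensor.tmul_mul_tmul, mul_one]
          rw [Finset.sum_comm]
          simp only [← MinTensor.sum_tmul, hu.mul_star']
          rw [Finset.sum_eq_single x (fun z _ hz => by rw [if_neg hz, MinTensor.zero_tmul])
            (by simp), if_pos rfl]
        rw [this]
        exact sum_mem fun z _ => Submodule.subset_span ⟨(_, _), rfl⟩
      · have : MinTensor.inr (star (u x y)) = ∑ z, D (star (u z y)) * MinTensor.inl (u z x) := by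
          change MinTensor.tmul 1 (star (u x y)) = ∑ z, D (star (u z y)) * MinTensor.tmul (u z x) 1
          simp only [map_star, hD, star_sum, MinTensor.star_tmul, Finset.sum_mul,
            MinTensor.tmul_mul_tmul, mul_one]
          rw [Finset.sum_comm]
          simp only [← MinTensor.sum_tmul, hu.star_mul]
          rw [Finset.sum_eq_single x (fun z _ hz => by rw [if_neg hz, MinTensor.zero_tmul])
            (by simp), if_pos rfl]
        rw [this]
        exact sum_mem fun z _ => Submodule.subset_span ⟨(_, _), rfl⟩
  dense_right := by
    classical
    refine dense_span_mul_of_generates D MinTensor.inr MinTensor.inl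
      (fun a b => (MinTensor.inr_mul_inl b a).trans (MinTensor.inl_mul_inr b a).symm) ?_ hS ?_
    · simp only [MinTensor.inr_mul_inl]
      refine MinTensor.dense_span_tmul.mono (Submodule.span_mono ?_)
      rintro _ ⟨p, rfl⟩
      exact ⟨p.swap, rfl⟩
    · rintro _ ⟨⟨y, x⟩, rfl⟩
      constructor
      -- The same with the legs exchanged; the second leg now contains `u * star u`, so unitarity of
      -- `u` itself is used.
      · have : MinTensor.inl (u y x) = ∑ z, D (u y z) * MinTensor.inr (star (u x z)) := by
          change MinTensor.tmul (u y x) 1 = ∑ z, D (u y z) * MinTensor.tmul 1 (star (u x z))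
          simp only [hD, Finset.sum_mul, MinTensor.tmul_mul_tmul, mul_one]
          rw [Finset.sum_comm]
          simp only [← MinTensor.tmul_sum, hu.mul_star]
          rw [Finset.sum_eq_single x (fun z _ hz => by rw [if_neg hz, MinTensor.tmul_zero])
            (by simp), if_pos rfl]
        rw [this]
        exact sum_mem fun z _ => Submodule.subset_span ⟨(_, _), rfl⟩
      · have : MinTensor.inl (star (u y x)) = ∑ z, D (star (u y z)) * MinTensor.inr (u x z) := by
          change MinTensor.tmul (star (u y x)) 1 = ∑ z, D (star (u y z)) * MinTensor.tmul 1 (u x z)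
          simp only [map_star, hD, star_sum, MinTensor.star_tmul, Finset.sum_mul,
            MinTensor.tmul_mul_tmul, mul_one]
          rw [Finset.sum_comm]
          simp only [← MinTensor.tmul_sum, hu.star_mul']
          rw [Finset.sum_eq_single x (fun z _ hz => by rw [if_neg hz, MinTensor.tmul_zero])
            (by simp), if_pos rfl]
        rw [this]
        exact sum_mem fun z _ => Submodule.subset_span ⟨(_, _), rfl⟩

open Classical in
/-- A matrix of projections whose rows and columns add up to `1`, and that is multiplicative for
the co-product, is the matrix of a co-action on a finite set. -/
noncomputable def FiniteCoaction.ofMatrix {A : Type u} [CStarAlgebra A] {Q : CQG A} {X : Type v}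
    [Fintype X] (m : X → X → A) (hs : ∀ x y, star (m x y) = m x y)
    (hm : ∀ x y, m x y * m x y = m x y) (hrow : ∀ x, ∑ y, m x y = 1)
    (hcol : ∀ y, ∑ x, m x y = 1)
    (hc : ∀ x y, Q.comul (m x y) = ∑ z, MinTensor.tmul (m x z) (m z y)) : FiniteCoaction Q X :=
  have h0 : ∀ x y y', m x y * m x y' = if y = y' then m x y else 0 := fun x y y' => by
    split_ifs with h
    · rw [← h, hm]
    · exact CStarAlgebra.mul_eq_zero_of_sum_eq_one (hs x) (hm x) (hrow x) h
  have h0' : ∀ y x x', m x y * m x' y = if x = x' then m x y else 0 := fun y x x' => by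
    split_ifs with h
    · rw [← h, hm]
    · exact CStarAlgebra.mul_eq_zero_of_sum_eq_one (x := fun x => m x y) (fun x => hs x y)
        (fun x => hm x y) (hcol y) h
  { toHom :=
    { toFun := fun f x => ∑ y, f y • m x y
      map_one' := by ext x; simpa using hrow x
      map_mul' := fun f g => by
        ext x
        simp only [Pi.mul_apply, Finset.sum_mul, Finset.mul_sum, smul_mul_smul_comm, h0]
        simp
      map_zero' := by ext x; simp
      map_add' := fun f g => by
        ext x
        simp only [Pi.add_apply, add_smul, Finset.sum_add_distrib]
      commutes' := fun z => by
        ext x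
        simp only [Pi.algebraMap_apply, Algebra.algebraMap_self, RingHom.id_apply,
          ← Finset.smul_sum, hrow, Algebra.algebraMap_eq_smul_one]
      map_star' := fun f => by
        ext x
        simp only [Pi.star_apply, star_sum, star_smul, hs] }
    comul := fun x y => by
      change Q.comul (∑ z, (Pi.single x 1 : X → ℂ) z • m y z) = ∑ z, MinTensor.tmul
        (∑ w, (Pi.single z 1 : X → ℂ) w • m y w) (∑ w, (Pi.single x 1 : X → ℂ) w • m z w)
      simp only [Pi.single_apply, ite_smul, one_smul, zero_smul, Finset.sum_ite_eq',
        Finset.mem_univ, if_true, hc]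
    dense := by
      refine dense_univ.mono fun F _ => ?_
      -- The span is everything: in `∑ m x y * m z y * F z` column orthogonality forces `z = x`, and
      -- the row sum `∑ y, m x y = 1` leaves `F x`.
      have hF : F = ∑ p : X × X, fun x => (∑ z, (Pi.single p.1 1 : X → ℂ) z • m x z) *
          (m p.2 p.1 * F p.2) := by
        ext x
        simp only [Pi.single_apply, ite_smul, one_smul, zero_smul, Finset.sum_ite_eq',
          Finset.mem_univ, if_true, Finset.sum_apply, ← mul_assoc, h0']
        rw [Fintype.sum_prod_type_right]
        simp only [← Finset.sum_mul]
        rw [Finset.sum_eq_single x (fun y _ hy => by simp [hy.symm]) (by simp)]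
        simp [hrow]
      rw [hF]
      exact sum_mem fun p _ => Submodule.subset_span ⟨(Pi.single p.1 1, m p.2 p.1 * F p.2), rfl⟩ }

theorem FiniteCoaction.ofMatrix_apply {A : Type u} [CStarAlgebra A] {Q : CQG A} {X : Type v}
    [Fintype X] (m : X → X → A) (hs hm hrow hcol) (hc : ∀ x y, Q.comul (m x y) =
      ∑ z, MinTensor.tmul (m x z) (m z y)) (f : X → ℂ) (x : X) :
    (FiniteCoaction.ofMatrix m hs hm hrow hcol hc).toHom f x = ∑ y, f y • m x y := rfl

/-! ### Tensor products, bi-unitarity and retracts of magic matrices. -/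

namespace Multigraph

variable {V : Type u} {E : Type v} [Fintype V] {G : Multigraph V E}

namespace EdgeLabeling

namespace Magic

variable {L : G.EdgeLabeling} {B : Type w} [CStarAlgebra B]
  {b : V × Fin G.maxMult → V × Fin G.maxMult → B}

theorem codRestrict (h : L.Magic b) (S : StarSubalgebra ℂ B) [IsClosed (S : Set B)]
    (hb : ∀ x y, b x y ∈ S) : L.Magic fun x y => (⟨b x y, hb x y⟩ : S) where
  star_eq x y := Subtype.ext (h.star_eq x y)
  idem x y := Subtype.ext (h.idem x y)
  row x := Subtype.ext (by simpa using h.row x)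
  col y := Subtype.ext (by simpa using h.col y)
  vertex k i s s' := Subtype.ext (by simpa using h.vertex k i s s')
  edge e x y hxy := Subtype.ext (h.edge e x y hxy)

/-- This is what allows the co-product of `Q` to be defined by the universal property. -/
theorem tensor [Fintype E] {A B : Type w} [CStarAlgebra A] [CStarAlgebra B]
    {a : V × Fin G.maxMult → V × Fin G.maxMult → A}
    {b : V × Fin G.maxMult → V × Fin G.maxMult → B} (ha : L.Magic a) (hb : L.Magic b) :
    L.Magic fun x y => ∑ z, MinTensor.tmul (a x z) (b z y) where
  star_eq x y := by simp only [star_sum, MinTensor.star_tmul, ha.star_eq, hb.star_eq]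
  idem x y := by
    simp only [Finset.sum_mul, Finset.mul_sum, MinTensor.tmul_mul_tmul]
    refine Finset.sum_congr rfl fun z _ => ?_
    rw [Finset.sum_eq_single z, ha.idem, hb.idem]
    · intro z' _ hz
      rw [ha.row_orth x hz, MinTensor.zero_tmul]
    · simp
  row x := by
    rw [Finset.sum_comm]
    simp only [← MinTensor.tmul_sum, hb.row, ← MinTensor.sum_tmul, ha.row, MinTensor.one_tmul_one]
  col y := by
    rw [Finset.sum_comm]
    simp only [← MinTensor.sum_tmul, ha.col, ← MinTensor.tmul_sum, hb.col, MinTensor.one_tmul_one]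
  vertex k i s s' := by
    have h1 : ∀ s, ∑ r, ∑ z, MinTensor.tmul (a (k, s) z) (b z (i, r)) =
        ∑ j, MinTensor.tmul (L.vtx a k j) (L.vtx b j i) := fun s => by
      rw [Finset.sum_comm, Fintype.sum_prod_type]
      simp only [← MinTensor.tmul_sum, hb.sum_right, ← MinTensor.sum_tmul, ha.sum_right]
    rw [h1, h1]
  edge e x y hxy := by
    simp only [Finset.sum_mul, Finset.mul_sum, MinTensor.tmul_mul_tmul]
    refine Finset.sum_eq_zero fun z' _ => Finset.sum_eq_zero fun z _ => ?_
    -- If the intermediate pair is an edge, the first leg vanishes; otherwise the second leg does.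
    by_cases hz : L.EdgePair z z'
    · obtain ⟨e', rfl, rfl⟩ := hz
      rw [ha.edge e' x y hxy, MinTensor.zero_tmul]
    · rw [hb.edge e z z' hz, MinTensor.tmul_zero]

theorem isBiunitary (h : L.Magic b) : IsBiunitary (Matrix.of b) := by
  classical
  have h1 : ∀ {b : V × Fin G.maxMult → V × Fin G.maxMult → B}, L.Magic b → ∀ x y,
      ∑ z, b z x * b z y = if x = y then 1 else 0 := fun {b} h x y => by
    split_ifs with hxy
    · simp only [← hxy, h.idem, h.col]
    · exact Finset.sum_eq_zero fun z _ => h.row_orth z hxy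
  have h2 : ∀ x y, ∑ z, b x z * b y z = if x = y then 1 else 0 := fun x y => by
    split_ifs with hxy
    · simp only [← hxy, h.idem, h.row]
    · exact Finset.sum_eq_zero fun z _ => h.col_orth z hxy
  constructor <;> intro x y <;> simp only [Matrix.of_apply, h.star_eq, h1 h, h2] <;> congr

/-- The matrix over the edges that is induced by `b` is bi-unitary. -/
theorem isBiunitary_edge [Fintype E] (h : L.Magic b) :
    IsBiunitary (Matrix.of fun σ τ => b (L.s σ) (L.s τ) * b (L.t σ) (L.t τ)) := by
  classical
  constructor
  · intro τ τ'; simp only [Matrix.of_apply, h.sum_star_mul]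
  -- The conditions that sum over the second index are those for the first index, read in the
  -- transposed matrix.
  · intro τ τ'
    simp only [Matrix.of_apply]
    convert h.transpose.sum_mul_star τ τ' using 1
  · intro τ τ'
    simp only [Matrix.of_apply]
    convert h.transpose.sum_star_mul τ τ' using 1
  · intro τ τ'; simp only [Matrix.of_apply, h.sum_mul_star]

-- In a row that is permissible at `k`, the entries with a label not permissible at `i` vanish, so
-- restricting to the permissible block leaves each row sum `vtx k i` unchanged.
open Classical in
theorem card_permissible_nsmul_vtx [Fintype E] (h : L.Magic b) (k i : V) :
    (Finset.univ.filter (L.Permissible k)).card • L.vtx b k i =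
      ∑ s ∈ Finset.univ.filter (L.Permissible k), ∑ r ∈ Finset.univ.filter (L.Permissible i),
        b (k, s) (i, r) := by
  rw [← Finset.sum_const]
  refine Finset.sum_congr rfl fun s hs => ?_
  rw [← h.sum_right k i s]
  refine (Finset.sum_subset (Finset.subset_univ _) fun r _ hr => ?_).symm
  refine h.eq_zero_of_permissible' ?_ ?_ <;> simp_all

theorem vtx_transpose (h : L.Magic b) (k i : V) :
    L.vtx (fun x y => b y x) k i = L.vtx b i k := h.sum_left _ _ _

end Magic

/-- The labels of parallel edges fill an initial segment, hence so do the permissible labels of a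
vertex. -/
theorem Permissible.of_le {L : G.EdgeLabeling} {k : V} {r r' : Fin G.maxMult}
    (h : L.Permissible k r) (hr : r' ≤ r) : L.Permissible k r' := by
  obtain ⟨e, he, rfl⟩ := h
  obtain ⟨e', h1, h2, h3⟩ := L.exists_edge ((Fin.le_def.1 hr).trans_lt (L.lab_lt e))
  refine ⟨e', ?_, Fin.ext h3⟩
  rwa [h1, h2]

namespace Magic

variable {L : G.EdgeLabeling} {B : Type w} [CStarAlgebra B]
  {b : V × Fin G.maxMult → V × Fin G.maxMult → B}

/-- Summing the permissible block by rows and by columns gives `vtx k i` with two multiplicities,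
the numbers of permissible labels at `k` and at `i`. If `vtx k i ≠ 0` these agree, and initial
segments of equal size coincide. -/
theorem vtx_eq_zero_of_permissible [Fintype E] (h : L.Magic b) {k i : V} {r : Fin G.maxMult}
    (hr : ¬(L.Permissible k r ↔ L.Permissible i r)) : L.vtx b k i = 0 := by
  classical
  by_contra hne
  refine hr ?_
  have h1 : (Finset.univ.filter (L.Permissible k)).card =
      (Finset.univ.filter (L.Permissible i)).card := by
    have h2 := h.card_permissible_nsmul_vtx k i
    have h3 := h.transpose.card_permissible_nsmul_vtx i k
    rw [Finset.sum_comm, ← h2, h.vtx_transpose, ← Nat.cast_smul_eq_nsmul ℂ,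
      ← Nat.cast_smul_eq_nsmul ℂ] at h3
    exact_mod_cast (smul_left_injective ℂ hne h3).symm
  have h4 : Finset.univ.filter (L.Permissible k) = Finset.univ.filter (L.Permissible i) := by
    by_cases hsub : Finset.univ.filter (L.Permissible k) ⊆ Finset.univ.filter (L.Permissible i)
    · exact Finset.eq_of_subset_of_card_le hsub h1.ge
    · obtain ⟨s, hs, hs'⟩ := Finset.not_subset.1 hsub
      simp only [Finset.mem_filter_univ] at hs hs'
      refine (Finset.eq_of_subset_of_card_le (fun s' h' => ?_) h1.le).symm
      simp only [Finset.mem_filter_univ] at h' ⊢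
      exact hs.of_le (not_lt.1 fun hlt => hs' (h'.of_le hlt.le))
  simpa using Finset.ext_iff.1 h4 r

end Magic

open Classical in
/-- The entries with a permissible index are kept; the others are replaced by multiples of the
entries of the induced matrix over the vertices. -/
noncomputable def retract (L : G.EdgeLabeling) {B : Type w} [CStarAlgebra B]
    (b : V × Fin G.maxMult → V × Fin G.maxMult → B) (x y : V × Fin G.maxMult) : B :=
  if L.Permissible x.1 x.2 ∨ L.Permissible y.1 y.2 then b x y
  else if x.2 = y.2 then L.vtx b x.1 y.1 else 0

namespace Magic

variable {L : G.EdgeLabeling} {B : Type w} [CStarAlgebra B]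
  {b : V × Fin G.maxMult → V × Fin G.maxMult → B}

theorem retract_transpose (h : L.Magic b) (x y : V × Fin G.maxMult) :
    L.retract (fun x y => b y x) x y = L.retract b y x := by
  classical
  unfold retract
  rw [h.vtx_transpose]
  exact if_congr or_comm rfl (if_congr eq_comm rfl rfl)

/-- A permissible row is unchanged. In another row only the entry with label `s` can survive. If `s`
is permissible at `i`, even that entry is zero, but then `vtx k i = 0` as well. -/
theorem sum_retract [Fintype E] (h : L.Magic b) (k i s) :
    ∑ r, L.retract b (k, s) (i, r) = L.vtx b k i := by
  classical
  by_cases hs : L.Permissible k s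
  · simp only [retract, hs, true_or, if_true, h.sum_right]
  · have h1 : ∀ r, L.retract b (k, s) (i, r) = if s = r then L.vtx b k i else 0 := fun r => by
      by_cases hr : L.Permissible i r
      · simp only [retract, hs, hr, or_true, if_true]
        rw [h.eq_zero_of_permissible hr hs]
        split_ifs with hsr
        · subst hsr
          exact (h.vtx_eq_zero_of_permissible fun h' => hs (h'.2 hr)).symm
        · rfl
      · simp only [retract, hs, hr, or_self, if_false]
    simp only [h1]
    simp

theorem retract_eq {x y : V × Fin G.maxMult} (hy : L.Permissible y.1 y.2) :
    L.retract b x y = b x y := if_pos (Or.inr hy)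

theorem magic_retract [Fintype E] (h : L.Magic b) : L.Magic (L.retract b) where
  star_eq x y := by
    unfold retract
    split_ifs
    · exact h.star_eq x y
    · exact h.star_vtx _ _
    · exact star_zero B
  idem x y := by
    unfold retract
    split_ifs
    · exact h.idem x y
    · exact h.vtx_idem _ _
    · exact mul_zero 0
  row x := by
    rw [Fintype.sum_prod_type]
    exact (Finset.sum_congr rfl fun i _ => h.sum_retract x.1 i x.2).trans (h.sum_vtx_right x.1)
  col y := by
    rw [Fintype.sum_prod_type]
    refine (Finset.sum_congr rfl fun i _ => ?_).trans (h.transpose.sum_vtx_right y.1)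
    simp only [← h.retract_transpose]
    exact h.transpose.sum_retract y.1 i y.2
  vertex k i s s' := by rw [h.sum_retract, h.sum_retract]
  edge e x y hxy := by
    -- The edge relation involves only columns at the ends of an edge; these are permissible and
    -- therefore unchanged.
    rw [retract_eq ⟨e, Or.inl rfl, rfl⟩, retract_eq ⟨e, Or.inr rfl, rfl⟩, h.edge e x y hxy]

end Magic

/-! ### The algebras `Q` and `Q'` -/

variable (L : G.EdgeLabeling)

/-- The generating matrix of `Q`. -/
noncomputable def gens (x y : V × Fin G.maxMult) : L.Q := L.q x.1 x.2 y.1 y.2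

theorem of_free (k s i r) : UnivProj.of {x | L.Rel x} (L.free k s i r) = L.gens (k, s) (i, r) :=
  rfl

theorem magic_gens : L.Magic L.gens where
  star_eq x y := UnivProj.star_gen _ _
  idem x y := UnivProj.gen_mul_gen _ _
  row x := by
    have := UnivProj.of_rel {x | L.Rel x} (Rel.row x.1 x.2)
    rw [Fintype.sum_prod_type]
    simpa only [map_sub, map_sum, map_one, of_free, sub_eq_zero] using this
  col y := by
    have := UnivProj.of_rel {x | L.Rel x} (Rel.col y.1 y.2)
    rw [Fintype.sum_prod_type]
    simpa only [map_sub, map_sum, map_one, of_free, sub_eq_zero] using this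
  vertex k i s s' := by
    have := UnivProj.of_rel {x | L.Rel x} (Rel.vertex k i s s')
    simpa only [map_sub, map_sum, of_free, sub_eq_zero] using this
  edge e x y hxy := by
    obtain ⟨k, s⟩ := x
    obtain ⟨l, s'⟩ := y
    have key : L.Rel (L.free k s (G.src e) (L.lab e) * L.free l s' (G.tgt e) (L.lab e)) := by
      by_cases h : G.mult k l = 0
      · exact Rel.noEdge e k l s s' h
      by_cases hs : s = s'
      · subst hs
        exact Rel.excess e k l s h (not_lt.1 fun h' => hxy (L.edgePair_of_lt h'))
      · exact Rel.offDiag e k l s s' h hs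
    exact (map_mul _ _ _).symm.trans (UnivProj.of_rel {x | L.Rel x} key)

theorem generates : (StarAlgebra.adjoin ℂ
    (Set.range fun p : (V × Fin G.maxMult) × (V × Fin G.maxMult) =>
      L.gens p.1 p.2)).topologicalClosure = ⊤ :=
  UnivProj.generates _

variable {L} in
/-- The universal property of `Q`. -/
noncomputable def Magic.hom {B : Type w} [CStarAlgebra B]
    {b : V × Fin G.maxMult → V × Fin G.maxMult → B} (h : L.Magic b) : L.Q →⋆ₐ[ℂ] B :=
  UnivProj.lift (fun p => b p.1 p.2) (fun p => h.star_eq _ _) (fun p => h.idem _ _) <| by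
    have h0 : ∀ k s i r, FreeStar.lift (fun p : L.Index => b p.1 p.2) (fun p => h.star_eq _ _)
        (L.free k s i r) = b (k, s) (i, r) := fun k s i r => FreeStar.lift_gen _ _ _
    have h1 : ∀ e k l (s s' : Fin G.maxMult), G.mult k l = 0 ∨ s ≠ s' ∨ G.mult k l ≤ (s : ℕ) →
        b (k, s) (L.s e) * b (l, s') (L.t e) = 0 := fun e k l s s' hs => by
      refine h.edge e _ _ ?_
      rintro ⟨e', h1, h2⟩
      simp only [EdgeLabeling.s, EdgeLabeling.t, Prod.mk.injEq] at h1 h2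
      obtain ⟨rfl, rfl⟩ := h1
      obtain ⟨rfl, rfl⟩ := h2
      have := L.lab_lt e'
      rcases hs with hs | hs | hs
      · omega
      · exact hs rfl
      · omega
    rintro r (⟨k, s⟩ | ⟨i, r⟩ | ⟨k, i, s, s'⟩ | ⟨e, k, l, s, s', hm⟩ | ⟨e, k, l, s, s', hm, hs⟩ |
      ⟨e, k, l, s, hm, hs⟩)
    · rw [map_sub, map_sum, map_one, sub_eq_zero, ← h.row (k, s), Fintype.sum_prod_type]
      simp only [map_sum, h0]
    · rw [map_sub, map_sum, map_one, sub_eq_zero, ← h.col (i, r), Fintype.sum_prod_type]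
      simp only [map_sum, h0]
    · rw [map_sub, map_sum, map_sum, sub_eq_zero]
      simpa only [h0] using h.vertex k i s s'
    · rw [map_mul, h0, h0]
      exact h1 e k l s s' (Or.inl hm)
    · rw [map_mul, h0, h0]
      exact h1 e k l s s' (Or.inr (Or.inl hs))
    · rw [map_mul, h0, h0]
      exact h1 e k l s s (Or.inr (Or.inr hs))

variable {L} in
theorem Magic.hom_gens {B : Type w} [CStarAlgebra B]
    {b : V × Fin G.maxMult → V × Fin G.maxMult → B} (h : L.Magic b) (x y) :
    h.hom (L.gens x y) = b x y := UnivProj.lift_gen _ _ _ _ _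

/-- The coefficients of the co-representation on the edges. -/
noncomputable def edgeGens (σ τ : E) : L.Q := L.gens (L.s σ) (L.s τ) * L.gens (L.t σ) (L.t τ)

theorem gens_mem {x y : V × Fin G.maxMult} (hx : L.Permissible x.1 x.2)
    (hy : L.Permissible y.1 y.2) : L.gens x y ∈ L.Q' :=
  StarSubalgebra.le_topologicalClosure _
    (StarAlgebra.subset_adjoin _ _ ⟨x.1, x.2, y.1, y.2, hx, hy, rfl⟩)

theorem edgeGens_mem (σ τ : E) : L.edgeGens σ τ ∈ L.Q' :=
  mul_mem (L.gens_mem ⟨σ, Or.inl rfl, rfl⟩ ⟨τ, Or.inl rfl, rfl⟩)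
    (L.gens_mem ⟨σ, Or.inr rfl, rfl⟩ ⟨τ, Or.inr rfl, rfl⟩)

/-- A generator with its column at one end of `e` equals itself times the column sum `1` at the
other end, and each resulting product is an edge coefficient or zero. -/
theorem Q'_eq : L.Q' = (StarAlgebra.adjoin ℂ
    (Set.range fun p : E × E => L.edgeGens p.1 p.2)).topologicalClosure := by
  refine le_antisymm (StarSubalgebra.topologicalClosure_mono (StarAlgebra.adjoin_le ?_))
    (StarSubalgebra.topologicalClosure_minimal (StarAlgebra.adjoin_le ?_)
      (StarSubalgebra.isClosed_topologicalClosure _))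
  · have h0 : ∀ x y e, L.gens x (L.s e) * L.gens y (L.t e) ∈ StarAlgebra.adjoin ℂ
        (Set.range fun p : E × E => L.edgeGens p.1 p.2) := fun x y e => by
      by_cases h : L.EdgePair x y
      · obtain ⟨σ, rfl, rfl⟩ := h
        exact StarAlgebra.subset_adjoin _ _ ⟨(σ, e), rfl⟩
      · rw [L.magic_gens.edge e x y h]
        exact zero_mem _
    rintro _ ⟨k, s, i, r, -, ⟨e, he, rfl⟩, rfl⟩
    obtain rfl | rfl := he
    · change L.gens (k, s) (L.s e) ∈ StarAlgebra.adjoin ℂ _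
      rw [← mul_one (L.gens (k, s) (L.s e)), ← L.magic_gens.col (L.t e), Finset.mul_sum]
      exact sum_mem fun y _ => h0 _ _ _
    · change L.gens (k, s) (L.t e) ∈ StarAlgebra.adjoin ℂ _
      rw [← one_mul (L.gens (k, s) (L.t e)), ← L.magic_gens.col (L.s e), Finset.sum_mul]
      exact sum_mem fun y _ => h0 _ _ _
  · rintro _ ⟨p, rfl⟩
    exact L.edgeGens_mem p.1 p.2

/-- The coefficients of the co-representation on the edges, as a matrix over `Q'`. -/
noncomputable def edgeMatrix : Matrix E E L.Q' :=
  Matrix.of fun σ τ => ⟨L.edgeGens σ τ, L.edgeGens_mem σ τ⟩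

theorem edgeMatrix_generates : (StarAlgebra.adjoin ℂ
    (Set.range fun p : E × E => L.edgeMatrix p.1 p.2)).topologicalClosure = ⊤ := by
  refine StarSubalgebra.generates_of_coe ?_
  rw [← Set.range_comp]
  exact L.Q'_eq.le

variable [Fintype E]

/-- The co-product of `Q`. -/
noncomputable def comul : L.Q →⋆ₐ[ℂ] MinTensor L.Q L.Q := (L.magic_gens.tensor L.magic_gens).hom

theorem comul_gens (x y) : L.comul (L.gens x y) = ∑ z, MinTensor.tmul (L.gens x z) (L.gens z y) :=
  Magic.hom_gens _ x y

/-- The compact quantum group `Q`. -/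
noncomputable def cqg : CQG L.Q :=
  CQG.ofMatrix L.comul (Matrix.of L.gens) L.magic_gens.isBiunitary L.generates L.comul_gens

/-- The row label in `vtx` was chosen permissible, so the terms with a column outside the
permissible range vanish. -/
theorem vtx_mem (k i : V) : L.vtx L.gens k i ∈ L.Q' := by
  refine sum_mem fun r _ => ?_
  by_cases hr : L.Permissible i r
  · exact L.gens_mem (L.permissible_label k) hr
  · rw [L.magic_gens.eq_zero_of_permissible' (L.permissible_label k) hr]
    exact zero_mem _

theorem retract_mem (x y) : L.retract L.gens x y ∈ L.Q' := by
  classical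
  unfold retract
  split_ifs with h
  · by_cases hx : L.Permissible x.1 x.2 <;> by_cases hy : L.Permissible y.1 y.2
    · exact L.gens_mem hx hy
    · rw [L.magic_gens.eq_zero_of_permissible' hx hy]; exact zero_mem _
    · rw [L.magic_gens.eq_zero_of_permissible hy hx]; exact zero_mem _
    · exact (h.elim hx hy).elim
  · exact L.vtx_mem _ _
  · exact zero_mem _

/-- A retraction of `Q` onto `Q'`. -/
noncomputable def toQ' : L.Q →⋆ₐ[ℂ] L.Q' :=
  (L.magic_gens.magic_retract.codRestrict L.Q' L.retract_mem).hom

theorem toQ'_gens (x y) (hy : L.Permissible y.1 y.2) : (L.toQ' (L.gens x y) : L.Q) = L.gens x y :=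
  (congrArg Subtype.val (Magic.hom_gens _ x y)).trans (Magic.retract_eq hy)

theorem toQ'_edgeGens (σ τ) : L.toQ' (L.edgeGens σ τ) = L.edgeMatrix σ τ := by
  refine Subtype.ext ?_
  rw [edgeGens, map_mul, MulMemClass.coe_mul, L.toQ'_gens _ _ ⟨τ, Or.inl rfl, rfl⟩,
    L.toQ'_gens _ _ ⟨τ, Or.inr rfl, rfl⟩]
  rfl

theorem isBiunitary_edgeMatrix : IsBiunitary L.edgeMatrix := by
  classical
  have h := L.magic_gens.isBiunitary_edge
  have h0 : ∀ (σ τ : E) [Decidable (σ = τ)], (((if σ = τ then 1 else 0 : L.Q') : L.Q)) =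
      if σ = τ then 1 else 0 := fun σ τ _ => by split_ifs <;> rfl
  constructor <;> intro σ τ <;> refine Subtype.ext ?_ <;> rw [h0, AddSubmonoidClass.coe_finsetSum]
  · exact h.star_mul σ τ
  · exact h.mul_star σ τ
  · exact h.star_mul' σ τ
  · exact h.mul_star' σ τ

/-- The product of the two co-products is a sum over all pairs of labelled vertices; the edge
relation in the second leg reduces it to edges. -/
theorem comul_edgeGens (σ τ) : L.comul (L.edgeGens σ τ) =
    ∑ ρ, MinTensor.tmul (L.edgeGens σ ρ) (L.edgeGens ρ τ) := by
  simp only [edgeGens, map_mul, comul_gens, Finset.sum_mul, Finset.mul_sum,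
    MinTensor.tmul_mul_tmul]
  rw [L.sum_edge (fun x y => MinTensor.tmul (L.gens (L.s σ) x * L.gens (L.t σ) y)
    (L.gens x (L.s τ) * L.gens y (L.t τ))) fun x y hxy => by
      rw [L.magic_gens.edge τ x y hxy, MinTensor.tmul_zero]]
  exact Finset.sum_comm

/-- The co-product of `Q'`. -/
noncomputable def comul' : L.Q' →⋆ₐ[ℂ] MinTensor L.Q' L.Q' :=
  (MinTensor.map L.toQ' L.toQ').comp (L.comul.comp L.Q'.subtype)

theorem comul'_edgeMatrix (σ τ) : L.comul' (L.edgeMatrix σ τ) =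
    ∑ ρ, MinTensor.tmul (L.edgeMatrix σ ρ) (L.edgeMatrix ρ τ) := by
  change MinTensor.map L.toQ' L.toQ' (L.comul (L.edgeGens σ τ)) = _
  simp only [comul_edgeGens, map_sum, MinTensor.map_tmul, toQ'_edgeGens]

/-- The compact quantum group `Q'`. -/
noncomputable def cqg' : CQG L.Q' :=
  CQG.ofMatrix L.comul' L.edgeMatrix L.isBiunitary_edgeMatrix L.edgeMatrix_generates
    L.comul'_edgeMatrix

/-- The two homomorphisms agree on the edge coefficients, which generate `Q'` and are fixed by the
retraction. -/
theorem isWoronowiczSub : L.cqg.IsWoronowiczSub L.Q' L.cqg' := by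
  suffices H : (MinTensor.map L.Q'.subtype L.Q'.subtype).comp L.comul' =
      L.comul.comp L.Q'.subtype from DFunLike.congr_fun H
  refine starAlgHom_ext_of_generates L.edgeMatrix_generates ?_
  rintro _ ⟨⟨σ, τ⟩, rfl⟩
  change MinTensor.map L.Q'.subtype L.Q'.subtype (L.comul' (L.edgeMatrix σ τ)) =
    L.comul (L.edgeGens σ τ)
  simp only [comul'_edgeMatrix, comul_edgeGens, map_sum, MinTensor.map_tmul]
  rfl

/-- The co-representation of `Q'` on the edges. -/
noncomputable def edgeCorep : BiunitaryCorep L.cqg' E where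
  u := L.edgeMatrix
  unitary_u := (IsBiunitary.iff_mem_unitary.1 L.isBiunitary_edgeMatrix).1
  unitary_conj := (IsBiunitary.iff_mem_unitary.1 L.isBiunitary_edgeMatrix).2
  comul := L.comul'_edgeMatrix

end EdgeLabeling

end Multigraph

/-! ### Matrices of co-actions, and criteria for stochastic and projection-valued matrices. -/

namespace FiniteCoaction

variable {A : Type w} [CStarAlgebra A] {Q : CQG A} {X : Type v} [Fintype X]
  (α : FiniteCoaction Q X)

open Classical in
/-- The matrix of a co-action on a finite set. -/
noncomputable def mat (x y : X) : A := α.toHom (Pi.single y 1) x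

theorem toHom_apply (f : X → ℂ) (x : X) : α.toHom f x = ∑ y, f y • α.mat x y := by
  classical
  have h : f = ∑ y, f y • (Pi.single y 1 : X → ℂ) := by
    ext z; simp [Finset.sum_apply, Pi.single_apply]
  conv_lhs => rw [h]
  simp only [map_sum, map_smul, Finset.sum_apply, Pi.smul_apply, mat]

theorem star_mat (x y : X) : star (α.mat x y) = α.mat x y := by
  classical
  rw [mat, ← Pi.star_apply, ← map_star]
  have h : star (Pi.single y 1 : X → ℂ) = Pi.single y 1 := by
    ext z
    simp [Pi.single_apply, apply_ite]
  rw [h]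

theorem mat_idem (x y : X) : α.mat x y * α.mat x y = α.mat x y := by
  classical
  rw [mat, ← Pi.mul_apply, ← map_mul, ← Pi.single_mul, one_mul]

theorem sum_mat (x : X) : ∑ y, α.mat x y = 1 := by
  have := α.toHom_apply 1 x
  simpa using this.symm

end FiniteCoaction

theorem BiunitaryCorep.toMap_single {A : Type w} [CStarAlgebra A] {Q : CQG A} {E : Type v}
    [Fintype E] [DecidableEq E] (β : BiunitaryCorep Q E) (τ : E) (z : ℂ) (σ : E) :
    β.toMap (Pi.single τ z) σ = z • β.u σ τ := by
  simp [toMap, Pi.single_apply]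

/-- A row-stochastic matrix of projections that has a positive invariant weight is
column-stochastic. -/
theorem CStarAlgebra.sum_eq_one_of_invariant_weight {A : Type*} [CStarAlgebra A] {V : Type*}
    [Fintype V] {a : V → V → A} (hs : ∀ k i, star (a k i) = a k i)
    (ha : ∀ k i, a k i * a k i = a k i) (hrow : ∀ k, ∑ i, a k i = 1) {w : V → ℤ}
    (hw : ∀ k, 0 < w k) (h : ∀ i, ∑ k, w k • a k i = w i • 1) (i : V) : ∑ k, a k i = 1 := by
  classical
  -- Compress the invariance equation for column `i` by `a k i`. The term `k' = k` contributes `w k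
  -- • a k i`, the other terms are positive, and the total is only `w i • a k i`.
  have h1 : ∀ k i, w i < w k → a k i = 0 := fun k i hki => by
    have h2 : ∑ k', (w k' - if k' = k then w i else 0) •
        (star (a k' i * a k i) * (a k' i * a k i)) = 0 := by
      have h3 : ∀ k', star (a k' i * a k i) * (a k' i * a k i) = a k i * a k' i * a k i :=
        fun k' => by
          rw [star_mul, hs, hs, mul_assoc, ← mul_assoc (a k' i), ha, mul_assoc]
      simp only [h3, sub_smul, Finset.sum_sub_distrib, ite_smul, zero_smul, Finset.sum_ite_eq',
        Finset.mem_univ, if_true, ha]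
      have h4 : ∀ k', w k' • (a k i * a k' i * a k i) = a k i * (w k' • a k' i) * a k i :=
        fun k' => by rw [mul_smul_comm, smul_mul_assoc]
      simp only [h4]
      rw [← Finset.sum_mul, ← Finset.mul_sum, h, mul_smul_comm, mul_one, smul_mul_assoc, ha,
        sub_self]
    have h3 := eq_zero_of_sum_zsmul_star_mul_self (fun k' _ => ?_) h2 (Finset.mem_univ k) ?_
    · rwa [ha] at h3
    · split_ifs with hk
      · subst hk; omega
      · have := hw k'; omega
    · rw [if_pos rfl]; omega
  -- Invariance gives `∑ w k * w i • a k i = ∑ i, w i ^ 2`, and the row sums give `∑ w k ^ 2 • a k i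
  -- = ∑ k, w k ^ 2`. The difference has nonnegative coefficients once the zero entries with `w i <
  -- w k` are dropped, so `a k i` also vanishes for `w k < w i`.
  have h2 : ∑ p : V × V, (if w p.1 ≤ w p.2 then w p.1 * (w p.2 - w p.1) else 0) •
      (star (a p.1 p.2) * a p.1 p.2) = 0 := by
    have h3 : ∀ p : V × V, (if w p.1 ≤ w p.2 then w p.1 * (w p.2 - w p.1) else 0) •
        (star (a p.1 p.2) * a p.1 p.2) =
        w p.2 • (w p.1 • a p.1 p.2) - (w p.1 * w p.1) • a p.1 p.2 := fun p => by
      rw [hs, ha, smul_smul, ← sub_smul]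
      split_ifs with hp
      · congr 1; ring
      · rw [h1 _ _ (not_le.1 hp), smul_zero, smul_zero]
    simp only [h3, Finset.sum_sub_distrib]
    rw [Fintype.sum_prod_type_right, Fintype.sum_prod_type]
    simp only [← Finset.smul_sum, h, hrow]
    simp only [smul_smul, sub_self]
  have h3 : ∀ k, w k • a k i = w i • a k i := fun k => by
    rcases lt_trichotomy (w i) (w k) with hk | hk | hk
    · rw [h1 k i hk, smul_zero, smul_zero]
    · rw [hk]
    · have h4 := eq_zero_of_sum_zsmul_star_mul_self (fun p _ => ?_) h2
        (Finset.mem_univ (k, i)) ?_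
      · change a k i = 0 at h4
        rw [h4, smul_zero, smul_zero]
      · split_ifs with hp
        · exact mul_nonneg (hw _).le (sub_nonneg.2 hp)
        · exact le_rfl
      · rw [if_pos hk.le]
        exact mul_ne_zero (hw k).ne' (sub_ne_zero.2 hk.ne')
  have h4 := h i
  simp only [h3] at h4
  rw [← Finset.smul_sum, ← Int.cast_smul_eq_zsmul ℂ, ← Int.cast_smul_eq_zsmul ℂ] at h4
  exact smul_right_injective A (by exact_mod_cast (hw i).ne' : (w i : ℂ) ≠ 0) h4

/-- If elements with orthogonal ranges and orthogonal supports add up to a projection, then they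
are projections. -/
theorem CStarAlgebra.isProjection_of_sum {A : Type*} [CStarAlgebra A] {ι : Type*} {s : Finset ι}
    {x : ι → A} {e : A} (he : star e = e) (he' : e * e = e) (hx : ∑ i ∈ s, x i = e)
    (h : ∀ i ∈ s, ∀ j ∈ s, i ≠ j → x i * star (x j) = 0 ∧ star (x i) * x j = 0) {i : ι}
    (hi : i ∈ s) : star (x i) = x i ∧ x i * x i = x i := by
  -- As `e = star e = ∑ star (x j)`, orthogonality leaves one term. It remains to show `x i * e = x
  -- i`; this follows from `∑ star (x j) * x j = e`, compressed by `1 - e`.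
  have h1 : x i * e = x i * star (x i) := by
    rw [← he, ← hx, star_sum, Finset.mul_sum, Finset.sum_eq_single i]
    · exact fun j hj hij => (h i hi j hj hij.symm).1
    · exact fun hi' => (hi' hi).elim
  have h2 : ∑ j ∈ s, star (x j) * x j = e := by
    calc _ = ∑ j ∈ s, ∑ k ∈ s, star (x j) * x k := Finset.sum_congr rfl fun j hj => by
          rw [Finset.sum_eq_single j]
          · exact fun k hk hjk => (h j hj k hk hjk.symm).2
          · exact fun hj' => (hj' hj).elim
      _ = star e * e := by
          conv_rhs => rw [← hx]
          rw [star_sum, Finset.sum_mul_sum]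
      _ = e := by rw [he, he']
  have h3 : ∑ j ∈ s, star (x j - x j * e) * (x j - x j * e) = 0 := by
    have h4 : ∀ j, star (x j - x j * e) * (x j - x j * e) =
        (1 - e) * (star (x j) * x j) * (1 - e) := fun j => by
      rw [star_sub, star_mul, he]; noncomm_ring
    simp only [h4]
    rw [← Finset.sum_mul, ← Finset.mul_sum, h2, sub_mul, one_mul, he', sub_self, zero_mul]
  have h4 := sub_eq_zero.1 (eq_zero_of_sum_star_mul_self h3 hi)
  rw [h1] at h4
  have h5 : star (x i) = x i := by
    rw [h4, star_mul, star_star]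
  refine ⟨h5, ?_⟩
  rw [h5] at h4
  exact h4.symm

/-! ### Co-representations that preserve quantum symmetry. -/

namespace Multigraph

open Classical in
theorem mult_eq_card {V : Type u} {E : Type v} [Fintype E] (G : Multigraph V E) (k l : V) :
    G.mult k l = ({e | G.src e = k ∧ G.tgt e = l} : Finset E).card := by
  rw [mult, edges, Set.ncard_eq_toFinset_card', Set.toFinset_ofPred]

variable {V : Type u} {E : Type v} [Fintype V] [Fintype E] {G : Multigraph V E}
  {A : Type w} [CStarAlgebra A] {Q : CQG A}

-- The bimodule condition, tested on point masses and written in matrix entries.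
open Classical in
theorem respectsBimodule_iff {α : FiniteCoaction Q V} {β : BiunitaryCorep Q E} :
    G.RespectsBimodule α β ↔
      (∀ σ τ i, α.mat (G.src σ) i * β.u σ τ = if i = G.src τ then β.u σ τ else 0) ∧
      ∀ σ τ j, β.u σ τ * α.mat (G.tgt σ) j = if j = G.tgt τ then β.u σ τ else 0 := by
  constructor
  · intro h
    constructor
    · intro σ τ i
      have h1 := congrFun (h (Pi.single i 1) (Pi.single τ 1)).1 σ
      rw [BiunitaryCorep.toMap_single, one_smul] at h1
      rw [FiniteCoaction.mat, ← h1]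
      simp [BiunitaryCorep.toMap, Pi.single_apply, ite_smul, eq_comm]
    · intro σ τ i
      have h1 := congrFun (h (Pi.single i 1) (Pi.single τ 1)).2 σ
      rw [BiunitaryCorep.toMap_single, one_smul] at h1
      rw [FiniteCoaction.mat, ← h1]
      simp only [BiunitaryCorep.toMap]
      rw [Finset.sum_eq_single τ (fun ρ _ hρ => by simp [hρ]) (by simp)]
      simp [Pi.single_apply, eq_comm]
  · rintro ⟨h1, h2⟩ f g
    constructor
    · ext σ
      simp only [α.toHom_apply, BiunitaryCorep.toMap, Finset.sum_mul, Finset.mul_sum,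
        smul_mul_smul_comm, h1]
      simp
    · ext σ
      simp only [α.toHom_apply, BiunitaryCorep.toMap, Finset.sum_mul, Finset.mul_sum,
        smul_mul_smul_comm, h2]
      rw [Finset.sum_comm]
      simp

theorem toMap_one_iff {β : BiunitaryCorep Q E} :
    (β.toMap (fun _ => 1) = fun _ => 1) ↔ ∀ σ, ∑ τ, β.u σ τ = 1 := by
  simp [funext_iff, BiunitaryCorep.toMap]

/-- Bichon's sense of preserving quantum symmetry implies the weaker one. -/
theorem PreservesBichon.preservesSym {β : BiunitaryCorep Q E} (h : G.PreservesBichon β) :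
    G.PreservesSym β := by
  obtain ⟨⟨γ, hγ⟩, α, hα⟩ := h
  have hγ' : ∀ σ τ, γ.mat σ τ = β.u σ τ := hγ
  have h1 : ∀ τ, ∑ σ, γ.mat σ τ = 1 := fun τ => by
    rw [← (β.isBiunitary.star_mul τ τ).trans (if_pos rfl)]
    refine Finset.sum_congr rfl fun σ _ => ?_
    rw [← hγ', γ.star_mat, γ.mat_idem]
  refine ⟨⟨⟨α, hα⟩, toMap_one_iff.2 fun σ => ?_⟩, fun σ σ' τ _ _ hσ => ?_⟩
  · simp only [← hγ', γ.sum_mat]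
  · have h2 := CStarAlgebra.mul_eq_zero_of_sum_eq_one (x := fun σ => γ.mat σ τ)
      (fun σ => γ.star_mat σ τ) (fun σ => γ.mat_idem σ τ) (h1 τ) hσ
    rw [← hγ', ← hγ', γ.star_mat, γ.star_mat]
    exact ⟨h2, h2⟩

section Banica

variable {α : FiniteCoaction Q V} {β : BiunitaryCorep Q E} (h : G.RespectsBimodule α β)
  (hβ : ∀ σ, ∑ τ, β.u σ τ = 1)

-- A vector fixed by a unitary is fixed by its adjoint.
include hβ in
theorem _root_.BiunitaryCorep.sum_col (τ : E) : ∑ σ, β.u σ τ = 1 := by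
  classical
  have h1 : ∑ σ, star (β.u σ τ) = 1 := by
    calc _ = ∑ σ, star (β.u σ τ) * ∑ ρ, β.u σ ρ := by simp only [hβ, mul_one]
      _ = ∑ ρ, ∑ σ, star (β.u σ τ) * β.u σ ρ := by
          simp only [Finset.mul_sum]; exact Finset.sum_comm
      _ = 1 := by simp [β.isBiunitary.star_mul]
  simpa using congrArg star h1

include h hβ

open Classical in
theorem RespectsBimodule.sum_src (σ : E) (i : V) :
    ∑ τ with G.src τ = i, β.u σ τ = α.mat (G.src σ) i := by
  rw [← mul_one (α.mat _ _), ← hβ σ, Finset.mul_sum, Finset.sum_filter]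
  simp only [(respectsBimodule_iff.1 h).1, eq_comm]

open Classical in
theorem RespectsBimodule.sum_tgt (σ : E) (j : V) :
    ∑ τ with G.tgt τ = j, β.u σ τ = α.mat (G.tgt σ) j := by
  rw [← one_mul (α.mat _ _), ← hβ σ, Finset.sum_mul, Finset.sum_filter]
  simp only [(respectsBimodule_iff.1 h).2, eq_comm]

/-- Summing `u σ τ` over the edges `τ` that leave `i` and over all `σ` in two ways shows that the
out-degree is an invariant weight for `α`, and likewise the in-degree. Their sum is positive because
no vertex is isolated. -/
theorem RespectsBimodule.sum_mat_col (i : V) : ∑ k, α.mat k i = 1 := by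
  classical
  have key : ∀ f : E → V, (∀ σ i, ∑ τ with f τ = i, β.u σ τ = α.mat (f σ) i) → ∀ i,
      ∑ k, (({σ | f σ = k} : Finset E).card : ℤ) • α.mat k i =
        (({σ | f σ = i} : Finset E).card : ℤ) • 1 := fun f hf i => by
    have h1 : ∀ k, (({σ | f σ = k} : Finset E).card : ℤ) • α.mat k i =
        ∑ σ with f σ = k, ∑ τ with f τ = i, β.u σ τ := fun k => by
      rw [natCast_zsmul, ← Finset.sum_const]
      refine Finset.sum_congr rfl fun σ hσ => ?_
      rw [hf, (Finset.mem_filter.1 hσ).2]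
    simp only [h1]
    refine (Finset.sum_fiberwise Finset.univ f fun σ => ∑ τ with f τ = i, β.u σ τ).trans
      (Finset.sum_comm.trans ?_)
    simp only [BiunitaryCorep.sum_col hβ, Finset.sum_const, natCast_zsmul]
  refine CStarAlgebra.sum_eq_one_of_invariant_weight α.star_mat α.mat_idem α.sum_mat
    (w := fun k => ({σ | G.src σ = k} : Finset E).card + ({σ | G.tgt σ = k} : Finset E).card)
    (fun k => ?_) (fun i => ?_) i
  · obtain ⟨e, he⟩ := G.no_isolated k
    norm_cast
    rcases he with he | he
    · exact Nat.add_pos_left (Finset.card_pos.2 ⟨e, by simpa using he⟩) _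
    · exact Nat.add_pos_right _ (Finset.card_pos.2 ⟨e, by simpa using he⟩)
  · simp only [add_smul, Finset.sum_add_distrib]
    rw [key G.src (h.sum_src hβ), key G.tgt (h.sum_tgt hβ)]

-- The bimodule relation concerns rows of `α`; orthogonality within its columns, available now that
-- they sum to `1`, transfers it to the other index.
open Classical in
theorem RespectsBimodule.mat_mul (k : V) (σ τ : E) :
    α.mat k (G.src τ) * β.u σ τ = if G.src σ = k then β.u σ τ else 0 := by
  split_ifs with hk
  · rw [← hk, (respectsBimodule_iff.1 h).1, if_pos rfl]
  · have h1 := (respectsBimodule_iff.1 h).1 σ τ (G.src τ)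
    rw [if_pos rfl] at h1
    rw [← h1, ← mul_assoc, CStarAlgebra.mul_eq_zero_of_sum_eq_one
      (x := fun k => α.mat k (G.src τ)) (fun k => α.star_mat _ _) (fun k => α.mat_idem _ _)
      (h.sum_mat_col hβ _) (Ne.symm hk), zero_mul]

open Classical in
theorem RespectsBimodule.mul_mat (l : V) (σ τ : E) :
    β.u σ τ * α.mat l (G.tgt τ) = if G.tgt σ = l then β.u σ τ else 0 := by
  split_ifs with hl
  · rw [← hl, (respectsBimodule_iff.1 h).2, if_pos rfl]
  · have h1 := (respectsBimodule_iff.1 h).2 σ τ (G.tgt τ)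
    rw [if_pos rfl] at h1
    rw [← h1, mul_assoc, CStarAlgebra.mul_eq_zero_of_sum_eq_one
      (x := fun k => α.mat k (G.tgt τ)) (fun k => α.star_mat _ _) (fun k => α.mat_idem _ _)
      (h.sum_mat_col hβ _) hl, mul_zero]

-- Multiply the column sum `1` of `u` by the two entries of `α`: exactly the edges from `k` to `l`
-- survive.
open Classical in
theorem RespectsBimodule.sum_col (k l : V) (τ : E) :
    ∑ σ with G.src σ = k ∧ G.tgt σ = l, β.u σ τ = α.mat k (G.src τ) * α.mat l (G.tgt τ) := by
  rw [← mul_one (α.mat k _), ← BiunitaryCorep.sum_col hβ τ, Finset.mul_sum, Finset.sum_mul,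
    Finset.sum_filter]
  refine Finset.sum_congr rfl fun σ _ => ?_
  rw [h.mat_mul hβ]
  by_cases h1 : G.src σ = k <;> simp [h1, h.mul_mat hβ]

open Classical in
theorem RespectsBimodule.sum_row (i j : V) (σ : E) :
    ∑ τ with G.src τ = i ∧ G.tgt τ = j, β.u σ τ = α.mat (G.src σ) i * α.mat (G.tgt σ) j := by
  rw [← mul_one (α.mat _ i), ← hβ σ, Finset.mul_sum, Finset.sum_mul, Finset.sum_filter]
  refine Finset.sum_congr rfl fun τ _ => ?_
  rw [(respectsBimodule_iff.1 h).1]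
  by_cases h1 : i = G.src τ
  · simp [h1, (respectsBimodule_iff.1 h).2, eq_comm]
  · simp [h1, Ne.symm h1]

/-- The block of `u` between the edges `k → l` and `i → j` has every row sum and every column sum
equal to this product, so the total counts it with both multiplicities. -/
theorem RespectsBimodule.mat_mul_mat_eq_zero {k l i j : V} (hm : G.mult k l ≠ G.mult i j) :
    α.mat k i * α.mat l j = 0 := by
  classical
  have h1 : G.mult k l • (α.mat k i * α.mat l j) = G.mult i j • (α.mat k i * α.mat l j) := by
    rw [mult_eq_card, mult_eq_card, ← Finset.sum_const, ← Finset.sum_const]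
    calc _ = ∑ σ with G.src σ = k ∧ G.tgt σ = l, ∑ τ with G.src τ = i ∧ G.tgt τ = j, β.u σ τ :=
          Finset.sum_congr rfl fun σ hσ => by
            rw [h.sum_row hβ, (Finset.mem_filter.1 hσ).2.1, (Finset.mem_filter.1 hσ).2.2]
      _ = ∑ τ with G.src τ = i ∧ G.tgt τ = j, ∑ σ with G.src σ = k ∧ G.tgt σ = l, β.u σ τ :=
          Finset.sum_comm
      _ = _ := Finset.sum_congr rfl fun τ hτ => by
            rw [h.sum_col hβ, (Finset.mem_filter.1 hτ).2.1, (Finset.mem_filter.1 hτ).2.2]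
  by_contra hne
  rw [← Nat.cast_smul_eq_nsmul ℂ, ← Nat.cast_smul_eq_nsmul ℂ] at h1
  exact hm (by exact_mod_cast smul_left_injective ℂ hne h1)

open Classical in
/-- The co-action on the vertices that underlies `β`, repeated on every label. -/
theorem RespectsBimodule.magic (L : G.EdgeLabeling) :
    L.Magic fun x y => if x.2 = y.2 then α.mat x.1 y.1 else 0 where
  star_eq x y := by
    split_ifs
    · exact α.star_mat _ _
    · exact star_zero A
  idem x y := by
    split_ifs
    · exact α.mat_idem _ _
    · exact mul_zero 0
  row x := by
    rw [Fintype.sum_prod_type]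
    simp [α.sum_mat]
  col y := by
    rw [Fintype.sum_prod_type]
    simp [h.sum_mat_col hβ]
  vertex k i s s' := by simp
  edge e x y hxy := by
    obtain ⟨k, s⟩ := x
    obtain ⟨l, s'⟩ := y
    change (if s = L.lab e then α.mat k (G.src e) else 0) *
      (if s' = L.lab e then α.mat l (G.tgt e) else 0) = 0
    by_cases h1 : s = L.lab e
    · by_cases h2 : s' = L.lab e
      · rw [if_pos h1, if_pos h2]
        refine h.mat_mul_mat_eq_zero hβ fun hm => hxy ?_
        rw [h1, h2]
        -- Equal multiplicities make the label of `e` available between `k` and `l`.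
        exact L.edgePair_of_lt (hm ▸ L.lab_lt e)
      · rw [if_neg h2, mul_zero]
    · rw [if_neg h1, zero_mul]

/-- If the entries of the matrix on the edges over `Q` are self-adjoint, then every co-action that
preserves quantum symmetry does so in Bichon's sense. -/
theorem RespectsBimodule.preservesBichon (L : G.EdgeLabeling)
    (hL : ∀ σ τ, star (L.edgeGens σ τ) = L.edgeGens σ τ) (hr : G.RestrictedOrthogonality β) :
    G.PreservesBichon β := by
  classical
  have h1 : ∀ σ τ, star (α.mat (G.src σ) (G.src τ) * α.mat (G.tgt σ) (G.tgt τ)) =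
      α.mat (G.src σ) (G.src τ) * α.mat (G.tgt σ) (G.tgt τ) := fun σ τ => by
    -- Pass to the parallel edges with label `0`: equal labels make the `δ` in the magic matrix
    -- equal to `1`, and `α` sees only the endpoints.
    obtain ⟨σ', hσ, hσ', h0⟩ := L.exists_edge ((Nat.zero_le _).trans_lt (L.lab_lt σ))
    obtain ⟨τ', hτ, hτ', h0'⟩ := L.exists_edge ((Nat.zero_le _).trans_lt (L.lab_lt τ))
    have h2 : L.lab σ' = L.lab τ' := Fin.ext (h0.trans h0'.symm)
    have h3 := congrArg (h.magic hβ L).hom (hL σ' τ')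
    rw [map_star, EdgeLabeling.edgeGens, map_mul, EdgeLabeling.Magic.hom_gens,
      EdgeLabeling.Magic.hom_gens] at h3
    simpa only [EdgeLabeling.s, EdgeLabeling.t, h2, if_true, hσ, hσ', hτ, hτ'] using h3
  have h2 : ∀ σ τ, star (β.u σ τ) = β.u σ τ ∧ β.u σ τ * β.u σ τ = β.u σ τ := fun σ τ => by
    refine CStarAlgebra.isProjection_of_sum (x := fun σ => β.u σ τ) (h1 σ τ) ?_
      (h.sum_col hβ (G.src σ) (G.tgt σ) τ) ?_ (by simp)
    -- Self-adjointness says that the two projections commute, so their product is a projection.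
    · nth_rw 1 [← h1 σ τ]
      rw [star_mul, α.star_mat, α.star_mat, mul_assoc, ← mul_assoc (α.mat (G.src σ) _),
        α.mat_idem]
      have h3 := h1 σ τ
      rw [star_mul, α.star_mat, α.star_mat] at h3
      rw [← mul_assoc, h3, mul_assoc, α.mat_idem]
    · intro ρ hρ ρ' hρ' hne
      simp only [Finset.mem_filter_univ] at hρ hρ'
      exact hr ρ ρ' τ (hρ.1.trans hρ'.1.symm) (hρ.2.trans hρ'.2.symm) hne
  refine ⟨⟨FiniteCoaction.ofMatrix β.u (fun σ τ => (h2 σ τ).1) (fun σ τ => (h2 σ τ).2) hβ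
    (BiunitaryCorep.sum_col hβ) β.comul, fun σ τ => ?_⟩, α, h⟩
  refine (FiniteCoaction.ofMatrix_apply (fun σ τ => β.u σ τ) _ _ _ _ _ _ _).trans ?_
  simp [Pi.single_apply]

end Banica

/-! ### The co-representation of `Q'` on the edge space. -/

namespace EdgeLabeling

variable (L : G.EdgeLabeling)

theorem comul_vtx (k i : V) : L.comul (L.vtx L.gens k i) =
    ∑ j, MinTensor.tmul (L.vtx L.gens k j) (L.vtx L.gens j i) := by
  have h := L.magic_gens
  have h0 : L.vtx L.gens k i = ∑ r, L.gens (k, L.label k) (i, r) := rfl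
  rw [h0]
  simp only [map_sum, comul_gens]
  rw [Finset.sum_comm, Fintype.sum_prod_type]
  simp only [← MinTensor.tmul_sum, h.sum_right, ← MinTensor.sum_tmul]

theorem toQ'_vtx (k i : V) : L.toQ' (L.vtx L.gens k i) = ⟨L.vtx L.gens k i, L.vtx_mem k i⟩ := by
  refine Subtype.ext ?_
  change ((L.toQ' (∑ r, L.gens (k, L.label k) (i, r)) : L.Q') : L.Q) = L.vtx L.gens k i
  rw [map_sum, AddSubmonoidClass.coe_finsetSum]
  refine Eq.trans ?_ (L.magic_gens.sum_retract k i (L.label k))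
  exact Finset.sum_congr rfl fun r _ => congrArg Subtype.val (Magic.hom_gens _ _ _)

/-- The co-action of `Q'` on the vertices. -/
noncomputable def vertexCoaction : FiniteCoaction L.cqg' V :=
  FiniteCoaction.ofMatrix (fun k i => ⟨L.vtx L.gens k i, L.vtx_mem k i⟩)
    (fun k i => Subtype.ext (L.magic_gens.star_vtx k i))
    (fun k i => Subtype.ext (L.magic_gens.vtx_idem k i))
    (fun k => Subtype.ext (by simpa using L.magic_gens.sum_vtx_right k))
    (fun i => Subtype.ext (by simpa using L.magic_gens.sum_vtx_left i))
    fun k i => by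
      change MinTensor.map L.toQ' L.toQ' (L.comul (L.vtx L.gens k i)) = _
      simp only [comul_vtx, map_sum, MinTensor.map_tmul, toQ'_vtx]

theorem vertexCoaction_mat (k i : V) :
    (L.vertexCoaction.mat k i : L.Q) = L.vtx L.gens k i := by
  classical
  rw [FiniteCoaction.mat, vertexCoaction, FiniteCoaction.ofMatrix_apply]
  simp [Pi.single_apply]

theorem preservesSym : G.PreservesSym L.edgeCorep := by
  classical
  have h := L.magic_gens
  have hu : ∀ σ τ, ((L.edgeCorep.u σ τ : L.Q') : L.Q) =
      L.gens (L.s σ) (L.s τ) * L.gens (L.t σ) (L.t τ) := fun σ τ => rfl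
  refine ⟨⟨⟨L.vertexCoaction, respectsBimodule_iff.2 ⟨fun σ τ i => Subtype.ext ?_,
    fun σ τ j => Subtype.ext ?_⟩⟩, toMap_one_iff.2 fun σ => Subtype.ext ?_⟩,
    fun σ σ' τ hs ht hσ => ⟨Subtype.ext ?_, Subtype.ext ?_⟩⟩
  · rw [MulMemClass.coe_mul, vertexCoaction_mat]
    split_ifs with hi
    · rw [hu, ← mul_assoc, hi]
      exact congrArg (· * _) (h.vtx_mul_self _ _ _ _)
    · rw [hu, ← mul_assoc]
      have h1 : L.vtx L.gens (G.src σ) i * L.gens (L.s σ) (L.s τ) = 0 := by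
        have h2 : L.gens (L.s σ) (L.s τ) =
          L.vtx L.gens (G.src σ) (G.src τ) * L.gens (L.s σ) (L.s τ) :=
            (h.vtx_mul_self _ _ _ _).symm
        rw [h2, ← mul_assoc, h.vtx_row_orth _ hi, zero_mul]
      rw [h1, zero_mul]
      rfl
  · rw [MulMemClass.coe_mul, vertexCoaction_mat]
    split_ifs with hj
    · rw [hu, mul_assoc, hj]
      exact congrArg (_ * ·) (h.mul_vtx_self _ _ _ _)
    · have h1 : L.gens (L.t σ) (L.t τ) * L.vtx L.gens (G.tgt σ) j = 0 := by
        have h2 : L.gens (L.t σ) (L.t τ) =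
          L.gens (L.t σ) (L.t τ) * L.vtx L.gens (G.tgt σ) (G.tgt τ) :=
            (h.mul_vtx_self _ _ _ _).symm
        rw [h2, mul_assoc, h.vtx_row_orth _ (Ne.symm hj), mul_zero]
      rw [hu, mul_assoc, h1, mul_zero]
      rfl
  · rw [AddSubmonoidClass.coe_finsetSum]
    -- Row sums of the edge matrix are column sums for the transpose.
    exact h.transpose.sum_edge_col σ
  · change L.gens (L.s σ) (L.s τ) * L.gens (L.t σ) (L.t τ) *
      star (L.gens (L.s σ') (L.s τ) * L.gens (L.t σ') (L.t τ)) = 0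
    rw [star_mul, h.star_eq, h.star_eq, mul_assoc, ← mul_assoc (L.gens (L.t σ) _),
      h.col_orth, zero_mul, mul_zero]
    -- Parallel edges with the same labelled target have the same label, hence coincide; so distinct
    -- ones give orthogonal entries in a column.
    intro h'
    have hl : L.lab σ = L.lab σ' := congrArg Prod.snd h'
    exact hσ (L.ext_edge (Prod.ext hs hl) ht)
  · change star (L.gens (L.s σ) (L.s τ) * L.gens (L.t σ) (L.t τ)) *
      (L.gens (L.s σ') (L.s τ) * L.gens (L.t σ') (L.t τ)) = 0
    rw [star_mul, h.star_eq, h.star_eq, mul_assoc, ← mul_assoc (L.gens (L.s σ) _),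
      h.col_orth, zero_mul, mul_zero]
    exact fun h' => hσ (L.ext_edge h' ht)

theorem faithful : L.edgeCorep.Faithful := L.edgeMatrix_generates

/-- The matrix of a co-action on `C(E)` is self-adjoint entrywise. So the edge coefficients in `Q`
are self-adjoint, and this relation is transported by homomorphisms to every object that preserves
quantum symmetry. -/
theorem catBic_eq_catSym (h : G.PreservesBichon L.edgeCorep) :
    G.catBic = (G.catSym : Set (EdgeCorep.{v, w} E)) := by
  obtain ⟨⟨γ, hγ⟩, -⟩ := h
  have hL : ∀ σ τ, star (L.edgeGens σ τ) = L.edgeGens σ τ := fun σ τ => by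
    have h1 : γ.mat σ τ = L.edgeCorep.u σ τ := hγ σ τ
    exact congrArg Subtype.val (h1 ▸ γ.star_mat σ τ)
  ext X
  let _ := X.cstar
  refine ⟨fun hX => PreservesBichon.preservesSym (A := X.A) hX, ?_⟩
  rintro ⟨⟨⟨α, hα⟩, h1⟩, hr⟩
  exact hα.preservesBichon (toMap_one_iff.1 h1) L hL hr

end EdgeLabeling

end Multigraph

theorem mainTheorem5 {V : Type u} {E : Type v} [Fintype V] [Fintype E] (G : Multigraph V E)
    (L : G.EdgeLabeling) :
    L.Q' = (StarAlgebra.adjoin ℂ (Set.range fun p : E × E =>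
      L.q (G.src p.1) (L.lab p.1) (G.src p.2) (L.lab p.2) *
        L.q (G.tgt p.1) (L.lab p.1) (G.tgt p.2) (L.lab p.2))).topologicalClosure ∧
    ∃ Δ : CQG L.Q,
      (∀ k s i r, Δ.comul (L.q k s i r) =
        ∑ k', ∑ s', MinTensor.tmul (L.q k s k' s') (L.q k' s' i r)) ∧
      ∃ Δ' : CQG L.Q', Δ.IsWoronowiczSub L.Q' Δ' ∧
        ∃ β : BiunitaryCorep Δ' E,
          (∀ σ τ, ((β.u σ τ : L.Q') : L.Q) =
            L.q (G.src σ) (L.lab σ) (G.src τ) (L.lab τ) *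
              L.q (G.tgt σ) (L.lab σ) (G.tgt τ) (L.lab τ)) ∧
          β.Faithful ∧
          (⟨L.Q', Δ', β⟩ : EdgeCorep E) ∈ G.catSym ∧
          (G.catBic ≠ (G.catSym : Set (EdgeCorep.{v, w} E)) →
            (⟨L.Q', Δ', β⟩ : EdgeCorep E) ∉ G.catBic) := by
  refine ⟨L.Q'_eq, L.cqg, fun k s i r => ?_, L.cqg', L.isWoronowiczSub, L.edgeCorep,
    fun _ _ => rfl, L.faithful, L.preservesSym, fun hne h => hne (L.catBic_eq_catSym h)⟩
  rw [← Fintype.sum_prod_type' (f := fun k' s' =>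
    MinTensor.tmul (L.q k s k' s') (L.q k' s' i r))]
  exact L.comul_gens (k, s) (i, r)
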